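/- Let $N\in\mathbb N$ and let $\gamma$ be a smooth ($C^1$, regular), oriented, non self-intersecting curve in $\mathbb C$ without end points, both of whose ends go to infinity. Let $W$ be a regular $N\times N$ matrix of weights on $\gamma$: the moments $W_k=\frac1{2\pi i}\int_\gamma z^kW(z)\,dz$ converge absolutely and $\det[W_{j+k}]_{j,k=0}^{m}\neq0$ for all $m\in\mathbb N$. Suppose that $W=W^{\mathsf L}W^{\mathsf R}$ on $\gamma$, where $W^{\mathsf L},W^{\mathsf R}$ are matrices of entire functions with $\det W^{\mathsf L}\not\equiv0$, $\det W^{\mathsf R}\not\equiv 0$, whose logarithmic derivatives $h^{\mathsf L}=(W^{\mathsf L})'(W^{\mathsf L})^{-1}$ and $h^{\mathsf R}=(W^{\mathsf R})^{-1}(W^{\mathsf R})'$ are entire. Let $P_n^{\mathsf L},P_n^{\mathsf R}$ be the monic matrix polynomials of degree $n$ with $$\frac1{2\pi i}\int_\gamma P_n^{\mathsf L}(z)W(z)z^k\,dz=\delta_{n,k}C_n^{-1}=\frac1{2\pi i}\int_\gamma z^kW(z)P_n^{\mathsf R}(z)\,dz,\qquad 0\le k\le n,$$ with $C_n$ nonsingular,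 and for $z\notin\gamma$ let $$Q_n^{\mathsf L}(z)=\frac1{2\pi i}\int_\gamma\frac{P_n^{\mathsf L}(w)W(w)}{w-z}\,dw,\qquad Q_n^{\mathsf R}(z)=\frac1{2\pi i}\int_\gamma\frac{W(w)P_n^{\mathsf R}(w)}{w-z}\,dw .$$ Put $$Y_n^{\mathsf L}=\begin{bmatrix}P_n^{\mathsf L}&Q_n^{\mathsf L}\\-C_{n-1}P_{n-1}^{\mathsf L}&-C_{n-1}Q_{n-1}^{\mathsf L}\end{bmatrix},\qquad Y_n^{\mathsf R}=\begin{bmatrix}P_n^{\mathsf R}&-P_{n-1}^{\mathsf R}C_{n-1}\\Q_n^{\mathsf R}&-Q_{n-1}^{\mathsf R}C_{n-1}\end{bmatrix},$$ where for $n=0$ the entries with index $-1$ are read with $C_{-1}P^{\mathsf L}_{-1}=P^{\mathsf R}_{-1}C_{-1}=0$ and $-C_{-1}Q^{\mathsf L}_{-1}=-Q^{\mathsf R}_{-1}C_{-1}=I$. Put $$S_n^{\mathsf L}=Y_n^{\mathsf L}\begin{bmatrix}z^{-n}I&0\\0&z^{n}I\end{bmatrix},\quad S_n^{\mathsf R}=\begin{bmatrix}z^{-n}I&0\\0&z^{n}I\end{bmatrix}Y_n^{\mathsf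 R},\quad Z_n^{\mathsf L}=Y_n^{\mathsf L}\begin{bmatrix}W^{\mathsf L}&0\\0&(W^{\mathsf R})^{-1}\end{bmatrix},\quad Z_n^{\mathsf R}=\begin{bmatrix}W^{\mathsf R}&0\\0&(W^{\mathsf L})^{-1}\end{bmatrix}Y_n^{\mathsf R},$$ and define the structure matrices, on $\mathbb C\setminus\gamma$, by $M_n^{\mathsf L}=(Z_n^{\mathsf L})'(Z_n^{\mathsf L})^{-1}$ and $M_n^{\mathsf R}=(Z_n^{\mathsf R})^{-1}(Z_n^{\mathsf R})'$. Asymptotic expansions at infinity, $F(z)\sim\sum_{l\ge0}a_lz^{-l}$, are meant as $z\to\infty$ away from $\gamma$: for all $c>0$ and $k,K\in\mathbb N$, $F(z)-\sum_{l<K}a_lz^{-l}=O(|z|^{-K})$ as $z\to\infty$ in $\{\operatorname{dist}(z,\gamma)\ge c|z|^{-k}\}$. The relation $E=(F)_{\boldsymbol+}$ means that $E$ is entire and $F-E\sim\sum_{l\ge1}a_lz^{-l}$ for some matrices $a_l$. Then, for every $n\in\mathbb N$, all these objects are well defined: $P_n^{\mathsf L},P_n^{\mathsf R}$ exist, $C_n$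 is nonsingular, $W^{\mathsf L},W^{\mathsf R}$ are invertible everywhere and $Y_n^{\mathsf L},Y_n^{\mathsf R}$ are invertible off $\gamma$. Moreover: 1. $M_n^{\mathsf L}$ and $M_n^{\mathsf R}$ extend to matrices of entire functions, and $$M_n^{\mathsf L}=\Big(S_n^{\mathsf L}\begin{bmatrix}h^{\mathsf L}&0\\0&-h^{\mathsf R}\end{bmatrix}(S_n^{\mathsf L})^{-1}\Big)_{\boldsymbol+},\qquad M_n^{\mathsf R}=\Big((S_n^{\mathsf R})^{-1}\begin{bmatrix}h^{\mathsf R}&0\\0&-h^{\mathsf L}\end{bmatrix}S_n^{\mathsf R}\Big)_{\boldsymbol+}.$$ 2. $S_n^{\mathsf L}\sim\sum_{l\ge0} s^{\mathsf L}_lz^{-l}$ and $S_n^{\mathsf R}\sim\sum_{l\ge0} s^{\mathsf R}_lz^{-l}$ with $s_0^{\mathsf L}=s_0^{\mathsf R}=I$, where the $s_l^{\mathsf L},s_l^{\mathsf R}$ are obtained by expanding the entries of $S_n^{\mathsf L},S_n^{\mathsf R}$ (coefficients of the polynomials, and moments $\frac1{2\pi i}\int_\gamma P_m^{\mathsf L}Wz^k\,dz$,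 $\frac1{2\pi i}\int_\gamma z^kWP_m^{\mathsf R}\,dz$ for $m\in\{n-1,n\}$). Also $(S_n^{\mathsf L})^{-1}\sim\sum_l t^{\mathsf L}_lz^{-l}$ and $(S_n^{\mathsf R})^{-1}\sim\sum_l t^{\mathsf R}_lz^{-l}$, where $\sum_l t_l x^{l}$ is the formal inverse of $\sum_l s_lx^{l}$. 3. If $h^{\mathsf L}(z)=\sum_l h^{\mathsf L}_lz^l$ and $h^{\mathsf R}(z)=\sum_l h^{\mathsf R}_lz^l$ are matrix polynomials, then $M_n^{\mathsf L},M_n^{\mathsf R}$ are matrix polynomials of degree $\max(\deg h^{\mathsf L},\deg h^{\mathsf R})$. With $d=\max(\deg h^{\mathsf L},\deg h^{\mathsf R})$ (the zero polynomial counting as degree $0$ in $d$) their coefficients of $z^k$ are $$\sum_{l=k}^{d}\ \sum_{i+j=l-k}s^{\mathsf L}_i\begin{bmatrix}h^{\mathsf L}_l&0\\0&-h^{\mathsf R}_l\end{bmatrix}t^{\mathsf L}_j\qquad\text{and}\qquad\sum_{l=k}^{d}\ \sum_{i+j=l-k}t^{\mathsf R}_i\begin{bmatrix}h^{\mathsf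 R}_l&0\\0&-h^{\mathsf L}_l\end{bmatrix}s^{\mathsf R}_j,$$ so that only $s_0,\dots,s_d$ are involved. -/

import Mathlib

open Filter Asymptotics Bornology
open scoped Topology Polynomial

noncomputable section

/-- `N × N` complex matrices. -/
abbrev Mat (N : ℕ) : Type := Matrix (Fin N) (Fin N) ℂ

/-- `2N × 2N` complex matrices, seen as `2 × 2` block matrices with blocks of size `N`. -/
abbrev BMat (N : ℕ) : Type := Matrix (Fin N ⊕ Fin N) (Fin N ⊕ Fin N) ℂ

/-- Entrywise complex derivative of a matrix function. -/
def matDeriv {m : Type*} (F : ℂ → Matrix m m ℂ) (z : ℂ) : Matrix m m ℂ :=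
  Matrix.of fun i j => deriv (fun w => F w i j) z

/-- A matrix of entire functions. -/
def IsEntireMat {m : Type*} (F : ℂ → Matrix m m ℂ) : Prop :=
  ∀ i j, Differentiable ℂ (fun z => F z i j)

/-- The value at the complex number `z` of a polynomial with matrix coefficients. -/
def matEval {m : Type*} [Fintype m] [DecidableEq m] (P : (Matrix m m ℂ)[X]) (z : ℂ) :
    Matrix m m ℂ :=
  P.eval (algebraMap ℂ (Matrix m m ℂ) z)

/-! ### Curves, weights, moments -/

/-- A smooth, oriented, non self-intersecting curve without end points, both of whose ends go to
infinity, given by a regular parametrization. -/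
structure IsSmoothLine (γ : ℝ → ℂ) : Prop where
  contDiff : ContDiff ℝ 1 γ
  deriv_ne_zero : ∀ t, deriv γ t ≠ 0
  injective : Function.Injective γ
  proper : Tendsto γ (cocompact ℝ) (cocompact ℂ)

/-- `(2πi)⁻¹ ∫_γ F(z) dz`, entry by entry. -/
def curveInt {N : ℕ} (γ : ℝ → ℂ) (F : ℂ → Mat N) : Mat N :=
  Matrix.of fun i j =>
    (2 * (Real.pi : ℂ) * Complex.I)⁻¹ * ∫ t : ℝ, F (γ t) i j * deriv γ t

/-- `W` is a matrix of weights on `γ`: all the moment integrals converge (absolutely). -/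
def IsWeight {N : ℕ} (γ : ℝ → ℂ) (W : ℂ → Mat N) : Prop :=
  ∀ (k : ℕ) (i j : Fin N),
    MeasureTheory.Integrable (fun t : ℝ => (γ t) ^ k * W (γ t) i j * deriv γ t)

/-- The moment of order `n` of `W`. -/
def moment {N : ℕ} (γ : ℝ → ℂ) (W : ℂ → Mat N) (n : ℕ) : Mat N :=
  curveInt γ fun z => z ^ n • W z

/-- The block Hankel matrix `[W_{j+k}]_{j,k = 0, …, n}`. -/
def hankel {N : ℕ} (γ : ℝ → ℂ) (W : ℂ → Mat N) (n : ℕ) :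
    Matrix (Fin (n + 1) × Fin N) (Fin (n + 1) × Fin N) ℂ :=
  Matrix.of fun p q => moment γ W ((p.1 : ℕ) + (q.1 : ℕ)) p.2 q.2

/-- Regularity of a matrix of weights. -/
def IsRegularWeight {N : ℕ} (γ : ℝ → ℂ) (W : ℂ → Mat N) : Prop :=
  ∀ n : ℕ, (hankel γ W n).det ≠ 0

/-! ### Biorthogonal polynomials and functions of the second kind -/

/-- `P` is a monic matrix polynomial of degree `n` that is left orthogonal with respect to `W`. -/
structure IsLeftOP {N : ℕ} (γ : ℝ → ℂ) (W : ℂ → Mat N) (n : ℕ) (P : (Mat N)[X]) : Prop where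
  natDegree_le : P.natDegree ≤ n
  coeff_self : P.coeff n = 1
  orthogonal : ∀ k < n, curveInt γ (fun z => z ^ k • (matEval P z * W z)) = 0

/-- `P` is a monic matrix polynomial of degree `n` that is right orthogonal with respect to `W`. -/
structure IsRightOP {N : ℕ} (γ : ℝ → ℂ) (W : ℂ → Mat N) (n : ℕ) (P : (Mat N)[X]) : Prop where
  natDegree_le : P.natDegree ≤ n
  coeff_self : P.coeff n = 1
  orthogonal : ∀ k < n, curveInt γ (fun z => z ^ k • (W z * matEval P z)) = 0

/-- The left orthogonal polynomial `P_n^L` (it exists and is unique when `W` is regular). -/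
def leftOP {N : ℕ} (γ : ℝ → ℂ) (W : ℂ → Mat N) (n : ℕ) : (Mat N)[X] :=
  Classical.epsilon (IsLeftOP γ W n)

/-- The right orthogonal polynomial `P_n^R` (it exists and is unique when `W` is regular). -/
def rightOP {N : ℕ} (γ : ℝ → ℂ) (W : ℂ → Mat N) (n : ℕ) : (Mat N)[X] :=
  Classical.epsilon (IsRightOP γ W n)

/-- `(2πi)⁻¹ ∫_γ P_n^L(z) W(z) z^k dz`. -/
def leftMoment {N : ℕ} (γ : ℝ → ℂ) (W : ℂ → Mat N) (n k : ℕ) : Mat N :=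
  curveInt γ fun z => z ^ k • (matEval (leftOP γ W n) z * W z)

/-- `(2πi)⁻¹ ∫_γ z^k W(z) P_n^R(z) dz`. -/
def rightMoment {N : ℕ} (γ : ℝ → ℂ) (W : ℂ → Mat N) (n k : ℕ) : Mat N :=
  curveInt γ fun z => z ^ k • (W z * matEval (rightOP γ W n) z)

/-- The matrix `C_n`, defined by `(2πi)⁻¹ ∫_γ P_n^L(z) W(z) z^n dz = C_n⁻¹`. -/
def normMat {N : ℕ} (γ : ℝ → ℂ) (W : ℂ → Mat N) (n : ℕ) : Mat N :=
  (leftMoment γ W n n)⁻¹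

/-- The left function of the second kind `Q_n^L`. -/
def leftQ {N : ℕ} (γ : ℝ → ℂ) (W : ℂ → Mat N) (n : ℕ) (z : ℂ) : Mat N :=
  curveInt γ fun w => (w - z)⁻¹ • (matEval (leftOP γ W n) w * W w)

/-- The right function of the second kind `Q_n^R`. -/
def rightQ {N : ℕ} (γ : ℝ → ℂ) (W : ℂ → Mat N) (n : ℕ) (z : ℂ) : Mat N :=
  curveInt γ fun w => (w - z)⁻¹ • (W w * matEval (rightOP γ W n) w)

/-! ### Fundamental matrices

For `n = 0` the conventions are `P_{-1} = 0` and `Q_{-1} = - C_{-1}⁻¹`, so that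
`- C_{-1} P_{-1} = 0` and `- C_{-1} Q_{-1} = I`. -/

/-- The left fundamental matrix `Y_n^L`. -/
def leftY {N : ℕ} (γ : ℝ → ℂ) (W : ℂ → Mat N) : ℕ → ℂ → BMat N
  | 0, z => Matrix.fromBlocks (matEval (leftOP γ W 0) z) (leftQ γ W 0 z) 0 1
  | n + 1, z =>
      Matrix.fromBlocks
        (matEval (leftOP γ W (n + 1)) z) (leftQ γ W (n + 1) z)
        (-(normMat γ W n * matEval (leftOP γ W n) z)) (-(normMat γ W n * leftQ γ W n z))

/-- The right fundamental matrix `Y_n^R`. -/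
def rightY {N : ℕ} (γ : ℝ → ℂ) (W : ℂ → Mat N) : ℕ → ℂ → BMat N
  | 0, z => Matrix.fromBlocks (matEval (rightOP γ W 0) z) 0 (rightQ γ W 0 z) 1
  | n + 1, z =>
      Matrix.fromBlocks
        (matEval (rightOP γ W (n + 1)) z) (-(matEval (rightOP γ W n) z * normMat γ W n))
        (rightQ γ W (n + 1) z) (-(rightQ γ W n z * normMat γ W n))

/-- The normalized left fundamental matrix `S_n^L = Y_n^L diag(z^{-n} I, z^n I)`. -/
def leftS {N : ℕ} (γ : ℝ → ℂ) (W : ℂ → Mat N) (n : ℕ) (z : ℂ) : BMat N :=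
  leftY γ W n z * Matrix.fromBlocks ((z ^ n)⁻¹ • (1 : Mat N)) 0 0 (z ^ n • (1 : Mat N))

/-- The normalized right fundamental matrix `S_n^R = diag(z^{-n} I, z^n I) Y_n^R`. -/
def rightS {N : ℕ} (γ : ℝ → ℂ) (W : ℂ → Mat N) (n : ℕ) (z : ℂ) : BMat N :=
  Matrix.fromBlocks ((z ^ n)⁻¹ • (1 : Mat N)) 0 0 (z ^ n • (1 : Mat N)) * rightY γ W n z

/-! ### Logarithmic derivatives, constant jump matrices and structure matrices -/

/-- The right logarithmic derivative `F' F⁻¹`. -/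
def rightLogDeriv {m : Type*} [Fintype m] [DecidableEq m] (F : ℂ → Matrix m m ℂ) (z : ℂ) :
    Matrix m m ℂ :=
  matDeriv F z * (F z)⁻¹

/-- The left logarithmic derivative `F⁻¹ F'`. -/
def leftLogDeriv {m : Type*} [Fintype m] [DecidableEq m] (F : ℂ → Matrix m m ℂ) (z : ℂ) :
    Matrix m m ℂ :=
  (F z)⁻¹ * matDeriv F z

/-- `Z_n^L = Y_n^L diag(W^L, (W^R)⁻¹)`. -/
def leftZ {N : ℕ} (γ : ℝ → ℂ) (W WL WR : ℂ → Mat N) (n : ℕ) (z : ℂ) : BMat N :=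
  leftY γ W n z * Matrix.fromBlocks (WL z) 0 0 (WR z)⁻¹

/-- `Z_n^R = diag(W^R, (W^L)⁻¹) Y_n^R`. -/
def rightZ {N : ℕ} (γ : ℝ → ℂ) (W WL WR : ℂ → Mat N) (n : ℕ) (z : ℂ) : BMat N :=
  Matrix.fromBlocks (WR z) 0 0 (WL z)⁻¹ * rightY γ W n z

/-- The left structure matrix `M_n^L = (Z_n^L)' (Z_n^L)⁻¹`, for `z` off the curve. -/
def leftM {N : ℕ} (γ : ℝ → ℂ) (W WL WR : ℂ → Mat N) (n : ℕ) (z : ℂ) : BMat N :=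
  rightLogDeriv (leftZ γ W WL WR n) z

/-- The right structure matrix `M_n^R = (Z_n^R)⁻¹ (Z_n^R)'`, for `z` off the curve. -/
def rightM {N : ℕ} (γ : ℝ → ℂ) (W WL WR : ℂ → Mat N) (n : ℕ) (z : ℂ) : BMat N :=
  leftLogDeriv (rightZ γ W WL WR n) z

/-! ### Asymptotic expansions at infinity -/

/-- `F(z) ∼ ∑_{l ≥ 0} a_l z^{-l}` as `z → ∞` away from the closed set `Γ`: for all `c > 0` and
all `k`, the remainder of every order `K` is `O(|z|^{-K})` as `z → ∞` in the region where
`dist(z, Γ) ≥ c |z|^{-k}`. -/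
def HasAsymptoticExpansion {m : Type*} (Γ : Set ℂ) (F : ℂ → Matrix m m ℂ)
    (a : ℕ → Matrix m m ℂ) : Prop :=
  ∀ c : ℝ, 0 < c → ∀ k K : ℕ, ∀ i j,
    (fun z : ℂ => F z i j - ∑ l ∈ Finset.range K, a l i j * (z ^ l)⁻¹)
      =O[cobounded ℂ ⊓ 𝓟 {z : ℂ | c ≤ ‖z‖ ^ k * Metric.infDist z Γ}]
        fun z : ℂ => (‖z‖ ^ K)⁻¹

/-- `E = (F)_+`: the function `E` is the sum of an everywhere convergent series in the
nonnegative powers of `z` (a matrix of entire functions), and what remains of the expansion of `F`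
at infinity, that is `F - E`, has an asymptotic expansion in the powers `z^{-1}, z^{-2}, …`. -/
def IsPlusPart {m : Type*} (Γ : Set ℂ) (F E : ℂ → Matrix m m ℂ) : Prop :=
  IsEntireMat E ∧
    ∃ a : ℕ → Matrix m m ℂ, a 0 = 0 ∧ HasAsymptoticExpansion Γ (fun z => F z - E z) a

/-- The coefficient of `z^{-l}` in the asymptotic expansion of `S_n^L` at infinity. -/
def leftSCoeff {N : ℕ} (γ : ℝ → ℂ) (W : ℂ → Mat N) : ℕ → ℕ → BMat N
  | _, 0 => 1
  | 0, l + 1 => Matrix.fromBlocks 0 (-leftMoment γ W 0 l) 0 0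
  | n + 1, l + 1 =>
      Matrix.fromBlocks
        (if l ≤ n then (leftOP γ W (n + 1)).coeff (n - l) else 0)
        (-leftMoment γ W (n + 1) (n + 1 + l))
        (if l ≤ n then -(normMat γ W n * (leftOP γ W n).coeff (n - l)) else 0)
        (normMat γ W n * leftMoment γ W n (n + 1 + l))

/-- The coefficient of `z^{-l}` in the asymptotic expansion of `S_n^R` at infinity. -/
def rightSCoeff {N : ℕ} (γ : ℝ → ℂ) (W : ℂ → Mat N) : ℕ → ℕ → BMat N
  | _, 0 => 1
  | 0, l + 1 => Matrix.fromBlocks 0 0 (-rightMoment γ W 0 l) 0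
  | n + 1, l + 1 =>
      Matrix.fromBlocks
        (if l ≤ n then (rightOP γ W (n + 1)).coeff (n - l) else 0)
        (if l ≤ n then -((rightOP γ W n).coeff (n - l) * normMat γ W n) else 0)
        (-rightMoment γ W (n + 1) (n + 1 + l))
        (rightMoment γ W n (n + 1 + l) * normMat γ W n)

/-- The coefficients of the formal inverse of `1 + s_1 x + s_2 x² + ⋯`; the `l`-th one depends
only on `s_1, …, s_l`. -/
def invCoeff {R : Type*} [Ring R] (s : ℕ → R) : ℕ → R
  | 0 => 1
  | l + 1 => -∑ i : Fin (l + 1), s (l + 1 - (i : ℕ)) * invCoeff s (i : ℕ)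
  termination_by l => l
  decreasing_by exact i.2

/-- The coefficient of `z^k` in the formal product
`(∑_i a_i z^{-i}) (∑_{l ≤ d} H_l z^l) (∑_j b_j z^{-j})`; for `k ≥ 0` it involves only
`a_0, …, a_d` and `b_0, …, b_d`. -/
def prodCoeff {R : Type*} [Ring R] (a : ℕ → R) (H : ℕ → R) (d : ℕ) (b : ℕ → R) (k : ℕ) : R :=
  ∑ l ∈ Finset.Icc k d, ∑ i ∈ Finset.range (l - k + 1), a i * H l * b (l - k - i)

end

/-! Let F(z) = (2πi)⁻¹ ∫_γ W(w)/(w - z) dw. Since (P(w) - P(z))/(w - z) is a polynomial in z, Q_n^L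
equals P_n^L F plus a polynomial, and Y_n^L = V_n [[1, F], [0, 1]] with a matrix polynomial V_n
(`leftY_eq`). The same identity holds for Laurent series in z⁻¹, with F replaced by its formal
expansion; orthogonality then says exactly that S_n^L becomes a power series in z⁻¹ with constant
term I (`formalS_eq`).

Inverses. Transposing W exchanges the left and right objects, and b ↦ J bᵀ J⁻¹ is an
anti-automorphism. Applied to V_n for the weight Wᵀ it gives a polynomial U_n such that V_n U_n is
also a power series in z⁻¹ with constant term 1; a polynomial of this kind is constant, so V_n U_n =
1 (`fundPoly_mul_inv`). This algebraic form of Liouville's theorem replaces the Riemann-Hilbert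
argument. It yields (Y_n^L)⁻¹ = J Y_n^R J⁻¹, so every statement on the right follows from the one on
the left.

Entire extension. With H = diag(h^L, -h^R), the product rule gives M_n^L = V_n' V_n⁻¹ + V_n (H +
[[0, G], [0, 0]]) V_n⁻¹, where G = F' - h^L F - F h^R (`leftM_eq`), so it suffices to extend G
across γ. No boundary values are used: for V = W^L W^R, which is entire with V' = h^L V + V h^R, the
numerator V(w) - (w - z)(h^L(z) V(w) + V(w) h^R(z)) - V(z) vanishes to second order at z = w. Its
quotient by (w - z)² is therefore entire in z, and it integrates to an entire function over any
compact arc of γ. The remaining arcs, and the explicit integral of V(z)/(w - z)² over the compact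
arc, are holomorphic in a given ball once the arc is long enough
(`IsSmoothLine.exists_entire_extension`).

Plus part. S_n H S_n⁻¹ - M_n is -Y_n' Y_n⁻¹. Writing Y_n = S_n diag(zⁿ, z⁻ⁿ) shows that the
expansion of Y_n' Y_n⁻¹ starts at z⁻¹ or later (`coeff_formalLogDeriv`). The expansions themselves
come from those of F and F', whose remainders are exact Cauchy integrals; a distance c|z|⁻ᵏ to γ
costs a fixed number of powers of z, which is harmless because every order is available.

Polynomial case. If h^L and h^R are polynomials, W' = h^L W + W h^R also has all moments on γ, so
integration by parts has no boundary terms and G is a polynomial. Then M_n is a polynomial, its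
coefficients are those of the nonnegative powers in S_n H S_n⁻¹, and the coefficient of z^d is
diag(h^L_d, -h^R_d), which determines the degree. -/

noncomputable section

open scoped Matrix

/-! ### Polynomials and Laurent series in `z⁻¹` over a noncommutative ring -/

section Formal

variable {R : Type*} [Ring R]

/-- Polynomials in `z`, seen as Laurent series in the variable `z⁻¹`. -/
def polyToLaurent : R[X] →+* LaurentSeries R :=
  Polynomial.eval₂RingHom' HahnSeries.C (HahnSeries.single (-1 : ℤ) (1 : R)) fun a => by
    simp [Commute, SemiconjBy, HahnSeries.C_apply, HahnSeries.single_mul_single]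

theorem polyToLaurent_C (a : R) :
    polyToLaurent (Polynomial.C a) = (HahnSeries.C a : LaurentSeries R) := by
  simp [polyToLaurent, Polynomial.eval₂RingHom']

theorem polyToLaurent_X :
    polyToLaurent (Polynomial.X : R[X]) = HahnSeries.single (-1 : ℤ) (1 : R) := by
  simp [polyToLaurent, Polynomial.eval₂RingHom']

theorem single_one_pow (a : ℤ) (n : ℕ) :
    (HahnSeries.single a (1 : R)) ^ n = HahnSeries.single (n * a) (1 : R) := by
  rw [HahnSeries.single_pow]; simp

theorem polyToLaurent_monomial (n : ℕ) (a : R) :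
    polyToLaurent (Polynomial.monomial n a) = HahnSeries.single (-(n : ℤ)) a := by
  rw [← Polynomial.C_mul_X_pow_eq_monomial, map_mul, map_pow, polyToLaurent_C, polyToLaurent_X,
    single_one_pow, HahnSeries.C_apply, HahnSeries.single_mul_single]
  simp

theorem coeff_polyToLaurent_neg (P : R[X]) (k : ℕ) :
    (polyToLaurent P).coeff (-(k : ℤ)) = P.coeff k := by
  induction P using Polynomial.induction_on' with
  | add p q hp hq => simp [hp, hq]
  | monomial n a =>
    rw [polyToLaurent_monomial, HahnSeries.coeff_single, Polynomial.coeff_monomial]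
    simp [eq_comm]

theorem coeff_polyToLaurent_of_pos (P : R[X]) {l : ℤ} (hl : 0 < l) :
    (polyToLaurent P).coeff l = 0 := by
  induction P using Polynomial.induction_on' with
  | add p q hp hq => simp [hp, hq]
  | monomial n a =>
    rw [polyToLaurent_monomial, HahnSeries.coeff_single, if_neg (by omega)]

theorem coeff_ofPowerSeries_nat (a : PowerSeries R) (l : ℕ) :
    (HahnSeries.ofPowerSeries ℤ R a).coeff (l : ℤ) = PowerSeries.coeff l a :=
  HahnSeries.ofPowerSeries_apply_coeff a l

theorem coeff_ofPowerSeries_of_neg (a : PowerSeries R) {l : ℤ} (hl : l < 0) :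
    (HahnSeries.ofPowerSeries ℤ R a).coeff l = 0 := by
  rw [HahnSeries.ofPowerSeries_apply]
  apply HahnSeries.embDomain_of_notMem_range
  rintro ⟨n, hn⟩
  simp at hn
  omega

theorem int_cases_nonneg (l : ℤ) : (∃ k : ℕ, l = k) ∨ l < 0 := by
  rcases lt_or_ge l 0 with h | h
  · exact Or.inr h
  · exact Or.inl ⟨l.toNat, by omega⟩

/-- A Laurent series without negative powers is a power series. -/
theorem eq_ofPowerSeries {f : LaurentSeries R} (hf : ∀ l < 0, f.coeff l = 0) :
    f = HahnSeries.ofPowerSeries ℤ R (PowerSeries.mk fun l => f.coeff l) := by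
  ext l
  rcases int_cases_nonneg l with ⟨k, rfl⟩ | h
  · rw [coeff_ofPowerSeries_nat, PowerSeries.coeff_mk]
  · rw [hf l h, coeff_ofPowerSeries_of_neg _ h]

/-- The only polynomials that are power series in `z⁻¹` are the constants. -/
theorem polynomial_eq_C_of_polyToLaurent {P : R[X]} {a : PowerSeries R}
    (h : polyToLaurent P = HahnSeries.ofPowerSeries ℤ R a) :
    P = Polynomial.C (PowerSeries.coeff 0 a) := by
  ext k
  rw [← coeff_polyToLaurent_neg, h, Polynomial.coeff_C]
  rcases Nat.eq_zero_or_pos k with rfl | hk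
  · simpa using coeff_ofPowerSeries_nat a 0
  · rw [coeff_ofPowerSeries_of_neg _ (by omega), if_neg (by omega)]

theorem single_mul_comm (a : ℤ) (f : LaurentSeries R) :
    HahnSeries.single a (1 : R) * f = f * HahnSeries.single a (1 : R) := by
  ext l
  rw [HahnSeries.coeff_single_mul, HahnSeries.coeff_mul_single]
  simp

/-! #### Linear functionals on polynomials -/

/-- `∑ a_i f_i` for the polynomial `∑ a_i z^i`. -/
def lfun (f : ℕ → R) (A : R[X]) : R := A.sum fun i a => a * f i

theorem lfun_add (f : ℕ → R) (A B : R[X]) : lfun f (A + B) = lfun f A + lfun f B :=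
  Polynomial.sum_add_index _ _ _ (by simp) (by intros; rw [add_mul])

theorem lfun_monomial (f : ℕ → R) (i : ℕ) (a : R) : lfun f (Polynomial.monomial i a) = a * f i :=
  Polynomial.sum_monomial_index _ _ (by simp)

theorem lfun_eq_sum (f : ℕ → R) {A : R[X]} {n : ℕ} (h : A.natDegree ≤ n) :
    lfun f A = ∑ i ∈ Finset.range (n + 1), A.coeff i * f i :=
  Polynomial.sum_over_range' _ (by simp) _ (by omega)

theorem lfun_C_mul (f : ℕ → R) (c : R) (A : R[X]) :
    lfun f (Polynomial.C c * A) = c * lfun f A := by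
  induction A using Polynomial.induction_on' with
  | add p q hp hq => simp [mul_add, lfun_add, hp, hq]
  | monomial n a => simp [Polynomial.C_mul_monomial, lfun_monomial, mul_assoc]

/-- The polynomials `∑_{p + q = i - 1} μ_p z^q`. -/
def assocMono (μ : ℕ → R) : ℕ → R[X]
  | 0 => 0
  | i + 1 => Polynomial.X * assocMono μ i + Polynomial.C (μ i)

/-- The associated polynomial (of the second kind) of a polynomial. -/
def assocPoly (μ : ℕ → R) (A : R[X]) : R[X] :=
  A.sum fun i a => Polynomial.C a * assocMono μ i

theorem assocPoly_add (μ : ℕ → R) (A B : R[X]) :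
    assocPoly μ (A + B) = assocPoly μ A + assocPoly μ B :=
  Polynomial.sum_add_index _ _ _ (by simp) (by intros; rw [map_add, add_mul])

theorem assocPoly_monomial (μ : ℕ → R) (i : ℕ) (a : R) :
    assocPoly μ (Polynomial.monomial i a) = Polynomial.C a * assocMono μ i :=
  Polynomial.sum_monomial_index _ _ (by simp)

/-- The expansion `-∑_l μ_{i+l} z^{-l-1}` of the Cauchy transform of `w^i dμ`. -/
def stieltjes (μ : ℕ → R) (i : ℕ) : LaurentSeries R :=
  -HahnSeries.ofPowerSeries ℤ R (PowerSeries.X * PowerSeries.mk fun l => μ (i + l))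

theorem coeff_stieltjes_succ (μ : ℕ → R) (i l : ℕ) :
    (stieltjes μ i).coeff ((l : ℤ) + 1) = -μ (i + l) := by
  have := coeff_ofPowerSeries_nat (PowerSeries.X * PowerSeries.mk fun l => μ (i + l)) (l + 1)
  rw [PowerSeries.coeff_succ_X_mul, PowerSeries.coeff_mk, Nat.cast_succ] at this
  rw [stieltjes, HahnSeries.coeff_neg, this]

theorem coeff_stieltjes_of_nonpos (μ : ℕ → R) (i : ℕ) {l : ℤ} (hl : l ≤ 0) :
    (stieltjes μ i).coeff l = 0 := by
  rw [stieltjes, HahnSeries.coeff_neg]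
  rcases hl.lt_or_eq with h | rfl
  · rw [coeff_ofPowerSeries_of_neg _ h, neg_zero]
  · have := coeff_ofPowerSeries_nat (PowerSeries.X * PowerSeries.mk fun l => μ (i + l)) 0
    rw [Nat.cast_zero] at this
    rw [this]; simp

theorem int_cases_pos (l : ℤ) : (∃ k : ℕ, l = k + 1) ∨ l ≤ 0 := by
  rcases le_or_gt l 0 with h | h
  · exact Or.inr h
  · exact Or.inl ⟨(l - 1).toNat, by omega⟩

/-- Formal counterpart of w/(w - z) = z/(w - z) + 1; `single (-1)` is multiplication by z. -/
theorem stieltjes_succ (μ : ℕ → R) (i : ℕ) :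
    stieltjes μ (i + 1) = HahnSeries.single (-1 : ℤ) 1 * stieltjes μ i + HahnSeries.C (μ i) := by
  ext l
  rw [HahnSeries.coeff_add, HahnSeries.coeff_single_mul, HahnSeries.C_apply,
    HahnSeries.coeff_single, one_mul, sub_neg_eq_add]
  rcases int_cases_pos l with ⟨k, rfl⟩ | h
  · rw [coeff_stieltjes_succ, if_neg (by omega), show ((k : ℤ) + 1 + 1) = ((k + 1 : ℕ) : ℤ) + 1 by
      push_cast; ring, coeff_stieltjes_succ, add_zero, add_right_comm, add_assoc]
  · rw [coeff_stieltjes_of_nonpos _ _ h]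
    rcases h.lt_or_eq with h | rfl
    · rw [coeff_stieltjes_of_nonpos _ _ (by omega), if_neg (by omega), add_zero]
    · have := coeff_stieltjes_succ μ i 0
      rw [Nat.cast_zero] at this
      rw [this]; simp

theorem stieltjes_eq (μ : ℕ → R) (i : ℕ) :
    stieltjes μ i = HahnSeries.single (-(i : ℤ)) 1 * stieltjes μ 0
      + polyToLaurent (assocMono μ i) := by
  induction i with
  | zero => simp [assocMono, ← HahnSeries.C_apply]
  | succ i ih =>
    rw [stieltjes_succ, ih, assocMono, map_add, map_mul, polyToLaurent_X, polyToLaurent_C, mul_add,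
      ← mul_assoc, HahnSeries.single_mul_single, one_mul, add_assoc]
    congr 3
    push_cast; ring_nf

/-- The expansion of the Cauchy transform of `A dμ`. -/
def secondKind (μ : ℕ → R) (A : R[X]) : LaurentSeries R :=
  stieltjes (fun l => lfun (fun i => μ (i + l)) A) 0

/-- The divided difference (A(w) - A(z))/(w - z) is a polynomial in z, and its integral is the
associated polynomial; what remains is A(z) times the Stieltjes series. -/
theorem secondKind_eq (μ : ℕ → R) (A : R[X]) :
    secondKind μ A = polyToLaurent A * stieltjes μ 0 + polyToLaurent (assocPoly μ A) := by
  induction A using Polynomial.induction_on' with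
  | add p q hp hq =>
    rw [map_add, assocPoly_add, map_add, add_mul, add_add_add_comm, ← hp, ← hq]
    ext l
    rw [HahnSeries.coeff_add]
    rcases int_cases_pos l with ⟨k, rfl⟩ | h
    · simp only [secondKind, coeff_stieltjes_succ, lfun_add, neg_add]
    · simp only [secondKind, coeff_stieltjes_of_nonpos _ _ h, add_zero]
  | monomial n a =>
    have : secondKind μ (Polynomial.monomial n a) = HahnSeries.C a * stieltjes μ n := by
      ext l
      rw [HahnSeries.C_mul_eq_smul, HahnSeries.coeff_smul]
      rcases int_cases_pos l with ⟨k, rfl⟩ | h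
      · simp only [secondKind, coeff_stieltjes_succ, lfun_monomial, zero_add, smul_eq_mul, mul_neg]
      · simp only [secondKind, coeff_stieltjes_of_nonpos _ _ h, smul_zero]
    rw [this, stieltjes_eq, assocPoly_monomial, map_mul, polyToLaurent_C, polyToLaurent_monomial,
      mul_add, ← mul_assoc, HahnSeries.C_apply, HahnSeries.single_mul_single]
    simp

/-! #### The derivation `d/dz` -/

/-- Termwise derivative with respect to `z` of a Laurent series in `z⁻¹`. -/
def laurentDeriv (f : LaurentSeries R) : LaurentSeries R :=
  -- d/dz is written as z⁻¹ times the Euler operator z d/dz, which multiplies the coefficient of z⁻ˡ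
  -- by -l and so does not enlarge the support.
  HahnSeries.single (1 : ℤ) 1 *
    { coeff := fun l => (-l : ℤ) • f.coeff l
      isPWO_support' := f.isPWO_support.mono fun l hl => by
        simp only [Function.mem_support] at hl
        exact fun h => hl (by rw [h, smul_zero]) }

theorem coeff_laurentDeriv (f : LaurentSeries R) (l : ℤ) :
    (laurentDeriv f).coeff l = (1 - l : ℤ) • f.coeff (l - 1) := by
  rw [laurentDeriv, HahnSeries.coeff_single_mul, one_mul]
  simp

theorem laurentDeriv_add (f g : LaurentSeries R) :
    laurentDeriv (f + g) = laurentDeriv f + laurentDeriv g := by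
  ext l; simp only [coeff_laurentDeriv, HahnSeries.coeff_add, smul_add]

/-- The Euler operator obeys Leibniz termwise, by -(i + j) = -i + -j. Since it does not enlarge
supports, all three products can be summed over the same antidiagonal; the factor z⁻¹ is central. -/
theorem laurentDeriv_mul (f g : LaurentSeries R) :
    laurentDeriv (f * g) = laurentDeriv f * g + f * laurentDeriv g := by
  have key : ∀ h : LaurentSeries R, ∃ h' : LaurentSeries R, h'.support ⊆ h.support ∧
      (∀ l, h'.coeff l = (-l : ℤ) • h.coeff l) ∧
      laurentDeriv h = HahnSeries.single (1 : ℤ) 1 * h' := fun h =>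
    ⟨_, fun l hl => fun h0 => hl (by
      change (-l : ℤ) • h.coeff l = 0
      rw [h0, smul_zero]), fun l => rfl, rfl⟩
  obtain ⟨f', hfs, hf, hf'⟩ := key f
  obtain ⟨g', hgs, hg, hg'⟩ := key g
  rw [hf', hg', mul_assoc, ← mul_assoc f, ← single_mul_comm, mul_assoc, ← mul_add]
  ext l
  rw [coeff_laurentDeriv, HahnSeries.coeff_single_mul, one_mul, HahnSeries.coeff_add,
    HahnSeries.coeff_mul_left' f.isPWO_support hfs, HahnSeries.coeff_mul_right' g.isPWO_support hgs,
    HahnSeries.coeff_mul, ← Finset.sum_add_distrib, Finset.smul_sum]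
  refine Finset.sum_congr rfl fun ij hij => ?_
  have h1 : ij.1 + ij.2 = l - 1 := (Finset.mem_antidiagonal.1 hij).2.2
  rw [hf, hg, smul_mul_assoc, mul_smul_comm, ← add_smul]
  congr 1
  omega

theorem laurentDeriv_single (a : ℤ) (r : R) :
    laurentDeriv (HahnSeries.single a r) = HahnSeries.single (a + 1) ((-a) • r) := by
  ext l
  rw [coeff_laurentDeriv, HahnSeries.coeff_single, HahnSeries.coeff_single]
  by_cases h : l = a + 1
  · rw [if_pos (by omega), if_pos h, h]; congr 1; omega
  · rw [if_neg (by omega), if_neg h, smul_zero]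

theorem laurentDeriv_one : laurentDeriv (1 : LaurentSeries R) = 0 := by
  have := laurentDeriv_single 0 (1 : R)
  simpa using this

theorem laurentDeriv_polyToLaurent (P : R[X]) :
    laurentDeriv (polyToLaurent P) = polyToLaurent (Polynomial.derivative P) := by
  induction P using Polynomial.induction_on' with
  | add p q hp hq => simp [laurentDeriv_add, hp, hq]
  | monomial n a =>
    rw [polyToLaurent_monomial, laurentDeriv_single, Polynomial.derivative_monomial,
      polyToLaurent_monomial]
    rcases n with _ | n
    · simp
    · have : (-(((n + 1 : ℕ) : ℤ)) + 1) = -(((n + 1 - 1 : ℕ) : ℤ)) := by push_cast; simp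
      rw [this]
      congr 1
      rw [neg_neg, natCast_zsmul, nsmul_eq_mul, Nat.cast_comm]

/-! #### Anti-homomorphisms -/

/-- Coefficientwise action of an additive map on Laurent series. -/
def laurentMap {S : Type*} [Ring S] (τ : R →+ S) (f : LaurentSeries R) : LaurentSeries S :=
  f.map τ

theorem coeff_laurentMap {S : Type*} [Ring S] (τ : R →+ S) (f : LaurentSeries R) (l : ℤ) :
    (laurentMap τ f).coeff l = τ (f.coeff l) := rfl

theorem laurentMap_mul_anti {S : Type*} [Ring S] (τ : R →+ S) (hτ : ∀ a b, τ (a * b) = τ b * τ a)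
    (f g : LaurentSeries R) : laurentMap τ (f * g) = laurentMap τ g * laurentMap τ f := by
  have hs : ∀ h : LaurentSeries R, (laurentMap τ h).support ⊆ h.support := fun h l hl h0 =>
    hl (by change τ (h.coeff l) = 0; rw [h0, map_zero])
  ext l
  rw [coeff_laurentMap, HahnSeries.coeff_mul, map_sum,
    HahnSeries.coeff_mul_left' g.isPWO_support (hs g)]
  -- `τ` may kill coefficients and shrink the supports, so both products are compared on the larger
  -- antidiagonal, where the additional terms vanish.
  have : ∀ ij ∈ Finset.antidiagonal g.isPWO_support (laurentMap τ f).isPWO_support l,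
      ij ∈ Finset.antidiagonal g.isPWO_support f.isPWO_support l := fun ij h => by
    rw [Finset.mem_antidiagonal] at h ⊢
    exact ⟨h.1, hs f h.2.1, h.2.2⟩
  rw [Finset.sum_subset this]
  · refine Finset.sum_nbij' Prod.swap Prod.swap ?_ ?_ ?_ ?_ ?_
    · intro ij h
      rw [Finset.mem_antidiagonal] at h ⊢
      exact ⟨h.2.1, h.1, by rw [← h.2.2]; exact add_comm _ _⟩
    · intro ij h
      rw [Finset.mem_antidiagonal] at h ⊢
      exact ⟨h.2.1, h.1, by rw [← h.2.2]; exact add_comm _ _⟩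
    · intros; rfl
    · intros; rfl
    · intro ij _; rw [hτ]; rfl
  · intro ij h h'
    rw [Finset.mem_antidiagonal] at h h'
    have : (laurentMap τ f).coeff ij.2 = 0 := by
      by_contra h0
      exact h' ⟨h.1, h0, h.2.2⟩
    rw [this, mul_zero]

theorem laurentMap_add {S : Type*} [Ring S] (τ : R →+ S) (f g : LaurentSeries R) :
    laurentMap τ (f + g) = laurentMap τ f + laurentMap τ g := by
  ext l; simp [coeff_laurentMap]

theorem laurentMap_single {S : Type*} [Ring S] (τ : R →+ S) (a : ℤ) (r : R) :
    laurentMap τ (HahnSeries.single a r) = HahnSeries.single a (τ r) := by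
  ext l; rw [coeff_laurentMap, HahnSeries.coeff_single, HahnSeries.coeff_single]
  split_ifs <;> simp

theorem laurentMap_stieltjes {S : Type*} [Ring S] (τ : R →+ S) (μ : ℕ → R) (i : ℕ) :
    laurentMap τ (stieltjes μ i) = stieltjes (fun l => τ (μ l)) i := by
  ext l; rw [coeff_laurentMap]
  rcases int_cases_pos l with ⟨k, rfl⟩ | h
  · rw [coeff_stieltjes_succ, coeff_stieltjes_succ, map_neg]
  · rw [coeff_stieltjes_of_nonpos _ _ h, coeff_stieltjes_of_nonpos _ _ h, map_zero]

/-- Coefficientwise action of an additive map on polynomials. -/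
def polyMap {S : Type*} [Ring S] (τ : R →+ S) (P : R[X]) : S[X] :=
  ∑ i ∈ Finset.range (P.natDegree + 1), Polynomial.monomial i (τ (P.coeff i))

theorem coeff_polyMap {S : Type*} [Ring S] (τ : R →+ S) (P : R[X]) (k : ℕ) :
    (polyMap τ P).coeff k = τ (P.coeff k) := by
  rw [polyMap, Polynomial.finsetSum_coeff]
  simp only [Polynomial.coeff_monomial]
  rw [Finset.sum_ite_eq']
  split_ifs with h
  · rfl
  · rw [Polynomial.coeff_eq_zero_of_natDegree_lt (by simpa using h), map_zero]

theorem laurentMap_polyToLaurent {S : Type*} [Ring S] (τ : R →+ S) (P : R[X]) :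
    laurentMap τ (polyToLaurent P) = polyToLaurent (polyMap τ P) := by
  ext l; rw [coeff_laurentMap]
  rcases le_or_gt l 0 with h | h
  · obtain ⟨k, rfl⟩ : ∃ k : ℕ, l = -k := ⟨(-l).toNat, by omega⟩
    rw [coeff_polyToLaurent_neg, coeff_polyToLaurent_neg, coeff_polyMap]
  · rw [coeff_polyToLaurent_of_pos _ h, coeff_polyToLaurent_of_pos _ h, map_zero]

/-! #### Formal inverses -/

theorem invCoeff_succ (s : ℕ → R) (l : ℕ) :
    invCoeff s (l + 1) = -∑ i ∈ Finset.range (l + 1), s (l + 1 - i) * invCoeff s i := by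
  rw [invCoeff, Finset.sum_range]

theorem mk_mul_mk_invCoeff {s : ℕ → R} (hs : s 0 = 1) :
    PowerSeries.mk s * PowerSeries.mk (invCoeff s) = 1 := by
  ext l
  rw [PowerSeries.coeff_mul, ← Finset.Nat.sum_antidiagonal_swap]
  simp only [Prod.fst_swap, Prod.snd_swap, PowerSeries.coeff_mk, PowerSeries.coeff_one]
  rw [Finset.Nat.sum_antidiagonal_eq_sum_range_succ fun i j => s j * invCoeff s i]
  rcases l with _ | l
  · simp [hs, invCoeff]
  · rw [if_neg (by omega), Finset.sum_range_succ, Nat.sub_self, hs, one_mul, invCoeff_succ,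
      add_neg_cancel]

theorem invCoeff_unique {s t : ℕ → R} (hs : s 0 = 1)
    (h : PowerSeries.mk s * PowerSeries.mk t = 1 ∨ PowerSeries.mk t * PowerSeries.mk s = 1) :
    invCoeff s = t := by
  have h1 := mk_mul_mk_invCoeff hs
  -- The right inverse also has constant term 1, hence a right inverse of its own; this makes it
  -- two-sided.
  have h2 := mk_mul_mk_invCoeff (s := invCoeff s) (by rw [invCoeff])
  have h3 : PowerSeries.mk (invCoeff s) * PowerSeries.mk s = 1 := by
    have : PowerSeries.mk s = PowerSeries.mk (invCoeff (invCoeff s)) := by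
      rw [← mul_one (PowerSeries.mk s), ← h2, ← mul_assoc, h1, one_mul]
    rw [this, h2]
  have : PowerSeries.mk (invCoeff s) = PowerSeries.mk t := by
    rcases h with h | h
    · rw [← mul_one (PowerSeries.mk (invCoeff s)), ← h, ← mul_assoc, h3, one_mul]
    · rw [← one_mul (PowerSeries.mk (invCoeff s)), ← h, mul_assoc, h1, mul_one]
  ext l
  have := congrArg (PowerSeries.coeff l) this
  simpa using this

end Formal

/-! ### Evaluation of matrix polynomials -/

section Eval

variable {m : Type*} [Fintype m] [DecidableEq m]

/-- Evaluation at a complex number, as a ring homomorphism. -/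
def matEvalHom (z : ℂ) : (Matrix m m ℂ)[X] →+* Matrix m m ℂ :=
  Polynomial.eval₂RingHom' (RingHom.id _) (algebraMap ℂ (Matrix m m ℂ) z)
    fun a => (Algebra.commutes z a).symm

theorem matEval_eq_hom (P : (Matrix m m ℂ)[X]) (z : ℂ) : matEval P z = matEvalHom z P := by
  rfl

theorem matEval_add (P Q : (Matrix m m ℂ)[X]) (z : ℂ) :
    matEval (P + Q) z = matEval P z + matEval Q z := by simp only [matEval_eq_hom, map_add]

theorem matEval_mul (P Q : (Matrix m m ℂ)[X]) (z : ℂ) :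
    matEval (P * Q) z = matEval P z * matEval Q z := by simp only [matEval_eq_hom, map_mul]

theorem matEval_C (a : Matrix m m ℂ) (z : ℂ) : matEval (Polynomial.C a) z = a := by
  simp [matEval]

theorem matEval_one (z : ℂ) : matEval (1 : (Matrix m m ℂ)[X]) z = 1 := by
  simp [matEval]

theorem matEval_X (z : ℂ) : matEval (Polynomial.X : (Matrix m m ℂ)[X]) z = algebraMap ℂ _ z := by
  simp [matEval]

theorem matEval_monomial (i : ℕ) (a : Matrix m m ℂ) (z : ℂ) :
    matEval (Polynomial.monomial i a) z = z ^ i • a := by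
  rw [matEval, Polynomial.eval_monomial, ← map_pow, Algebra.algebraMap_eq_smul_one,
    mul_smul_comm, mul_one]

theorem matEval_eq_sum (P : (Matrix m m ℂ)[X]) {n : ℕ} (h : P.natDegree ≤ n) (z : ℂ) :
    matEval P z = ∑ i ∈ Finset.range (n + 1), z ^ i • P.coeff i := by
  conv_lhs => rw [P.as_sum_range' (n + 1) (by omega)]
  rw [matEval_eq_hom, map_sum]
  simp only [← matEval_eq_hom, matEval_monomial]

theorem matEval_apply (P : (Matrix m m ℂ)[X]) (z : ℂ) (a b : m) :
    matEval P z a b = ∑ i ∈ Finset.range (P.natDegree + 1), z ^ i * P.coeff i a b := by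
  rw [matEval_eq_sum P le_rfl, Matrix.sum_apply]
  simp

/-- A sequence obeying the recurrence of Cauchy transforms is determined by its first term. -/
theorem lfun_eq_matEval {q μ : ℕ → Matrix m m ℂ} {z : ℂ} (h : ∀ i, q (i + 1) = z • q i + μ i)
    (A : (Matrix m m ℂ)[X]) :
    lfun q A = matEval A z * q 0 + matEval (assocPoly μ A) z := by
  have hmono : ∀ i, q i = z ^ i • q 0 + matEval (assocMono μ i) z := by
    intro i
    induction i with
    | zero => simp [assocMono, matEval]
    | succ i ih =>
      rw [h, ih, assocMono, matEval_add, matEval_mul, matEval_X, matEval_C, smul_add, smul_smul,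
        Algebra.algebraMap_eq_smul_one, smul_mul_assoc, one_mul, pow_succ', add_assoc]
  induction A using Polynomial.induction_on' with
  | add p q hp hq =>
    rw [lfun_add, hp, hq, matEval_add, assocPoly_add, matEval_add, add_mul]; abel
  | monomial n a =>
    rw [lfun_monomial, hmono, assocPoly_monomial, matEval_monomial, matEval_mul, matEval_C, mul_add,
      mul_smul_comm, smul_mul_assoc]

theorem matEval_polyMap_transpose (P : (Matrix m m ℂ)[X]) (z : ℂ) :
    matEval (polyMap (Matrix.transposeAddEquiv m m ℂ).toAddMonoidHom P) z = (matEval P z)ᵀ := by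
  rw [polyMap, matEval_eq_hom, map_sum, matEval_eq_sum P le_rfl, Matrix.transpose_sum]
  simp only [← matEval_eq_hom, matEval_monomial]
  rfl

end Eval

/-! ### Moments and Cauchy transforms -/

section Moments

variable {N : ℕ} {γ : ℝ → ℂ} {W : ℂ → Mat N}

/-- `(2πi)⁻¹ ∫_γ w^i W(w) (w - z)⁻¹ dw`. -/
def cauchyMoment (γ : ℝ → ℂ) (W : ℂ → Mat N) (i : ℕ) (z : ℂ) : Mat N :=
  curveInt γ fun w => ((w - z)⁻¹ * w ^ i) • W w

/-- The scalar factor is left general to cover two uses: g(w) = wᵏ gives the moments of P W, and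
g(w) = (w - z)⁻¹ gives the functions of the second kind. -/
theorem curveInt_polynomial_mul {g : ℂ → ℂ}
    (hg : ∀ (i : ℕ) (a b : Fin N), MeasureTheory.Integrable
      fun t : ℝ => g (γ t) * γ t ^ i * W (γ t) a b * deriv γ t) (P : (Mat N)[X]) :
    curveInt γ (fun w => g w • (matEval P w * W w)) =
      lfun (fun i => curveInt γ fun w => (g w * w ^ i) • W w) P := by
  rw [lfun_eq_sum _ le_rfl]
  ext a c
  rw [Matrix.sum_apply]
  simp only [curveInt, Matrix.of_apply, Matrix.mul_apply, Matrix.smul_apply, smul_eq_mul]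
  have h : ∀ t : ℝ, (g (γ t) * ∑ b, matEval P (γ t) a b * W (γ t) b c) * deriv γ t =
      ∑ i ∈ Finset.range (P.natDegree + 1), ∑ b, P.coeff i a b *
        (g (γ t) * γ t ^ i * W (γ t) b c * deriv γ t) := by
    intro t
    rw [Finset.sum_comm, Finset.mul_sum, Finset.sum_mul]
    refine Finset.sum_congr rfl fun b _ => ?_
    rw [matEval_apply, Finset.sum_mul, Finset.mul_sum, Finset.sum_mul]
    exact Finset.sum_congr rfl fun i _ => by ring
  simp_rw [h]
  rw [MeasureTheory.integral_finsetSum _ fun i _ =>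
    MeasureTheory.integrable_finsetSum _ fun b _ => (hg i b c).const_mul _, Finset.mul_sum]
  refine Finset.sum_congr rfl fun i _ => ?_
  rw [MeasureTheory.integral_finsetSum _ fun b _ => (hg i b c).const_mul _, Finset.mul_sum]
  refine Finset.sum_congr rfl fun b _ => ?_
  rw [MeasureTheory.integral_const_mul]
  ring

theorem IsSmoothLine.continuous (hγ : IsSmoothLine γ) : Continuous γ := hγ.contDiff.continuous

theorem IsSmoothLine.isClosed_range (hγ : IsSmoothLine γ) : IsClosed (Set.range γ) :=
  (Topology.IsClosedEmbedding.of_continuous_injective_isClosedMap hγ.continuous hγ.injective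
    (isProperMap_iff_tendsto_cocompact.2 ⟨hγ.continuous, hγ.proper⟩).isClosedMap).isClosed_range

theorem IsSmoothLine.infDist_pos (hγ : IsSmoothLine γ) {z : ℂ} (hz : z ∉ Set.range γ) :
    0 < Metric.infDist z (Set.range γ) :=
  (hγ.isClosed_range.notMem_iff_infDist_pos (Set.range_nonempty γ)).1 hz

theorem sub_ne_zero_of_notMem {z : ℂ} (hz : z ∉ Set.range γ) (t : ℝ) : γ t - z ≠ 0 :=
  fun h => hz ⟨t, sub_eq_zero.1 h⟩

theorem infDist_le_norm_sub (γ : ℝ → ℂ) (z : ℂ) (t : ℝ) :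
    Metric.infDist z (Set.range γ) ≤ ‖γ t - z‖ := by
  rw [← dist_eq_norm, dist_comm]
  exact Metric.infDist_le_dist_of_mem ⟨t, rfl⟩

theorem IsSmoothLine.integrable_inv_mul (hγ : IsSmoothLine γ) {z : ℂ} (hz : z ∉ Set.range γ)
    {φ : ℝ → ℂ} (hφ : MeasureTheory.Integrable φ) :
    MeasureTheory.Integrable fun t => (γ t - z)⁻¹ * φ t := by
  refine hφ.bdd_mul (c := (Metric.infDist z (Set.range γ))⁻¹) ?_ ?_
  · exact ((hγ.continuous.sub continuous_const).inv₀
      (sub_ne_zero_of_notMem hz)).aestronglyMeasurable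
  · refine Filter.Eventually.of_forall fun t => ?_
    rw [norm_inv]
    exact inv_anti₀ (hγ.infDist_pos hz) (infDist_le_norm_sub γ z t)

theorem integrable_cauchyMoment (hγ : IsSmoothLine γ) (hW : IsWeight γ W) {z : ℂ}
    (hz : z ∉ Set.range γ) (i : ℕ) (a b : Fin N) :
    MeasureTheory.Integrable fun t => (γ t - z)⁻¹ * γ t ^ i * W (γ t) a b * deriv γ t := by
  refine (hγ.integrable_inv_mul hz (hW i a b)).congr (Filter.Eventually.of_forall fun t => ?_)
  simp only; ring

/-- From w/(w - z) = z/(w - z) + 1 under the integral. -/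
theorem cauchyMoment_succ (hγ : IsSmoothLine γ) (hW : IsWeight γ W) {z : ℂ}
    (hz : z ∉ Set.range γ) (i : ℕ) :
    cauchyMoment γ W (i + 1) z = z • cauchyMoment γ W i z + moment γ W i := by
  ext a b
  simp only [cauchyMoment, moment, curveInt, Matrix.of_apply, Matrix.smul_apply, smul_eq_mul,
    Matrix.add_apply]
  rw [mul_left_comm, ← mul_add, ← MeasureTheory.integral_const_mul z, ← MeasureTheory.integral_add
    ((integrable_cauchyMoment hγ hW hz i a b).const_mul z) (hW i a b)]
  congr 2
  ext t
  have := sub_ne_zero_of_notMem hz t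
  field_simp
  ring

theorem leftMoment_eq (hW : IsWeight γ W) (P : (Mat N)[X]) (k : ℕ) :
    curveInt γ (fun z => z ^ k • (matEval P z * W z)) = lfun (fun i => moment γ W (i + k)) P := by
  rw [curveInt_polynomial_mul]
  · simp only [moment, pow_add, mul_comm]
  · intro i a b
    refine (hW (k + i) a b).congr (Filter.Eventually.of_forall fun t => ?_)
    simp only [pow_add]

theorem leftQ_eq (hγ : IsSmoothLine γ) (hW : IsWeight γ W) {z : ℂ} (hz : z ∉ Set.range γ) (n : ℕ) :
    leftQ γ W n z = lfun (fun i => cauchyMoment γ W i z) (leftOP γ W n) := by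
  have := curveInt_polynomial_mul (g := fun w => (w - z)⁻¹)
    (integrable_cauchyMoment hγ hW hz) (leftOP γ W n)
  exact this

/-! ### Existence and uniqueness of the orthogonal polynomials -/

theorem vecMul_hankel (n : ℕ) (x : Fin (n + 1) × Fin N → ℂ) (q : Fin (n + 1) × Fin N) :
    Matrix.vecMul x (hankel γ W n) q =
      ∑ i : Fin (n + 1), ∑ b, x (i, b) * moment γ W (i + q.1) b q.2 := by
  simp only [Matrix.vecMul, dotProduct, Fintype.sum_prod_type, hankel, Matrix.of_apply]

/-- For each r, the r-th rows of the coefficients, strung together, form a left null vector of the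
block Hankel matrix. -/
theorem hankel_unique {n : ℕ} (h : (hankel γ W n).det ≠ 0) {p : ℕ → Mat N}
    (hp : ∀ k ≤ n, ∑ i ∈ Finset.range (n + 1), p i * moment γ W (i + k) = 0) :
    ∀ i ≤ n, p i = 0 := by
  intro i hi
  ext r b
  have hx : (fun q : Fin (n + 1) × Fin N => p q.1 r q.2) = 0 := by
    by_contra hne
    refine h (Matrix.exists_vecMul_eq_zero_iff.1 ⟨_, hne, ?_⟩)
    ext q
    rw [vecMul_hankel]
    have := congrFun (congrFun (hp q.1 (by omega)) r) q.2
    rw [Finset.sum_range, Matrix.sum_apply] at this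
    simp only [Matrix.mul_apply] at this
    exact this
  exact congrFun hx (⟨i, by omega⟩, b)

theorem hankel_exists {n : ℕ} (h : (hankel γ W n).det ≠ 0) (c : ℕ → Mat N) :
    ∃ p : ℕ → Mat N,
      ∀ k ≤ n, ∑ i ∈ Finset.range (n + 1), p i * moment γ W (i + k) = c k := by
  have hu : IsUnit (hankel γ W n).det := isUnit_iff_ne_zero.2 h
  let x : Fin N → Fin (n + 1) × Fin N → ℂ := fun r =>
    Matrix.vecMul (fun q : Fin (n + 1) × Fin N => c q.1 r q.2) (hankel γ W n)⁻¹
  refine ⟨fun i => Matrix.of fun r b => if hi : i < n + 1 then x r (⟨i, hi⟩, b) else 0,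
    fun k hk => ?_⟩
  ext r b
  have := vecMul_hankel (γ := γ) (W := W) n (x r) (⟨k, by omega⟩, b)
  rw [show Matrix.vecMul (x r) (hankel γ W n) = fun q : Fin (n + 1) × Fin N => c q.1 r q.2 by
    simp only [x, Matrix.vecMul_vecMul, Matrix.nonsing_inv_mul _ hu, Matrix.vecMul_one]] at this
  rw [Finset.sum_range, Matrix.sum_apply]
  simp only [Matrix.mul_apply, Matrix.of_apply, Fin.is_lt, dif_pos]
  exact this.symm

/-- Orthogonality, in terms of moments. -/
def IsMomentOP (μ : ℕ → Mat N) (n : ℕ) (P : (Mat N)[X]) : Prop :=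
  P.natDegree ≤ n ∧ P.coeff n = 1 ∧ ∀ k < n, lfun (fun i => μ (i + k)) P = 0

theorem isLeftOP_iff (hW : IsWeight γ W) (n : ℕ) (P : (Mat N)[X]) :
    IsLeftOP γ W n P ↔ IsMomentOP (moment γ W) n P := by
  constructor
  · rintro ⟨h1, h2, h3⟩
    exact ⟨h1, h2, fun k hk => by rw [← leftMoment_eq hW, h3 k hk]⟩
  · rintro ⟨h1, h2, h3⟩
    exact ⟨h1, h2, fun k hk => by rw [leftMoment_eq hW, h3 k hk]⟩

theorem exists_isMomentOP (hreg : IsRegularWeight γ W) (n : ℕ) :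
    ∃ P, IsMomentOP (moment γ W) n P := by
  rcases n with _ | n
  · exact ⟨1, by simp, by simp, by simp⟩
  -- In degree n + 1 the n + 1 unknown lower coefficients have to cancel the contribution of the
  -- monic term against 1, z, …, zⁿ.
  · obtain ⟨p, hp⟩ := hankel_exists (hreg n) fun k => -moment γ W (n + 1 + k)
    refine ⟨∑ i ∈ Finset.range (n + 2), Polynomial.monomial i (if i ≤ n then p i else 1), ?_, ?_, ?_⟩
    · refine Polynomial.natDegree_sum_le_of_forall_le _ _ fun i hi => ?_
      exact (Polynomial.natDegree_monomial_le _).trans (by simp at hi; omega)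
    · rw [Polynomial.finsetSum_coeff]
      simp [Polynomial.coeff_monomial]
    · intro k hk
      have hadd : ∀ (s : Finset ℕ) (f : ℕ → Mat N), lfun (fun i => moment γ W (i + k))
          (∑ i ∈ s, Polynomial.monomial i (f i)) = ∑ i ∈ s, f i * moment γ W (i + k) := by
        intro s f
        induction s using Finset.cons_induction with
        | empty => simp [lfun]
        | cons a s ha ih => rw [Finset.sum_cons, lfun_add, ih, lfun_monomial, Finset.sum_cons]
      rw [hadd, Finset.sum_range_succ, if_neg (by omega), one_mul, ← eq_neg_iff_add_eq_zero,
        ← hp k (by omega)]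
      refine Finset.sum_congr rfl fun i hi => ?_
      rw [if_pos (by simp at hi; omega)]

theorem IsMomentOP.unique (hreg : IsRegularWeight γ W) {n : ℕ} {P Q : (Mat N)[X]}
    (hP : IsMomentOP (moment γ W) n P) (hQ : IsMomentOP (moment γ W) n Q) : P = Q := by
  ext1 i
  rcases lt_trichotomy i n with h | rfl | h
  · obtain ⟨n, rfl⟩ : ∃ n', n = n' + 1 := ⟨n - 1, by omega⟩
    refine sub_eq_zero.1 (hankel_unique (hreg n) (p := fun i => P.coeff i - Q.coeff i)
      (fun k hk => ?_) i (by omega))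
    have h1 := hP.2.2 k (by omega)
    have h2 := hQ.2.2 k (by omega)
    rw [lfun_eq_sum _ hP.1, Finset.sum_range_succ, hP.2.1, ← eq_neg_iff_add_eq_zero] at h1
    rw [lfun_eq_sum _ hQ.1, Finset.sum_range_succ, hQ.2.1, ← eq_neg_iff_add_eq_zero] at h2
    simp only [sub_mul, Finset.sum_sub_distrib, h1, h2, sub_self]
  · rw [hP.2.1, hQ.2.1]
  · rw [Polynomial.coeff_eq_zero_of_natDegree_lt (hP.1.trans_lt h),
      Polynomial.coeff_eq_zero_of_natDegree_lt (hQ.1.trans_lt h)]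

/-- If the rows of A annihilate the norm matrix from the left, then A P is orthogonal to 1, z, …,
zⁿ. Regularity makes all its coefficients vanish, including the leading one, which is A since P is
monic. -/
theorem IsMomentOP.isUnit_det (hreg : IsRegularWeight γ W) {n : ℕ} {P : (Mat N)[X]}
    (hP : IsMomentOP (moment γ W) n P) :
    IsUnit (lfun (fun i => moment γ W (i + n)) P).det := by
  rw [isUnit_iff_ne_zero]
  intro h
  obtain ⟨v, hv, hv0⟩ := Matrix.exists_vecMul_eq_zero_iff.2 h
  apply hv
  let A : Mat N := Matrix.of fun _ => v
  have hA : A * lfun (fun i => moment γ W (i + n)) P = 0 := by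
    ext r c
    exact congrFun hv0 c
  have := hankel_unique (hreg n) (p := fun i => A * P.coeff i) (fun k hk => by
    have : ∑ i ∈ Finset.range (n + 1), A * P.coeff i * moment γ W (i + k) =
        A * lfun (fun i => moment γ W (i + k)) P := by
      rw [lfun_eq_sum _ hP.1, Finset.mul_sum]
      simp only [mul_assoc]
    rw [this]
    rcases hk.lt_or_eq with h | rfl
    · rw [hP.2.2 k h, mul_zero]
    · exact hA) n le_rfl
  rw [hP.2.1, mul_one] at this
  ext r
  exact congrFun (congrFun this r) r

theorem leftOP_spec (hW : IsWeight γ W) (hreg : IsRegularWeight γ W) (n : ℕ) :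
    IsLeftOP γ W n (leftOP γ W n) :=
  Classical.epsilon_spec (p := IsLeftOP γ W n)
    ((exists_isMomentOP hreg n).imp fun P hP => (isLeftOP_iff hW n P).2 hP)

theorem leftOP_isMomentOP (hW : IsWeight γ W) (hreg : IsRegularWeight γ W) (n : ℕ) :
    IsMomentOP (moment γ W) n (leftOP γ W n) :=
  (isLeftOP_iff hW n _).1 (leftOP_spec hW hreg n)

theorem leftMoment_eq_lfun (hW : IsWeight γ W) (n k : ℕ) :
    leftMoment γ W n k = lfun (fun i => moment γ W (i + k)) (leftOP γ W n) :=
  leftMoment_eq hW _ _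

theorem isUnit_leftMoment (hW : IsWeight γ W) (hreg : IsRegularWeight γ W) (n : ℕ) :
    IsUnit (leftMoment γ W n n).det := by
  rw [leftMoment_eq_lfun hW]
  exact (leftOP_isMomentOP hW hreg n).isUnit_det hreg

/-! ### Transposition -/

/-- The transposed weight. -/
def transposeWeight (W : ℂ → Mat N) (z : ℂ) : Mat N := (W z)ᵀ

theorem IsWeight.transpose (hW : IsWeight γ W) : IsWeight γ (transposeWeight W) :=
  fun k i j => hW k j i

theorem moment_transpose (k : ℕ) : moment γ (transposeWeight W) k = (moment γ W k)ᵀ := rfl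

theorem IsRegularWeight.transpose (hreg : IsRegularWeight γ W) :
    IsRegularWeight γ (transposeWeight W) := by
  intro n
  have : hankel γ (transposeWeight W) n = (hankel γ W n)ᵀ := by
    ext p q
    simp only [hankel, Matrix.of_apply, moment_transpose, Matrix.transpose_apply, add_comm]
  rw [this, Matrix.det_transpose]
  exact hreg n

theorem curveInt_transpose (F : ℂ → Mat N) : curveInt γ (fun z => (F z)ᵀ) = (curveInt γ F)ᵀ := rfl

/-- The polynomial with transposed coefficients. -/
def transposePoly (P : (Mat N)[X]) : (Mat N)[X] :=
  polyMap (Matrix.transposeAddEquiv (Fin N) (Fin N) ℂ).toAddMonoidHom P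

theorem coeff_transposePoly (P : (Mat N)[X]) (k : ℕ) :
    (transposePoly P).coeff k = (P.coeff k)ᵀ := coeff_polyMap _ _ _

theorem transposePoly_transposePoly (P : (Mat N)[X]) : transposePoly (transposePoly P) = P := by
  ext1 k; rw [coeff_transposePoly, coeff_transposePoly, Matrix.transpose_transpose]

theorem natDegree_transposePoly_le {P : (Mat N)[X]} {n : ℕ} (h : P.natDegree ≤ n) :
    (transposePoly P).natDegree ≤ n := by
  rw [Polynomial.natDegree_le_iff_coeff_eq_zero] at h ⊢
  intro k hk
  rw [coeff_transposePoly, h k hk, Matrix.transpose_zero]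

theorem matEval_transposePoly (P : (Mat N)[X]) (z : ℂ) :
    matEval (transposePoly P) z = (matEval P z)ᵀ := matEval_polyMap_transpose P z

/-- Transposition reverses products. This equivalence lets every right-hand object be read off from
the left-hand theory of Wᵀ. -/
theorem isRightOP_transposePoly_iff (n : ℕ) (P : (Mat N)[X]) :
    IsRightOP γ W n (transposePoly P) ↔ IsLeftOP γ (transposeWeight W) n P := by
  have h : ∀ k, curveInt γ (fun z => z ^ k • (W z * matEval (transposePoly P) z)) =
      (curveInt γ (fun z => z ^ k • (matEval P z * transposeWeight W z)))ᵀ := by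
    intro k
    rw [← curveInt_transpose]
    simp only [matEval_transposePoly, transposeWeight, Matrix.transpose_smul, Matrix.transpose_mul,
      Matrix.transpose_transpose]
  constructor
  · rintro ⟨h1, h2, h3⟩
    refine ⟨?_, ?_, fun k hk => ?_⟩
    · rw [← transposePoly_transposePoly P]; exact natDegree_transposePoly_le h1
    · rw [← transposePoly_transposePoly P, coeff_transposePoly, h2, Matrix.transpose_one]
    · have := h3 k hk
      rwa [h, Matrix.transpose_eq_zero] at this
  · rintro ⟨h1, h2, h3⟩
    refine ⟨natDegree_transposePoly_le h1, ?_, fun k hk => ?_⟩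
    · rw [coeff_transposePoly, h2, Matrix.transpose_one]
    · rw [h, h3 k hk, Matrix.transpose_zero]

theorem rightOP_eq (hW : IsWeight γ W) (hreg : IsRegularWeight γ W) (n : ℕ) :
    IsRightOP γ W n (rightOP γ W n) ∧
      rightOP γ W n = transposePoly (leftOP γ (transposeWeight W) n) := by
  have h1 : IsRightOP γ W n (transposePoly (leftOP γ (transposeWeight W) n)) :=
    (isRightOP_transposePoly_iff n _).2 (leftOP_spec hW.transpose hreg.transpose n)
  have h2 : IsRightOP γ W n (rightOP γ W n) := Classical.epsilon_spec (p := IsRightOP γ W n) ⟨_, h1⟩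
  refine ⟨h2, ?_⟩
  rw [← transposePoly_transposePoly (rightOP γ W n), isRightOP_transposePoly_iff] at h2
  rw [← transposePoly_transposePoly (rightOP γ W n)]
  congr 1
  exact IsMomentOP.unique hreg.transpose ((isLeftOP_iff hW.transpose n _).1 h2)
    (leftOP_isMomentOP hW.transpose hreg.transpose n)

theorem rightMoment_eq_transpose (hW : IsWeight γ W) (hreg : IsRegularWeight γ W) (n k : ℕ) :
    rightMoment γ W n k = (leftMoment γ (transposeWeight W) n k)ᵀ := by
  rw [rightMoment, leftMoment, ← curveInt_transpose, (rightOP_eq hW hreg n).2]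
  simp only [matEval_transposePoly, transposeWeight, Matrix.transpose_smul, Matrix.transpose_mul,
    Matrix.transpose_transpose]

theorem rightQ_eq_transpose (hW : IsWeight γ W) (hreg : IsRegularWeight γ W) (n : ℕ) (z : ℂ) :
    rightQ γ W n z = (leftQ γ (transposeWeight W) n z)ᵀ := by
  rw [rightQ, leftQ, ← curveInt_transpose, (rightOP_eq hW hreg n).2]
  simp only [matEval_transposePoly, transposeWeight, Matrix.transpose_smul, Matrix.transpose_mul,
    Matrix.transpose_transpose]

/-- Both sides equal the pairing (2πi)⁻¹ ∫ P_n^L W P_n^R: on expanding one of the two monic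
polynomials, orthogonality of the other leaves only the term of degree n. -/
theorem rightMoment_self (hW : IsWeight γ W) (hreg : IsRegularWeight γ W) (n : ℕ) :
    rightMoment γ W n n = leftMoment γ W n n := by
  have hP := leftOP_isMomentOP hW hreg n
  have hR := leftOP_isMomentOP hW.transpose hreg.transpose n
  rw [rightMoment_eq_transpose hW hreg, leftMoment_eq_lfun hW, leftMoment_eq_lfun hW.transpose]
  set P := leftOP γ W n
  set Q := leftOP γ (transposeWeight W) n
  have h1 : lfun (fun i => moment γ W (i + n)) P = ∑ k ∈ Finset.range (n + 1),
      lfun (fun i => moment γ W (i + k)) P * (Q.coeff k)ᵀ := by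
    rw [Finset.sum_range_succ, hR.2.1, Matrix.transpose_one, mul_one, Finset.sum_eq_zero, zero_add]
    intro k hk
    rw [hP.2.2 k (by simpa using hk), zero_mul]
  have h2 : lfun (fun i => moment γ (transposeWeight W) (i + n)) Q = ∑ k ∈ Finset.range (n + 1),
      lfun (fun i => moment γ (transposeWeight W) (i + k)) Q * (P.coeff k)ᵀ := by
    rw [Finset.sum_range_succ, hP.2.1, Matrix.transpose_one, mul_one, Finset.sum_eq_zero, zero_add]
    intro k hk
    rw [hR.2.2 k (by simpa using hk), zero_mul]
  rw [h1, h2, Matrix.transpose_sum]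
  simp only [lfun_eq_sum _ hP.1, lfun_eq_sum _ hR.1, Finset.sum_mul, Matrix.transpose_sum,
    Matrix.transpose_mul, Matrix.transpose_transpose, moment_transpose]
  rw [Finset.sum_comm]
  refine Finset.sum_congr rfl fun i _ => Finset.sum_congr rfl fun k _ => ?_
  rw [add_comm, mul_assoc]

theorem normMat_transpose (hW : IsWeight γ W) (hreg : IsRegularWeight γ W) (n : ℕ) :
    normMat γ W n = (normMat γ (transposeWeight W) n)ᵀ := by
  rw [normMat, normMat, Matrix.transpose_nonsing_inv, ← rightMoment_eq_transpose hW hreg,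
    rightMoment_self hW hreg]

theorem rightY_eq_transpose (hW : IsWeight γ W) (hreg : IsRegularWeight γ W) (n : ℕ) (z : ℂ) :
    rightY γ W n z = (leftY γ (transposeWeight W) n z)ᵀ := by
  rcases n with _ | n
  · simp only [rightY, leftY, Matrix.fromBlocks_transpose, Matrix.transpose_zero,
      Matrix.transpose_one, rightQ_eq_transpose hW hreg, (rightOP_eq hW hreg 0).2,
      matEval_transposePoly]
  · simp only [rightY, leftY, Matrix.fromBlocks_transpose, Matrix.transpose_neg,
      Matrix.transpose_mul, rightQ_eq_transpose hW hreg, (rightOP_eq hW hreg _).2,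
      matEval_transposePoly, normMat_transpose hW hreg]

theorem rightSCoeff_eq_transpose (hW : IsWeight γ W) (hreg : IsRegularWeight γ W) (n l : ℕ) :
    rightSCoeff γ W n l = (leftSCoeff γ (transposeWeight W) n l)ᵀ := by
  rcases n with _ | n <;> rcases l with _ | l
  · simp [rightSCoeff, leftSCoeff]
  · simp [rightSCoeff, leftSCoeff, Matrix.fromBlocks_transpose, rightMoment_eq_transpose hW hreg]
  · simp [rightSCoeff, leftSCoeff]
  · simp only [rightSCoeff, leftSCoeff, Matrix.fromBlocks_transpose, Matrix.transpose_neg,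
      Matrix.transpose_mul, rightMoment_eq_transpose hW hreg, (rightOP_eq hW hreg _).2,
      coeff_transposePoly, normMat_transpose hW hreg]
    split_ifs <;> simp

end Moments

section Blocks

variable {N : ℕ}

/-! ### Block matrices -/

/-- The upper right block. -/
def e12 : Mat N →+ BMat N where
  toFun x := Matrix.fromBlocks 0 x 0 0
  map_zero' := by simp
  map_add' x y := by simp [Matrix.fromBlocks_add]

theorem e12_apply (x : Mat N) : e12 x = Matrix.fromBlocks 0 x 0 0 := rfl

/-- This nilpotency makes 1 - [[0, F], [0, 0]] the inverse of 1 + [[0, F], [0, 0]]. -/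
theorem e12_mul_e12 (x y : Mat N) : e12 x * e12 y = 0 := by
  simp [e12_apply, Matrix.fromBlocks_multiply]

theorem e12_smul (c : ℂ) (x : Mat N) : e12 (c • x) = c • e12 x := by
  simp [e12_apply, Matrix.fromBlocks_smul]

/-- The symplectic unit. -/
def blockJ (N : ℕ) : BMat N := Matrix.fromBlocks 0 1 (-1) 0

/-- The inverse of the symplectic unit. -/
def blockJInv (N : ℕ) : BMat N := Matrix.fromBlocks 0 (-1) 1 0

theorem blockJ_mul_inv : blockJ N * blockJInv N = 1 := by
  simp [blockJ, blockJInv, Matrix.fromBlocks_multiply, Matrix.fromBlocks_one]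

theorem blockJInv_mul : blockJInv N * blockJ N = 1 := by
  simp [blockJ, blockJInv, Matrix.fromBlocks_multiply, Matrix.fromBlocks_one]

theorem blockJ_conj (a b c d : Mat N) : blockJ N * Matrix.fromBlocks a b c d * blockJInv N =
    Matrix.fromBlocks d (-c) (-b) a := by
  simp [blockJ, blockJInv, Matrix.fromBlocks_multiply]

/-- The anti-automorphism `b ↦ J bᵀ J⁻¹`. -/
def blockAnti (N : ℕ) : BMat N →+ BMat N where
  toFun b := blockJ N * bᵀ * blockJInv N
  map_zero' := by simp
  map_add' x y := by rw [Matrix.transpose_add, mul_add, add_mul]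

theorem blockAnti_apply (b : BMat N) : blockAnti N b = blockJ N * bᵀ * blockJInv N := rfl

theorem blockAnti_fromBlocks (a b c d : Mat N) : blockAnti N (Matrix.fromBlocks a b c d) =
    Matrix.fromBlocks dᵀ (-bᵀ) (-cᵀ) aᵀ := by
  rw [blockAnti_apply, Matrix.fromBlocks_transpose, blockJ_conj]

theorem blockAnti_mul (a b : BMat N) : blockAnti N (a * b) = blockAnti N b * blockAnti N a := by
  simp only [blockAnti_apply, Matrix.transpose_mul]
  calc _ = blockJ N * bᵀ * 1 * aᵀ * blockJInv N := by simp only [mul_one, mul_assoc]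
    _ = _ := by rw [← blockJInv_mul]; simp only [mul_assoc]

theorem blockAnti_one : blockAnti N 1 = 1 := by
  rw [blockAnti_apply, Matrix.transpose_one, mul_one, blockJ_mul_inv]

theorem blockAnti_smul (c : ℂ) (b : BMat N) : blockAnti N (c • b) = c • blockAnti N b := by
  simp [blockAnti_apply]

theorem blockAnti_e12 (x : Mat N) : blockAnti N (e12 x) = -e12 xᵀ := by
  rw [e12_apply, blockAnti_fromBlocks, e12_apply, Matrix.fromBlocks_neg]; simp

/-- The projection onto the first block. -/
def proj1 (N : ℕ) : BMat N := Matrix.fromBlocks 1 0 0 0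

/-- The projection onto the second block. -/
def proj2 (N : ℕ) : BMat N := Matrix.fromBlocks 0 0 0 1

theorem proj_add : proj1 N + proj2 N = 1 := by
  simp [proj1, proj2, Matrix.fromBlocks_add, Matrix.fromBlocks_one]

theorem proj1_mul_proj1 : proj1 N * proj1 N = proj1 N := by
  simp [proj1, Matrix.fromBlocks_multiply]

theorem proj2_mul_proj2 : proj2 N * proj2 N = proj2 N := by
  simp [proj2, Matrix.fromBlocks_multiply]

theorem proj1_mul_proj2 : proj1 N * proj2 N = 0 := by
  simp [proj1, proj2, Matrix.fromBlocks_multiply]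

theorem proj2_mul_proj1 : proj2 N * proj1 N = 0 := by
  simp [proj1, proj2, Matrix.fromBlocks_multiply]

/-! ### Additive maps acting on polynomials -/

theorem polyMap_add {R S : Type*} [Ring R] [Ring S] (τ : R →+ S) (P Q : R[X]) :
    polyMap τ (P + Q) = polyMap τ P + polyMap τ Q := by
  ext1 k; simp [coeff_polyMap]

theorem polyMap_monomial {R S : Type*} [Ring R] [Ring S] (τ : R →+ S) (i : ℕ) (a : R) :
    polyMap τ (Polynomial.monomial i a) = Polynomial.monomial i (τ a) := by
  ext1 k; rw [coeff_polyMap, Polynomial.coeff_monomial, Polynomial.coeff_monomial]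
  split_ifs <;> simp

theorem matEval_polyMap {m n : Type*} [Fintype m] [DecidableEq m] [Fintype n] [DecidableEq n]
    (τ : Matrix m m ℂ →+ Matrix n n ℂ) (hτ : ∀ (c : ℂ) x, τ (c • x) = c • τ x)
    (P : (Matrix m m ℂ)[X]) (z : ℂ) : matEval (polyMap τ P) z = τ (matEval P z) := by
  induction P using Polynomial.induction_on' with
  | add p q hp hq => rw [polyMap_add, matEval_add, hp, hq, matEval_add, map_add]
  | monomial i a => rw [polyMap_monomial, matEval_monomial, matEval_monomial, hτ]

/-- The left blocks. -/
def e11 : Mat N →+ BMat N where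
  toFun x := Matrix.fromBlocks x 0 0 0
  map_zero' := by simp
  map_add' x y := by simp [Matrix.fromBlocks_add]

/-- The lower left block. -/
def e21 : Mat N →+ BMat N where
  toFun x := Matrix.fromBlocks 0 0 x 0
  map_zero' := by simp
  map_add' x y := by simp [Matrix.fromBlocks_add]

theorem e11_apply (x : Mat N) : e11 x = Matrix.fromBlocks x 0 0 0 := rfl

theorem e21_apply (x : Mat N) : e21 x = Matrix.fromBlocks 0 0 x 0 := rfl

theorem lfun_e11 (f : ℕ → Mat N) (P : (Mat N)[X]) :
    lfun (fun i => e12 (f i)) (polyMap e11 P) = Matrix.fromBlocks 0 (lfun f P) 0 0 := by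
  induction P using Polynomial.induction_on' with
  | add p q hp hq => rw [polyMap_add, lfun_add, hp, hq, lfun_add]; simp [Matrix.fromBlocks_add]
  | monomial i a =>
    rw [polyMap_monomial, lfun_monomial, lfun_monomial]
    simp [e11_apply, e12_apply, Matrix.fromBlocks_multiply]

theorem lfun_e21 (f : ℕ → Mat N) (P : (Mat N)[X]) :
    lfun (fun i => e12 (f i)) (polyMap e21 P) = Matrix.fromBlocks 0 0 0 (lfun f P) := by
  induction P using Polynomial.induction_on' with
  | add p q hp hq => rw [polyMap_add, lfun_add, hp, hq, lfun_add]; simp [Matrix.fromBlocks_add]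
  | monomial i a =>
    rw [polyMap_monomial, lfun_monomial, lfun_monomial]
    simp [e21_apply, e12_apply, Matrix.fromBlocks_multiply]

/-- The polynomial matrix `[[P, 0], [Q, D]]`, with `D` constant. -/
def colPoly (P Q : (Mat N)[X]) (D : Mat N) : (BMat N)[X] :=
  polyMap e11 P + polyMap e21 Q + Polynomial.C (Matrix.fromBlocks 0 0 0 D)

theorem coeff_colPoly (P Q : (Mat N)[X]) (D : Mat N) (k : ℕ) :
    (colPoly P Q D).coeff k =
      Matrix.fromBlocks (P.coeff k) 0 (Q.coeff k) (if k = 0 then D else 0) := by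
  rw [colPoly, Polynomial.coeff_add, Polynomial.coeff_add, coeff_polyMap, coeff_polyMap,
    Polynomial.coeff_C, e11_apply, e21_apply]
  split_ifs <;> simp [Matrix.fromBlocks_add]

/-- The lower right block `D` is invisible here, because it multiplies the zero second block row of
`e12 (f i)`. -/
theorem lfun_colPoly (f : ℕ → Mat N) (P Q : (Mat N)[X]) (D : Mat N) :
    lfun (fun i => e12 (f i)) (colPoly P Q D) =
      Matrix.fromBlocks 0 (lfun f P) 0 (lfun f Q) := by
  rw [colPoly, lfun_add, lfun_add, lfun_e11, lfun_e21, ← Polynomial.monomial_zero_left,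
    lfun_monomial]
  simp [Matrix.fromBlocks_add, e12_apply, Matrix.fromBlocks_multiply]

theorem matEval_colPoly (P Q : (Mat N)[X]) (D : Mat N) (z : ℂ) :
    matEval (colPoly P Q D) z = Matrix.fromBlocks (matEval P z) 0 (matEval Q z) D := by
  rw [colPoly, matEval_add, matEval_add, matEval_C, matEval_polyMap _ fun c x => by
    simp [e11_apply, Matrix.fromBlocks_smul], matEval_polyMap _ fun c x => by
    simp [e21_apply, Matrix.fromBlocks_smul]]
  simp [e11_apply, e21_apply, Matrix.fromBlocks_add]

end Blocks

/-! ### The polynomial part of the fundamental matrix -/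

section Fundamental

variable {N : ℕ} {γ : ℝ → ℂ} {W : ℂ → Mat N}

/-- The first block column of the fundamental matrix. -/
def fundCol (γ : ℝ → ℂ) (W : ℂ → Mat N) : ℕ → (BMat N)[X]
  -- The block 1 encodes the convention -C_{-1} Q_{-1} = I. It is constant and is killed by every
  -- later product with the Cauchy transform.
  | 0 => colPoly (leftOP γ W 0) 0 1
  | n + 1 => colPoly (leftOP γ W (n + 1)) (-(Polynomial.C (normMat γ W n) * leftOP γ W n)) 0

/-- The moments, as upper right blocks. -/
def blockMoment (γ : ℝ → ℂ) (W : ℂ → Mat N) (i : ℕ) : BMat N := e12 (moment γ W i)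

/-- The polynomial matrix `V_n` with `Y_n = V_n [[1, F], [0, 1]]`, for the Cauchy transform `F`
of the weight. -/
def fundPoly (γ : ℝ → ℂ) (W : ℂ → Mat N) (n : ℕ) : (BMat N)[X] :=
  fundCol γ W n + assocPoly (blockMoment γ W) (fundCol γ W n)

/-- The inverse of `fundPoly`. -/
def fundPolyInv (γ : ℝ → ℂ) (W : ℂ → Mat N) (n : ℕ) : (BMat N)[X] :=
  polyMap (blockAnti N) (fundPoly γ (transposeWeight W) n)

theorem lfun_neg {R : Type*} [Ring R] (f : ℕ → R) (A : R[X]) : lfun f (-A) = -lfun f A := by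
  rw [eq_neg_iff_add_eq_zero, ← lfun_add, neg_add_cancel]
  simp [lfun]

theorem lfun_fundCol_succ (f : ℕ → Mat N) (n : ℕ) :
    lfun (fun i => e12 (f i)) (fundCol γ W (n + 1)) = Matrix.fromBlocks 0
      (lfun f (leftOP γ W (n + 1))) 0 (-(normMat γ W n * lfun f (leftOP γ W n))) := by
  rw [fundCol, lfun_colPoly, lfun_neg, lfun_C_mul]

theorem lfun_fundCol_zero (f : ℕ → Mat N) :
    lfun (fun i => e12 (f i)) (fundCol γ W 0) = Matrix.fromBlocks 0
      (lfun f (leftOP γ W 0)) 0 0 := by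
  rw [fundCol, lfun_colPoly]
  simp [lfun]

theorem matEval_assocMono_mul_eq_zero {m : Type*} [Fintype m] [DecidableEq m]
    {μ : ℕ → Matrix m m ℂ} {x : Matrix m m ℂ} (h : ∀ i, μ i * x = 0) (z : ℂ) (i : ℕ) :
    matEval (assocMono μ i) z * x = 0 := by
  induction i with
  | zero => simp [assocMono, matEval]
  | succ i ih => rw [assocMono, matEval_add, matEval_mul, matEval_C, add_mul, mul_assoc, ih, h,
      mul_zero, add_zero]

/-- Every coefficient of an associated polynomial is a combination of the μ_i with factors on the
left, so x meets some μ_i first. It is applied with μ_i and x both in the upper right block. -/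
theorem matEval_assocPoly_mul_eq_zero {m : Type*} [Fintype m] [DecidableEq m]
    {μ : ℕ → Matrix m m ℂ} {x : Matrix m m ℂ} (h : ∀ i, μ i * x = 0) (z : ℂ)
    (A : (Matrix m m ℂ)[X]) : matEval (assocPoly μ A) z * x = 0 := by
  induction A using Polynomial.induction_on' with
  | add p q hp hq => rw [assocPoly_add, matEval_add, add_mul, hp, hq, add_zero]
  | monomial i a => rw [assocPoly_monomial, matEval_mul, mul_assoc,
      matEval_assocMono_mul_eq_zero h, mul_zero]

/-- The first block column of Y_n is polynomial and the second is its Cauchy transform. The latter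
is the column times F plus the associated polynomial, and this polynomial part is absorbed in V_n
without being affected by the factor 1 + [[0, F], [0, 0]]. -/
theorem leftY_eq (hγ : IsSmoothLine γ) (hW : IsWeight γ W) {z : ℂ} (hz : z ∉ Set.range γ) (n : ℕ) :
    leftY γ W n z = matEval (fundPoly γ W n) z * (1 + e12 (cauchyMoment γ W 0 z)) := by
  rw [fundPoly, matEval_add, add_mul, mul_add, mul_add, mul_one, mul_one,
    matEval_assocPoly_mul_eq_zero (μ := blockMoment γ W) (fun i => e12_mul_e12 _ _), add_zero, add_assoc,
    ← lfun_eq_matEval (q := fun i => e12 (cauchyMoment γ W i z)) (fun i => by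
      rw [cauchyMoment_succ hγ hW hz, map_add, e12_smul, blockMoment])]
  rcases n with _ | n
  · rw [lfun_fundCol_zero, fundCol, matEval_colPoly, leftY, leftQ_eq hγ hW hz]
    simp [Matrix.fromBlocks_add, matEval]
  · rw [lfun_fundCol_succ, fundCol, matEval_colPoly, leftY, leftQ_eq hγ hW hz, leftQ_eq hγ hW hz]
    have : matEval (-(Polynomial.C (normMat γ W n) * leftOP γ W n)) z =
        -(normMat γ W n * matEval (leftOP γ W n) z) := by
      rw [matEval_eq_hom, map_neg, ← matEval_eq_hom, matEval_mul, matEval_C]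
    simp [Matrix.fromBlocks_add, this]

/-! ### Formal expansion at infinity -/

/-- The expansion of the Cauchy transform of the weight, as an upper right block. -/
def formalF (γ : ℝ → ℂ) (W : ℂ → Mat N) : LaurentSeries (BMat N) := stieltjes (blockMoment γ W) 0

/-- The formal matrix `diag(z^{-n}, z^n)`, in the variable `z⁻¹`. -/
def formalD (N : ℕ) (n : ℤ) : LaurentSeries (BMat N) :=
  HahnSeries.single n (proj1 N) + HahnSeries.single (-n) (proj2 N)

/-- The formal expansion of `S_n`. -/
def formalS (γ : ℝ → ℂ) (W : ℂ → Mat N) (n : ℕ) : LaurentSeries (BMat N) :=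
  HahnSeries.ofPowerSeries ℤ _ (PowerSeries.mk (leftSCoeff γ W n))

theorem formalD_mul_neg (n : ℤ) : formalD N n * formalD N (-n) = 1 := by
  simp only [formalD, add_mul, mul_add, HahnSeries.single_mul_single, proj1_mul_proj1,
    proj1_mul_proj2, proj2_mul_proj1, proj2_mul_proj2, neg_neg, add_neg_cancel, neg_add_cancel,
    HahnSeries.single_eq_zero, add_zero, zero_add]
  rw [← HahnSeries.single_add, proj_add]
  rfl

theorem formalF_mul_of {f : LaurentSeries (BMat N)} {μ : ℕ → BMat N}
    (h : ∀ i l, μ i * f.coeff l = 0) : stieltjes μ 0 * f = 0 := by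
  ext1
  funext l
  rw [HahnSeries.coeff_mul, HahnSeries.coeff_zero]
  refine Finset.sum_eq_zero fun ij _ => ?_
  rcases int_cases_pos ij.1 with ⟨k, hk⟩ | hk
  · rw [hk, coeff_stieltjes_succ, neg_mul, h, neg_zero]
  · rw [coeff_stieltjes_of_nonpos _ _ hk, zero_mul]

theorem blockMoment_mul_coeff_formalF (i : ℕ) (l : ℤ) :
    blockMoment γ W i * (formalF γ W).coeff l = 0 := by
  rcases int_cases_pos l with ⟨k, rfl⟩ | hk
  · rw [formalF, coeff_stieltjes_succ, mul_neg, blockMoment, blockMoment, e12_mul_e12, neg_zero]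
  · rw [formalF, coeff_stieltjes_of_nonpos _ _ hk, mul_zero]

theorem formalF_mul_formalF : formalF γ W * formalF γ W = 0 :=
  formalF_mul_of blockMoment_mul_coeff_formalF

theorem polyToLaurent_assocPoly_mul_formalF (A : (BMat N)[X]) :
    polyToLaurent (assocPoly (blockMoment γ W) A) * formalF γ W = 0 := by
  have h : ∀ i, polyToLaurent (assocMono (blockMoment γ W) i) * formalF γ W = 0 := by
    intro i
    induction i with
    | zero => simp [assocMono]
    | succ i ih =>
      rw [assocMono, map_add, map_mul, polyToLaurent_C, add_mul, mul_assoc, ih, mul_zero, zero_add]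
      ext1
      funext l
      rw [HahnSeries.C_mul_eq_smul, HahnSeries.coeff_smul, smul_eq_mul,
        blockMoment_mul_coeff_formalF, HahnSeries.coeff_zero]
  induction A using Polynomial.induction_on' with
  | add p q hp hq => rw [assocPoly_add, map_add, add_mul, hp, hq, add_zero]
  | monomial i a => rw [assocPoly_monomial, map_mul, mul_assoc, h, mul_zero]

theorem formalY_eq (n : ℕ) :
    polyToLaurent (fundPoly γ W n) * (1 + formalF γ W) =
      polyToLaurent (fundCol γ W n) + secondKind (blockMoment γ W) (fundCol γ W n) := by
  rw [fundPoly, map_add, add_mul, mul_add, mul_add, mul_one, mul_one,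
    polyToLaurent_assocPoly_mul_formalF, secondKind_eq, formalF, add_zero, add_assoc]

theorem coeff_fundCol_succ (n k : ℕ) : (fundCol γ W (n + 1)).coeff k =
    Matrix.fromBlocks ((leftOP γ W (n + 1)).coeff k) 0
      (-(normMat γ W n * (leftOP γ W n).coeff k)) 0 := by
  rw [fundCol, coeff_colPoly]; simp

theorem coeff_secondKind_succ {R : Type*} [Ring R] (μ : ℕ → R) (A : R[X]) (l : ℕ) :
    (secondKind μ A).coeff ((l : ℤ) + 1) = -lfun (fun i => μ (i + l)) A := by
  rw [secondKind, coeff_stieltjes_succ, zero_add]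

theorem coeff_formalY_neg (n k : ℕ) :
    (polyToLaurent (fundPoly γ W n) * (1 + formalF γ W)).coeff (-(k : ℤ)) =
      (fundCol γ W n).coeff k := by
  rw [formalY_eq, HahnSeries.coeff_add, coeff_polyToLaurent_neg, secondKind,
    coeff_stieltjes_of_nonpos _ _ (by omega), add_zero]

theorem coeff_formalY_succ (n l : ℕ) :
    (polyToLaurent (fundPoly γ W n) * (1 + formalF γ W)).coeff ((l : ℤ) + 1) =
      -lfun (fun i => e12 (moment γ W (i + l))) (fundCol γ W n) := by
  rw [formalY_eq, HahnSeries.coeff_add, coeff_polyToLaurent_of_pos _ (by omega), zero_add,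
    coeff_secondKind_succ]
  rfl

/-- The right side has no positive power of z, which is where orthogonality enters: it forces Q_n =
O(z⁻ⁿ⁻¹) and, by the choice of C_{n-1}, -C_{n-1} Q_{n-1} = z⁻ⁿ(I + O(z⁻¹)). The first column only
needs the degrees and the monic normalization. -/
theorem formalS_eq (hW : IsWeight γ W) (hreg : IsRegularWeight γ W) (n : ℕ) :
    polyToLaurent (fundPoly γ W n) * (1 + formalF γ W) * formalD N n = formalS γ W n := by
  ext1
  funext l
  rw [formalD, mul_add, HahnSeries.coeff_add, HahnSeries.coeff_mul_single,
    HahnSeries.coeff_mul_single, sub_neg_eq_add, formalS]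
  have hP := fun n => leftOP_isMomentOP hW hreg n
  have hb : ∀ a b c d : Mat N, Matrix.fromBlocks a b c d * proj1 N = Matrix.fromBlocks a 0 c 0 := by
    simp [proj1, Matrix.fromBlocks_multiply]
  have hb' : ∀ a b c d : Mat N,
      Matrix.fromBlocks a b c d * proj2 N = Matrix.fromBlocks 0 b 0 d := by
    simp [proj2, Matrix.fromBlocks_multiply]
  have hlow : ∀ n k, n < k → (leftOP γ W n).coeff k = 0 := fun n k h =>
    Polynomial.coeff_eq_zero_of_natDegree_lt ((hP n).1.trans_lt h)
  rcases n with _ | n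
  · rw [Nat.cast_zero, sub_zero, add_zero, ← mul_add, proj_add, mul_one]
    rcases int_cases_nonneg l with ⟨l, rfl⟩ | hl
    · rw [coeff_ofPowerSeries_nat, PowerSeries.coeff_mk]
      rcases l with _ | l
      · have := coeff_formalY_neg (γ := γ) (W := W) 0 0
        rw [Nat.cast_zero, neg_zero] at this
        rw [Nat.cast_zero, this, fundCol, coeff_colPoly, (hP 0).2.1, leftSCoeff]
        simp [Matrix.fromBlocks_one]
      · rw [Nat.cast_succ, coeff_formalY_succ, lfun_fundCol_zero, leftSCoeff,
          leftMoment_eq_lfun hW, Matrix.fromBlocks_neg]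
        simp
    · rw [coeff_ofPowerSeries_of_neg _ hl]
      obtain ⟨k, rfl⟩ : ∃ k : ℕ, l = -k := ⟨(-l).toNat, by omega⟩
      rw [coeff_formalY_neg, fundCol, coeff_colPoly, hlow 0 k (by omega), if_neg (by omega)]
      simp
  -- `proj1` selects the polynomial column, shifted by z^{-(n+1)}; `hB` below does the same for the
  -- column of Cauchy transforms, shifted by z^{n+1}.
  · have hA : (polyToLaurent (fundPoly γ W (n + 1)) * (1 + formalF γ W)).coeff
        (l - (n + 1 : ℕ)) * proj1 N = if l ≤ n + 1 then
          (fundCol γ W (n + 1)).coeff (n + 1 - l).toNat else 0 := by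
      split_ifs with h
      · rw [show l - (n + 1 : ℕ) = -((n + 1 - l).toNat : ℤ) by omega, coeff_formalY_neg,
          coeff_fundCol_succ, hb]
      · rw [show l - (n + 1 : ℕ) = ((l - (n + 1) - 1).toNat : ℤ) + 1 by omega, coeff_formalY_succ,
          lfun_fundCol_succ, Matrix.fromBlocks_neg, hb]
        simp
    have hB : (polyToLaurent (fundPoly γ W (n + 1)) * (1 + formalF γ W)).coeff
        (l + (n + 1 : ℕ)) * proj2 N = if 0 ≤ l + n then
          Matrix.fromBlocks 0 (-leftMoment γ W (n + 1) (l + n).toNat) 0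
            (normMat γ W n * leftMoment γ W n (l + n).toNat) else 0 := by
      split_ifs with h
      · rw [show l + (n + 1 : ℕ) = ((l + n).toNat : ℤ) + 1 by omega, coeff_formalY_succ,
          lfun_fundCol_succ, Matrix.fromBlocks_neg, hb', leftMoment_eq_lfun hW,
          leftMoment_eq_lfun hW, neg_neg]
      · rw [show l + (n + 1 : ℕ) = -((-(l + (n + 1))).toNat : ℤ) by omega, coeff_formalY_neg,
          coeff_fundCol_succ, hb']
        simp
    have hm : ∀ n k, k < n → leftMoment γ W n k = 0 := fun n k h => by
      rw [leftMoment_eq_lfun hW, (hP n).2.2 k h]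
    rw [hA, hB]
    rcases int_cases_nonneg l with ⟨l, rfl⟩ | hl
    · rw [coeff_ofPowerSeries_nat, PowerSeries.coeff_mk, if_pos (by omega : (0 : ℤ) ≤ l + n)]
      rcases l with _ | l
      · rw [if_pos (by omega), show ((n : ℤ) + 1 - (0 : ℕ)).toNat = n + 1 by omega,
          show (((0 : ℕ) : ℤ) + n).toNat = n by omega, coeff_fundCol_succ, (hP (n + 1)).2.1,
          hlow n _ (by omega), hm (n + 1) n (by omega), normMat,
          Matrix.nonsing_inv_mul _ (isUnit_leftMoment hW hreg n), leftSCoeff, Matrix.fromBlocks_add]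
        simp [Matrix.fromBlocks_one]
      · rw [leftSCoeff, show (((l + 1 : ℕ) : ℤ) + n).toNat = n + 1 + l by omega]
        by_cases h : l ≤ n
        · rw [if_pos (by omega), if_pos h, if_pos h,
            show ((n : ℤ) + 1 - (l + 1 : ℕ)).toNat = n - l by omega, coeff_fundCol_succ,
            Matrix.fromBlocks_add]
          simp
        · rw [if_neg (by omega), if_neg h, if_neg h, zero_add]
    · rw [coeff_ofPowerSeries_of_neg _ hl, if_pos (by omega), coeff_fundCol_succ,
        hlow (n + 1) _ (by omega), hlow n _ (by omega)]
      split_ifs with h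
      · rw [hm _ _ (by omega), hm _ _ (by omega)]
        simp
      · simp

/-- The formal expansion of the inverse of `S_n`. -/
def formalSInv (γ : ℝ → ℂ) (W : ℂ → Mat N) (n : ℕ) : LaurentSeries (BMat N) :=
  laurentMap (blockAnti N) (formalS γ (transposeWeight W) n)

theorem formalSInv_eq_ofPowerSeries (n : ℕ) : formalSInv γ W n = HahnSeries.ofPowerSeries ℤ _
    (PowerSeries.mk fun l => blockAnti N (leftSCoeff γ (transposeWeight W) n l)) := by
  ext1
  funext l
  rw [formalSInv, coeff_laurentMap, formalS]
  rcases int_cases_nonneg l with ⟨k, rfl⟩ | h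
  · rw [coeff_ofPowerSeries_nat, coeff_ofPowerSeries_nat, PowerSeries.coeff_mk,
      PowerSeries.coeff_mk]
  · rw [coeff_ofPowerSeries_of_neg _ h, coeff_ofPowerSeries_of_neg _ h, map_zero]

/-- The anti-automorphism is applied to the factorization of S_n for Wᵀ: it reverses the product,
changes the sign of F and inverts diag(z⁻ⁿ, zⁿ). -/
theorem formalSInv_eq (hW : IsWeight γ W) (hreg : IsRegularWeight γ W) (n : ℕ) :
    formalD N (-n) * (1 - formalF γ W) * polyToLaurent (fundPolyInv γ W n) =
      formalSInv γ W n := by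
  have h1 : laurentMap (blockAnti N) (1 : LaurentSeries (BMat N)) = 1 := by
    rw [← HahnSeries.single_zero_one, laurentMap_single, blockAnti_one]
  have h2 : laurentMap (blockAnti N) (formalF γ (transposeWeight W)) = -formalF γ W := by
    rw [formalF, laurentMap_stieltjes]
    ext1
    funext l
    rw [formalF, HahnSeries.coeff_neg]
    rcases int_cases_pos l with ⟨k, rfl⟩ | h
    · rw [coeff_stieltjes_succ, coeff_stieltjes_succ, blockMoment, blockMoment, blockAnti_e12,
        moment_transpose, Matrix.transpose_transpose]
    · rw [coeff_stieltjes_of_nonpos _ _ h, coeff_stieltjes_of_nonpos _ _ h, neg_zero]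
  have h3 : laurentMap (blockAnti N) (formalD N n) = formalD N (-n) := by
    rw [formalD, laurentMap_add, laurentMap_single, laurentMap_single, proj1, proj2,
      blockAnti_fromBlocks, blockAnti_fromBlocks, formalD, neg_neg, add_comm]
    simp [proj1, proj2]
  rw [formalSInv, ← formalS_eq hW.transpose hreg.transpose, laurentMap_mul_anti _ blockAnti_mul,
    laurentMap_mul_anti _ blockAnti_mul, laurentMap_add, h1, h2, h3, laurentMap_polyToLaurent,
    fundPolyInv, mul_assoc, sub_eq_add_neg]

theorem one_add_formalF_mul : (1 + formalF γ W) * (1 - formalF γ W) = 1 := by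
  rw [add_mul, mul_sub, mul_sub, formalF_mul_formalF]; simp

theorem formalS_mul_inv (hW : IsWeight γ W) (hreg : IsRegularWeight γ W) (n : ℕ) :
    formalS γ W n * formalSInv γ W n =
      polyToLaurent (fundPoly γ W n * fundPolyInv γ W n) := by
  rw [← formalS_eq hW hreg, ← formalSInv_eq hW hreg, map_mul]
  calc _ = polyToLaurent (fundPoly γ W n) * ((1 + formalF γ W) * (formalD N n * formalD N (-n)) *
        (1 - formalF γ W)) * polyToLaurent (fundPolyInv γ W n) := by simp only [mul_assoc]
    _ = _ := by rw [formalD_mul_neg, mul_one, one_add_formalF_mul, mul_one]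

theorem leftSCoeff_zero (n : ℕ) : leftSCoeff γ W n 0 = 1 := by
  cases n <;> rfl

/-- Liouville's theorem in algebraic form: in S_n times its candidate inverse the factors containing
F and z^{±n} cancel, leaving a polynomial in z that is also a power series in z⁻¹, hence its
constant term 1. -/
theorem fundPoly_mul_inv (hW : IsWeight γ W) (hreg : IsRegularWeight γ W) (n : ℕ) :
    fundPoly γ W n * fundPolyInv γ W n = 1 := by
  have h := formalS_mul_inv hW hreg n
  rw [formalSInv_eq_ofPowerSeries, formalS, ← map_mul] at h
  rw [polynomial_eq_C_of_polyToLaurent h.symm, PowerSeries.coeff_mul]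
  simp [leftSCoeff_zero, blockAnti_one]

theorem formalS_mul_inv_eq_one (hW : IsWeight γ W) (hreg : IsRegularWeight γ W) (n : ℕ) :
    formalS γ W n * formalSInv γ W n = 1 := by
  rw [formalS_mul_inv hW hreg, fundPoly_mul_inv hW hreg, map_one]

/-- The candidate inverse, built from Wᵀ, is J S_n^R J⁻¹ termwise, and formal inverses are unique.
-/
theorem invCoeff_leftSCoeff (hW : IsWeight γ W) (hreg : IsRegularWeight γ W) (n l : ℕ) :
    invCoeff (leftSCoeff γ W n) l = blockJ N * rightSCoeff γ W n l * blockJInv N := by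
  have h := formalS_mul_inv_eq_one hW hreg n
  rw [formalSInv_eq_ofPowerSeries, formalS, ← map_mul, ← map_one (HahnSeries.ofPowerSeries ℤ _)] at h
  rw [invCoeff_unique (leftSCoeff_zero n) (Or.inl (HahnSeries.ofPowerSeries_injective h))]
  beta_reduce
  rw [blockAnti_apply, rightSCoeff_eq_transpose hW hreg]

theorem invCoeff_rightSCoeff (hW : IsWeight γ W) (hreg : IsRegularWeight γ W) (n l : ℕ) :
    invCoeff (rightSCoeff γ W n) l = blockJInv N * leftSCoeff γ W n l * blockJ N := by
  have h : ∀ l, rightSCoeff γ W n l = blockJInv N * invCoeff (leftSCoeff γ W n) l * blockJ N := by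
    intro l
    rw [invCoeff_leftSCoeff hW hreg, ← mul_assoc, ← mul_assoc, blockJInv_mul, one_mul, mul_assoc,
      blockJInv_mul, mul_one]
  have h0 : rightSCoeff γ W n 0 = 1 := by cases n <;> rfl
  refine congrFun (invCoeff_unique (t := fun l => blockJInv N * leftSCoeff γ W n l * blockJ N) h0
    (Or.inr ?_)) l
  have h1 := mk_mul_mk_invCoeff (leftSCoeff_zero (γ := γ) (W := W) n)
  ext1 l
  have h2 := congrArg (PowerSeries.coeff l) h1
  rw [PowerSeries.coeff_mul] at h2 ⊢
  simp only [PowerSeries.coeff_mk, h] at h2 ⊢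
  calc _ = blockJInv N * (∑ x ∈ Finset.HasAntidiagonal.antidiagonal l,
        leftSCoeff γ W n x.1 * invCoeff (leftSCoeff γ W n) x.2) * blockJ N := by
        rw [Finset.mul_sum, Finset.sum_mul]
        refine Finset.sum_congr rfl fun x _ => ?_
        calc _ = blockJInv N * leftSCoeff γ W n x.1 * (blockJ N * blockJInv N) *
              invCoeff (leftSCoeff γ W n) x.2 * blockJ N := by simp only [mul_assoc]
          _ = _ := by rw [blockJ_mul_inv]; simp only [mul_assoc, one_mul]
    _ = _ := by
      rw [h2, PowerSeries.coeff_one]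
      split_ifs
      · rw [mul_one, blockJInv_mul]
      · simp

/-! ### Lower bounds for orders -/

theorem coeff_mul_eq_zero_of_lt {R : Type*} [Ring R] {f g : LaurentSeries R} {a b : ℤ}
    (hf : ∀ l < a, f.coeff l = 0) (hg : ∀ l < b, g.coeff l = 0) :
    ∀ l < a + b, (f * g).coeff l = 0 := by
  intro l hl
  rw [HahnSeries.coeff_mul]
  refine Finset.sum_eq_zero fun ij hij => ?_
  have h : ij.1 + ij.2 = l := (Finset.mem_antidiagonal.1 hij).2.2
  rcases lt_or_ge ij.1 a with h1 | h1
  · rw [hf _ h1, zero_mul]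
  · rw [hg _ (by omega), mul_zero]

/-- The formal expansion of `Y_n' Y_n⁻¹`. -/
def formalLogDeriv (γ : ℝ → ℂ) (W : ℂ → Mat N) (n : ℕ) : LaurentSeries (BMat N) :=
  polyToLaurent (Polynomial.derivative (fundPoly γ W n)) * polyToLaurent (fundPolyInv γ W n) +
    polyToLaurent (fundPoly γ W n) * laurentDeriv (formalF γ W) *
      polyToLaurent (fundPolyInv γ W n)

theorem laurentDeriv_formalF_mul_formalF : laurentDeriv (formalF γ W) * formalF γ W = 0 := by
  ext1
  funext l
  rw [HahnSeries.coeff_mul, HahnSeries.coeff_zero]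
  refine Finset.sum_eq_zero fun ij _ => ?_
  rw [coeff_laurentDeriv]
  rcases int_cases_pos (ij.1 - 1) with ⟨k, hk⟩ | hk
  · rw [hk]; nth_rewrite 1 [formalF]
    rw [coeff_stieltjes_succ, smul_neg, neg_mul, smul_mul_assoc,
      blockMoment_mul_coeff_formalF, smul_zero, neg_zero]
  · nth_rewrite 1 [formalF]
    rw [coeff_stieltjes_of_nonpos _ _ hk, smul_zero, zero_mul]

theorem laurentDeriv_formalD_mul (n : ℤ) : laurentDeriv (formalD N (-n)) * formalD N n =
    HahnSeries.single (1 : ℤ) (n • (proj1 N - proj2 N)) := by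
  rw [formalD, laurentDeriv_add, laurentDeriv_single, laurentDeriv_single, formalD]
  simp only [add_mul, mul_add, HahnSeries.single_mul_single, neg_neg, smul_mul_assoc,
    proj1_mul_proj1, proj1_mul_proj2, proj2_mul_proj1, proj2_mul_proj2, smul_zero,
    HahnSeries.single_eq_zero, add_zero, zero_add]
  rw [show -n + 1 + n = 1 by ring, show n + 1 + -n = 1 by ring, ← HahnSeries.single_add, smul_sub,
    neg_smul, sub_eq_add_neg]

/-- Put Y = S D⁻¹ with D = diag(z⁻ⁿ, zⁿ). Then Y' Y⁻¹ = S' S⁻¹ + S (n/z) diag(1, -1) S⁻¹. Both S and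
S⁻¹ are power series in z⁻¹, and S' and n/z contain only negative powers of z. -/
theorem coeff_formalLogDeriv (hW : IsWeight γ W) (hreg : IsRegularWeight γ W) (n : ℕ) {l : ℤ}
    (hl : l ≤ 0) : (formalLogDeriv γ W n).coeff l = 0 := by
  have hDD : formalD N (-n) * formalD N n = 1 := by
    have := formalD_mul_neg (N := N) (-n)
    rwa [neg_neg] at this
  have h1 : polyToLaurent (fundPoly γ W n) * (1 + formalF γ W) =
      formalS γ W n * formalD N (-n) := by
    rw [← formalS_eq hW hreg, mul_assoc _ (formalD N n), formalD_mul_neg, mul_one]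
  have h2 : (1 - formalF γ W) * polyToLaurent (fundPolyInv γ W n) =
      formalD N n * formalSInv γ W n := by
    rw [← formalSInv_eq hW hreg, ← mul_assoc, ← mul_assoc, formalD_mul_neg, one_mul]
  have h3 : formalLogDeriv γ W n = laurentDeriv (polyToLaurent (fundPoly γ W n) *
      (1 + formalF γ W)) * ((1 - formalF γ W) * polyToLaurent (fundPolyInv γ W n)) := by
    rw [laurentDeriv_mul, laurentDeriv_add, laurentDeriv_one, zero_add, add_mul, ← mul_assoc,
      mul_assoc _ (1 + formalF γ W), one_add_formalF_mul, mul_one, ← mul_assoc,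
      mul_assoc _ (laurentDeriv _), mul_sub, laurentDeriv_formalF_mul_formalF, sub_zero, mul_one,
      laurentDeriv_polyToLaurent, formalLogDeriv]
  have hS : ∀ l < 0, (formalS γ W n).coeff l = 0 := fun l hl => coeff_ofPowerSeries_of_neg _ hl
  have hS' : ∀ l < 0, (formalSInv γ W n).coeff l = 0 := fun l hl => by
    rw [formalSInv_eq_ofPowerSeries, coeff_ofPowerSeries_of_neg _ hl]
  have h4 : formalLogDeriv γ W n = laurentDeriv (formalS γ W n) * formalSInv γ W n +
      formalS γ W n * HahnSeries.single (1 : ℤ) ((n : ℤ) • (proj1 N - proj2 N)) *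
        formalSInv γ W n := by
    rw [h3, h1, h2, laurentDeriv_mul, add_mul, ← mul_assoc, mul_assoc _ (formalD N (-n)), hDD,
      mul_one, ← mul_assoc, mul_assoc _ (laurentDeriv (formalD N (-n))), laurentDeriv_formalD_mul]
  rw [h4, HahnSeries.coeff_add]
  have hd : ∀ l < 1, (laurentDeriv (formalS γ W n)).coeff l = 0 := fun l hl => by
    rw [coeff_laurentDeriv, hS _ (by omega), smul_zero]
  have hs : ∀ l < 1, (HahnSeries.single (1 : ℤ)
      ((n : ℤ) • (proj1 N - proj2 N)) : LaurentSeries (BMat N)).coeff l = 0 := fun l hl =>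
    HahnSeries.coeff_single_of_ne (by omega)
  rw [coeff_mul_eq_zero_of_lt hd hS' l (by omega),
    coeff_mul_eq_zero_of_lt (coeff_mul_eq_zero_of_lt hS hs) hS' l (by omega), add_zero]

theorem coeff_ofPowerSeries_mul_polyToLaurent_mul {R : Type*} [Ring R] (a b : ℕ → R) (H : R[X])
    {d : ℕ} (hd : H.natDegree ≤ d) (k : ℕ) :
    (HahnSeries.ofPowerSeries ℤ R (PowerSeries.mk a) * polyToLaurent H *
      HahnSeries.ofPowerSeries ℤ R (PowerSeries.mk b)).coeff (-(k : ℤ)) =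
      prodCoeff a (fun l => H.coeff l) d b k := by
  have hmono : ∀ l h, (HahnSeries.ofPowerSeries ℤ R (PowerSeries.mk a) *
      polyToLaurent (Polynomial.monomial l h) *
      HahnSeries.ofPowerSeries ℤ R (PowerSeries.mk b)).coeff (-(k : ℤ)) =
      if k ≤ l then ∑ i ∈ Finset.range (l - k + 1), a i * h * b (l - k - i) else 0 := by
    intro l h
    rw [polyToLaurent_monomial]
    -- The monomial h zˡ is split so that the central factor zˡ can move to the front, leaving a
    -- product of ordinary power series.
    have h1 : (HahnSeries.single (-(l : ℤ)) h : LaurentSeries R) =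
        HahnSeries.single (-(l : ℤ)) 1 * HahnSeries.ofPowerSeries ℤ R (PowerSeries.C h) := by
      rw [HahnSeries.ofPowerSeries_C, HahnSeries.C_apply, HahnSeries.single_mul_single]
      simp
    rw [h1, ← mul_assoc, ← single_mul_comm, mul_assoc, mul_assoc, ← map_mul, ← map_mul,
      HahnSeries.coeff_single_mul, one_mul]
    split_ifs with hkl
    · rw [show -(k : ℤ) - -(l : ℤ) = ((l - k : ℕ) : ℤ) by omega, coeff_ofPowerSeries_nat,
        PowerSeries.coeff_mul, Finset.Nat.sum_antidiagonal_eq_sum_range_succ fun i j =>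
          PowerSeries.coeff i (PowerSeries.mk a) *
            PowerSeries.coeff j (PowerSeries.C h * PowerSeries.mk b)]
      simp only [PowerSeries.coeff_mk, PowerSeries.coeff_C_mul, mul_assoc, Nat.succ_eq_add_one]
    · rw [coeff_ofPowerSeries_of_neg _ (by omega)]
  conv_lhs => rw [H.as_sum_range' (d + 1) (by omega)]
  rw [map_sum, Finset.mul_sum, Finset.sum_mul, HahnSeries.coeff_sum]
  simp only [hmono]
  rw [prodCoeff, ← Finset.sum_filter]
  refine Finset.sum_congr ?_ fun _ _ => rfl
  ext l
  simp only [Finset.mem_filter, Finset.mem_range, Finset.mem_Icc]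
  omega

/-- The formal counterpart of `Y_n H Y_n⁻¹ = S_n H S_n⁻¹` for block diagonal `H`. -/
theorem formal_conj (hW : IsWeight γ W) (hreg : IsRegularWeight γ W) (n : ℕ) (H : (BMat N)[X])
    (h1 : ∀ k, H.coeff k * proj1 N = proj1 N * H.coeff k)
    (h2 : ∀ k, H.coeff k * proj2 N = proj2 N * H.coeff k) :
    polyToLaurent (fundPoly γ W n) * ((1 + formalF γ W) * polyToLaurent H * (1 - formalF γ W)) *
      polyToLaurent (fundPolyInv γ W n) =
    formalS γ W n * polyToLaurent H * formalSInv γ W n := by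
  have hc : ∀ (a : ℤ) (e : BMat N), (∀ k, H.coeff k * e = e * H.coeff k) →
      polyToLaurent H * HahnSeries.single a e = HahnSeries.single a e * polyToLaurent H := by
    intro a e he
    ext1
    funext l
    rw [HahnSeries.coeff_single_mul, HahnSeries.coeff_mul_single]
    rcases le_or_gt (l - a) 0 with h | h
    · obtain ⟨k, hk⟩ : ∃ k : ℕ, l - a = -k := ⟨(-(l - a)).toNat, by omega⟩
      rw [hk, coeff_polyToLaurent_neg, he]
    · rw [coeff_polyToLaurent_of_pos _ h, zero_mul, mul_zero]
  have hD : polyToLaurent H * formalD N (-n) = formalD N (-n) * polyToLaurent H := by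
    rw [formalD, mul_add, add_mul, hc _ _ h1, hc _ _ h2]
  rw [← formalS_eq hW hreg, ← formalSInv_eq hW hreg]
  calc _ = polyToLaurent (fundPoly γ W n) * (1 + formalF γ W) * (formalD N n * formalD N (-n)) *
        polyToLaurent H * (1 - formalF γ W) * polyToLaurent (fundPolyInv γ W n) := by
        rw [formalD_mul_neg, mul_one]; simp only [mul_assoc]
    _ = polyToLaurent (fundPoly γ W n) * (1 + formalF γ W) * formalD N n *
        (polyToLaurent H * formalD N (-n)) * (1 - formalF γ W) *
          polyToLaurent (fundPolyInv γ W n) := by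
        rw [hD]; simp only [mul_assoc]
    _ = _ := by simp only [mul_assoc]

end Fundamental

/-! ### Calculus of asymptotic expansions -/

section Asymptotics

/-- The remainder of order `K` of the expansion `f ∼ ∑ a_i z^{-i}` is `O(|z|^{-K})`. -/
def ExpansionUpTo (l : Filter ℂ) (K : ℕ) (f : ℂ → ℂ) (a : ℕ → ℂ) : Prop :=
  (fun z => f z - ∑ i ∈ Finset.range K, a i * (z ^ i)⁻¹) =O[l] fun z => (‖z‖ ^ K)⁻¹

variable {l : Filter ℂ}

theorem eventually_ne_zero_of_le_cobounded (hl : l ≤ cobounded ℂ) : ∀ᶠ z in l, z ≠ 0 :=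
  hl (eventually_ne_cobounded 0)

theorem ExpansionUpTo.congr {K : ℕ} {f g : ℂ → ℂ} {a b : ℕ → ℂ} (h : ExpansionUpTo l K f a)
    (hfg : ∀ᶠ z in l, f z = g z) (hab : ∀ i, a i = b i) : ExpansionUpTo l K g b :=
  IsBigO.congr' h (hfg.mono fun z hz => by simp only [hz, hab]) EventuallyEq.rfl

/-- Subtracting the leading term and multiplying by z trades one order of the remainder for a shift
of the coefficients; inductions on the order run through this equivalence. -/
theorem expansionUpTo_succ_iff (hl : l ≤ cobounded ℂ) (K : ℕ) (f : ℂ → ℂ) (a : ℕ → ℂ) :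
    ExpansionUpTo l (K + 1) f a ↔
      ExpansionUpTo l K (fun z => z * (f z - a 0)) (fun i => a (i + 1)) := by
  have h0 := eventually_ne_zero_of_le_cobounded hl
  have key : ∀ z : ℂ, z ≠ 0 → z * (f z - a 0) - ∑ i ∈ Finset.range K, a (i + 1) * (z ^ i)⁻¹ =
      z * (f z - ∑ i ∈ Finset.range (K + 1), a i * (z ^ i)⁻¹) := by
    intro z hz
    rw [Finset.sum_range_succ', mul_sub, mul_sub, mul_add, Finset.mul_sum, pow_zero, inv_one,
      mul_one]
    have : ∀ i, z * (a (i + 1) * (z ^ (i + 1))⁻¹) = a (i + 1) * (z ^ i)⁻¹ := fun i => by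
      field_simp
      rw [pow_succ]
      field_simp
    simp only [this]
    ring
  constructor
  · intro h
    have h1 : (fun z : ℂ => z) =O[l] fun z => ‖z‖ := isBigO_norm_right.2 (isBigO_refl _ _)
    refine (h1.mul h).congr' (h0.mono fun z hz => (key z hz).symm) (h0.mono fun z hz => ?_)
    have : ‖z‖ ≠ 0 := norm_ne_zero_iff.2 hz
    simp only [pow_succ]
    field_simp
  · intro h
    have h1 : (fun z : ℂ => z⁻¹) =O[l] fun z => ‖z‖⁻¹ := by
      refine IsBigO.of_norm_left ?_
      simp only [norm_inv]
      exact isBigO_refl _ _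
    refine (h1.mul h).congr' (h0.mono fun z hz => ?_) (h0.mono fun z hz => ?_)
    · simp only [key z hz]
      field_simp
    · have : ‖z‖ ≠ 0 := norm_ne_zero_iff.2 hz
      simp only [pow_succ]
      field_simp

theorem ExpansionUpTo.add {K : ℕ} {f g : ℂ → ℂ} {a b : ℕ → ℂ} (hf : ExpansionUpTo l K f a)
    (hg : ExpansionUpTo l K g b) :
    ExpansionUpTo l K (fun z => f z + g z) (fun i => a i + b i) :=
  (IsBigO.add hf hg).congr_left fun z => by
    simp only [add_mul, Finset.sum_add_distrib]; ring

theorem ExpansionUpTo.const_mul {K : ℕ} {f : ℂ → ℂ} {a : ℕ → ℂ} (hf : ExpansionUpTo l K f a)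
    (c : ℂ) : ExpansionUpTo l K (fun z => c * f z) (fun i => c * a i) :=
  (IsBigO.const_mul_left hf c).congr_left fun z => by
    simp only [mul_sub, Finset.mul_sum, mul_assoc]

theorem ExpansionUpTo.zero (K : ℕ) : ExpansionUpTo l K (fun _ => 0) (fun _ => 0) := by
  simp only [ExpansionUpTo, zero_mul, Finset.sum_const_zero, sub_zero]
  exact isBigO_zero _ _

theorem ExpansionUpTo.sum {ι : Type*} (s : Finset ι) {K : ℕ} {f : ι → ℂ → ℂ} {a : ι → ℕ → ℂ}
    (hf : ∀ j ∈ s, ExpansionUpTo l K (f j) (a j)) :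
    ExpansionUpTo l K (fun z => ∑ j ∈ s, f j z) (fun i => ∑ j ∈ s, a j i) := by
  induction s using Finset.cons_induction with
  | empty => simpa using ExpansionUpTo.zero K
  | cons j s hj ih =>
    simp only [Finset.sum_cons]
    exact (hf j (Finset.mem_cons_self j s)).add
      (ih fun i hi => hf i (Finset.mem_cons_of_mem hi))

/-- Induction on the order through f g - a₀ b₀ = (f - a₀) g + a₀ (g - b₀). The first term uses the
induction hypothesis for z(f - a₀), so f and g have to vary in the induction. -/
theorem ExpansionUpTo.mul (hl : l ≤ cobounded ℂ) (K : ℕ) {f g : ℂ → ℂ} {a b : ℕ → ℂ}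
    (hf : ∀ K, ExpansionUpTo l K f a) (hg : ∀ K, ExpansionUpTo l K g b) :
    ExpansionUpTo l K (fun z => f z * g z)
      (fun i => ∑ p ∈ Finset.HasAntidiagonal.antidiagonal i, a p.1 * b p.2) := by
  induction K generalizing f g a b with
  | zero =>
    have h1 := hf 0
    have h2 := hg 0
    simp only [ExpansionUpTo, Finset.range_zero, Finset.sum_empty, sub_zero, pow_zero,
      inv_one] at h1 h2 ⊢
    simpa using IsBigO.mul h1 h2
  | succ K ih =>
    rw [expansionUpTo_succ_iff hl]
    have hf1 : ∀ K, ExpansionUpTo l K (fun z => z * (f z - a 0)) (fun i => a (i + 1)) := fun K =>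
      (expansionUpTo_succ_iff hl K f a).1 (hf (K + 1))
    have hg1 := (expansionUpTo_succ_iff hl K g b).1 (hg (K + 1))
    refine ((ih hf1 hg).add (hg1.const_mul (a 0))).congr (Eventually.of_forall fun z => ?_)
      fun i => ?_
    · simp only [Finset.Nat.antidiagonal_zero, Finset.sum_singleton]; ring
    · rw [Finset.Nat.antidiagonal_succ, Finset.sum_cons, Finset.sum_map, add_comm]
      simp

theorem isBigO_inv_norm_pow (hl : l ≤ cobounded ℂ) {m n : ℕ} (h : m ≤ n) :
    (fun z : ℂ => (‖z‖ ^ n)⁻¹) =O[l] fun z => (‖z‖ ^ m)⁻¹ := by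
  have h1 : ∀ᶠ z : ℂ in l, 1 ≤ ‖z‖ :=
    hl ((tendsto_norm_cobounded_atTop (E := ℂ)).eventually_ge_atTop 1)
  refine IsBigO.of_bound 1 (h1.mono fun z hz => ?_)
  rw [one_mul, Real.norm_of_nonneg (by positivity), Real.norm_of_nonneg (by positivity)]
  exact inv_anti₀ (by positivity) (pow_le_pow_right₀ hz h)

/-- A uniform loss of powers in the remainders is harmless. -/
theorem expansionUpTo_of_weak (hl : l ≤ cobounded ℂ) {f : ℂ → ℂ} {a : ℕ → ℂ} {m : ℕ}
    (h : ∀ K, (fun z => f z - ∑ i ∈ Finset.range (K + m), a i * (z ^ i)⁻¹) =O[l]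
      fun z => (‖z‖ ^ K)⁻¹) (K : ℕ) : ExpansionUpTo l K f a := by
  -- The m surplus terms of the partial sum are themselves O(|z|⁻ᴷ).
  have h1 : (fun z : ℂ => ∑ i ∈ Finset.range m, a (K + i) * (z ^ (K + i))⁻¹) =O[l]
      fun z => (‖z‖ ^ K)⁻¹ := by
    refine IsBigO.fun_sum fun i _ => IsBigO.const_mul_left (?_ :
      (fun z : ℂ => (z ^ (K + i))⁻¹) =O[l] fun z => (‖z‖ ^ K)⁻¹) _
    refine IsBigO.trans (IsBigO.of_norm_left ?_) (isBigO_inv_norm_pow hl (Nat.le_add_right K i))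
    simp only [norm_inv, norm_pow]
    exact isBigO_refl _ _
  refine ((h K).add h1).congr_left fun z => ?_
  rw [Finset.sum_range_add]
  ring

/-- The filter of the points that go to infinity away from `Γ`. -/
def awayFilter (Γ : Set ℂ) (c : ℝ) (k : ℕ) : Filter ℂ :=
  cobounded ℂ ⊓ 𝓟 {z : ℂ | c ≤ ‖z‖ ^ k * Metric.infDist z Γ}

theorem awayFilter_le (Γ : Set ℂ) (c : ℝ) (k : ℕ) : awayFilter Γ c k ≤ cobounded ℂ := inf_le_left

theorem eventually_awayFilter {Γ : Set ℂ} {c : ℝ} (hc : 0 < c) (k : ℕ) :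
    ∀ᶠ z in awayFilter Γ c k, z ∉ Γ ∧ z ≠ 0 ∧ c ≤ ‖z‖ ^ k * Metric.infDist z Γ := by
  have h1 : ∀ᶠ z in awayFilter Γ c k, c ≤ ‖z‖ ^ k * Metric.infDist z Γ :=
    eventually_inf_principal.2 (Eventually.of_forall fun z hz => hz)
  filter_upwards [h1, eventually_ne_zero_of_le_cobounded (awayFilter_le Γ c k)] with z hz hz0
  refine ⟨fun h => ?_, hz0, hz⟩
  rw [Metric.infDist_zero_of_mem h, mul_zero] at hz
  exact absurd hz (not_le.2 hc)

variable {m : Type*} {Γ : Set ℂ}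

theorem hasAsymptoticExpansion_iff {F : ℂ → Matrix m m ℂ} {a : ℕ → Matrix m m ℂ} :
    HasAsymptoticExpansion Γ F a ↔ ∀ c : ℝ, 0 < c → ∀ k K : ℕ, ∀ i j,
      ExpansionUpTo (awayFilter Γ c k) K (fun z => F z i j) (fun l => a l i j) := Iff.rfl

theorem HasAsymptoticExpansion.congr {F G : ℂ → Matrix m m ℂ} {a b : ℕ → Matrix m m ℂ}
    (h : HasAsymptoticExpansion Γ F a) (hFG : ∀ z ∉ Γ, z ≠ 0 → F z = G z) (hab : ∀ l, a l = b l) :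
    HasAsymptoticExpansion Γ G b := by
  rw [hasAsymptoticExpansion_iff] at h ⊢
  intro c hc k K i j
  exact (h c hc k K i j).congr ((eventually_awayFilter hc k).mono fun z hz => by
    rw [hFG z hz.1 hz.2.1]) fun l => by rw [hab]

theorem HasAsymptoticExpansion.add {F G : ℂ → Matrix m m ℂ} {a b : ℕ → Matrix m m ℂ}
    (hF : HasAsymptoticExpansion Γ F a) (hG : HasAsymptoticExpansion Γ G b) :
    HasAsymptoticExpansion Γ (fun z => F z + G z) (fun l => a l + b l) := by
  rw [hasAsymptoticExpansion_iff] at *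
  exact fun c hc k K i j => (hF c hc k K i j).add (hG c hc k K i j)

theorem HasAsymptoticExpansion.mul [Fintype m] {F G : ℂ → Matrix m m ℂ} {a b : ℕ → Matrix m m ℂ}
    (hF : HasAsymptoticExpansion Γ F a) (hG : HasAsymptoticExpansion Γ G b) :
    HasAsymptoticExpansion Γ (fun z => F z * G z)
      (fun l => ∑ p ∈ Finset.HasAntidiagonal.antidiagonal l, a p.1 * b p.2) := by
  rw [hasAsymptoticExpansion_iff] at *
  intro c hc k K i j
  refine (ExpansionUpTo.sum Finset.univ fun s _ => ExpansionUpTo.mul (awayFilter_le Γ c k) K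
    (fun K => hF c hc k K i s) (fun K => hG c hc k K s j)).congr
    (Eventually.of_forall fun z => ?_) fun l => ?_
  · rw [Matrix.mul_apply]
  · rw [Finset.sum_comm, Matrix.sum_apply]
    simp only [Matrix.mul_apply]

theorem HasAsymptoticExpansion.const [DecidableEq m] (x : Matrix m m ℂ) :
    HasAsymptoticExpansion Γ (fun _ => x) (fun l => if l = 0 then x else 0) := by
  rw [hasAsymptoticExpansion_iff]
  intro c hc k K i j
  have hl := awayFilter_le Γ c k
  have h0 : ∀ a : ℂ, ExpansionUpTo (awayFilter Γ c k) 0 (fun _ => a)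
      (fun l => if l = 0 then a else 0) := fun a => by
    simp only [ExpansionUpTo, Finset.range_zero, Finset.sum_empty, sub_zero, pow_zero, inv_one]
    exact isBigO_const_const a one_ne_zero _
  have : ExpansionUpTo (awayFilter Γ c k) K (fun _ => x i j)
      (fun l => if l = 0 then x i j else 0) := by
    rcases K with _ | K
    · exact h0 _
    · rw [expansionUpTo_succ_iff hl]
      exact (ExpansionUpTo.zero K).congr (Eventually.of_forall fun z => by simp) (fun l => by simp)
  refine this.congr (Eventually.of_forall fun z => rfl) fun l => ?_
  split_ifs <;> simp

theorem hasAsymptoticExpansion_inv_smul_iff {F : ℂ → Matrix m m ℂ} {a b : ℕ → Matrix m m ℂ}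
    (h0 : b 0 = 0) (hb : ∀ l, b (l + 1) = a l) :
    HasAsymptoticExpansion Γ (fun z => z⁻¹ • F z) b ↔ HasAsymptoticExpansion Γ F a := by
  rw [hasAsymptoticExpansion_iff, hasAsymptoticExpansion_iff]
  have key : ∀ c : ℝ, 0 < c → ∀ k K : ℕ, ∀ i j,
      ExpansionUpTo (awayFilter Γ c k) (K + 1) (fun z => (z⁻¹ • F z) i j) (fun l => b l i j) ↔
        ExpansionUpTo (awayFilter Γ c k) K (fun z => F z i j) (fun l => a l i j) := by
    intro c hc k K i j
    have hl := awayFilter_le Γ c k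
    have he : ∀ᶠ z in awayFilter Γ c k, z * ((z⁻¹ • F z) i j - b 0 i j) = F z i j :=
      (eventually_ne_zero_of_le_cobounded hl).mono fun z hz => by
        rw [h0, Matrix.zero_apply, sub_zero, Matrix.smul_apply, smul_eq_mul,
          mul_inv_cancel_left₀ hz]
    rw [expansionUpTo_succ_iff hl]
    exact ⟨fun h => h.congr he fun l => by rw [hb],
      fun h => h.congr (he.mono fun z hz => hz.symm) fun l => by rw [hb]⟩
  refine ⟨fun h c hc k K i j => (key c hc k K i j).1 (h c hc k (K + 1) i j),
    fun h c hc k K i j => ?_⟩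
  rcases K with _ | K
  -- Order 0 is not reached by the shift; it follows from order 1, since O(|z|⁻¹) implies O(1).
  · have h1 := (key c hc k 0 i j).2 (h c hc k 0 i j)
    have hl := awayFilter_le Γ c k
    simp only [ExpansionUpTo, zero_add, Finset.sum_range_one, pow_one, h0, Matrix.zero_apply,
      zero_mul, sub_zero, Finset.range_zero, Finset.sum_empty] at h1 ⊢
    exact h1.trans (by simpa using isBigO_inv_norm_pow hl zero_le_one)
  · exact (key c hc k K i j).2 (h c hc k K i j)

/-! #### Expansions with finitely many positive powers -/

variable [Fintype m] [DecidableEq m]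

/-- `F` has, away from `Γ`, the asymptotic expansion `f`, a Laurent series in `z⁻¹`. -/
def HasLaurentExpansion (Γ : Set ℂ) (F : ℂ → Matrix m m ℂ) (f : LaurentSeries (Matrix m m ℂ)) :
    Prop :=
  ∃ (p : ℕ) (a : PowerSeries (Matrix m m ℂ)),
    f = HahnSeries.single (-(p : ℤ)) 1 * HahnSeries.ofPowerSeries ℤ _ a ∧
      HasAsymptoticExpansion Γ (fun z => (z ^ p)⁻¹ • F z) fun l => PowerSeries.coeff l a

/-- It makes the exponent `p` in `HasLaurentExpansion` immaterial: it can be raised to a common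
value for sums, and removed when the series has no positive power of z. -/
theorem hasAsymptoticExpansion_inv_pow_smul_iff {F : ℂ → Matrix m m ℂ}
    (a : PowerSeries (Matrix m m ℂ)) (q : ℕ) :
    HasAsymptoticExpansion Γ (fun z => (z ^ q)⁻¹ • F z)
      (fun l => PowerSeries.coeff l (PowerSeries.X ^ q * a)) ↔
      HasAsymptoticExpansion Γ F fun l => PowerSeries.coeff l a := by
  induction q with
  | zero => simp
  | succ q ih =>
    rw [← ih, ← hasAsymptoticExpansion_inv_smul_iff (F := fun z => (z ^ q)⁻¹ • F z)
      (b := fun l => PowerSeries.coeff l (PowerSeries.X ^ (q + 1) * a))]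
    · simp only [smul_smul, pow_succ, mul_inv, mul_comm]
    · rw [pow_succ', mul_assoc, PowerSeries.coeff_zero_X_mul]
    · intro l
      rw [pow_succ', mul_assoc, PowerSeries.coeff_succ_X_mul]

theorem single_neg_mul_X_pow (q : ℕ) (a : PowerSeries (Matrix m m ℂ)) :
    HahnSeries.single (-(q : ℤ)) (1 : Matrix m m ℂ) *
      HahnSeries.ofPowerSeries ℤ _ (PowerSeries.X ^ q * a) = HahnSeries.ofPowerSeries ℤ _ a := by
  rw [map_mul, HahnSeries.ofPowerSeries_X_pow, ← mul_assoc, HahnSeries.single_mul_single]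
  simp

theorem HasLaurentExpansion.mul {F G : ℂ → Matrix m m ℂ} {f g : LaurentSeries (Matrix m m ℂ)}
    (hF : HasLaurentExpansion Γ F f) (hG : HasLaurentExpansion Γ G g) :
    HasLaurentExpansion Γ (fun z => F z * G z) (f * g) := by
  obtain ⟨p, a, rfl, ha⟩ := hF
  obtain ⟨q, b, rfl, hb⟩ := hG
  refine ⟨p + q, a * b, ?_, (ha.mul hb).congr (fun z _ _ => ?_) fun l => ?_⟩
  · rw [mul_assoc, ← mul_assoc (HahnSeries.ofPowerSeries ℤ _ a), ← single_mul_comm, mul_assoc,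
      ← mul_assoc, HahnSeries.single_mul_single, one_mul, map_mul]
    push_cast
    rw [neg_add]
  · rw [smul_mul_smul_comm, ← mul_inv, pow_add]
  · rw [PowerSeries.coeff_mul]

theorem HasLaurentExpansion.add {F G : ℂ → Matrix m m ℂ} {f g : LaurentSeries (Matrix m m ℂ)}
    (hF : HasLaurentExpansion Γ F f) (hG : HasLaurentExpansion Γ G g) :
    HasLaurentExpansion Γ (fun z => F z + G z) (f + g) := by
  obtain ⟨p, a, rfl, ha⟩ := hF
  obtain ⟨q, b, rfl, hb⟩ := hG
  refine ⟨p + q, PowerSeries.X ^ q * a + PowerSeries.X ^ p * b, ?_,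
    (((hasAsymptoticExpansion_inv_pow_smul_iff a q).2 ha).add
      ((hasAsymptoticExpansion_inv_pow_smul_iff b p).2 hb)).congr (fun z _ _ => ?_) fun l => ?_⟩
  · have h1 : (HahnSeries.single (-((p + q : ℕ) : ℤ)) (1 : Matrix m m ℂ)) =
        HahnSeries.single (-(p : ℤ)) 1 * HahnSeries.single (-(q : ℤ)) 1 := by
      rw [HahnSeries.single_mul_single, one_mul]; push_cast; rw [neg_add]
    have h2 : (HahnSeries.single (-((p + q : ℕ) : ℤ)) (1 : Matrix m m ℂ)) =
        HahnSeries.single (-(q : ℤ)) 1 * HahnSeries.single (-(p : ℤ)) 1 := by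
      rw [HahnSeries.single_mul_single, one_mul]; push_cast; rw [neg_add_rev]
    rw [map_add, mul_add]
    nth_rewrite 1 [h1]
    rw [h2, mul_assoc, mul_assoc, single_neg_mul_X_pow, single_neg_mul_X_pow]
  · rw [smul_smul, smul_smul, smul_add, pow_add, mul_inv, mul_comm]
  · rw [map_add]

theorem HasAsymptoticExpansion.hasLaurentExpansion {F : ℂ → Matrix m m ℂ}
    {a : PowerSeries (Matrix m m ℂ)}
    (h : HasAsymptoticExpansion Γ F fun l => PowerSeries.coeff l a) :
    HasLaurentExpansion Γ F (HahnSeries.ofPowerSeries ℤ _ a) := by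
  refine ⟨0, a, ?_, by simpa using h⟩
  simp

theorem HasLaurentExpansion.congr {F G : ℂ → Matrix m m ℂ} {f : LaurentSeries (Matrix m m ℂ)}
    (h : HasLaurentExpansion Γ F f) (hFG : ∀ z ∉ Γ, z ≠ 0 → F z = G z) :
    HasLaurentExpansion Γ G f := by
  obtain ⟨p, a, hf, ha⟩ := h
  exact ⟨p, a, hf, ha.congr (fun z hz h0 => by rw [hFG z hz h0]) fun l => rfl⟩

theorem HasLaurentExpansion.hasAsymptoticExpansion {F : ℂ → Matrix m m ℂ}
    {a : PowerSeries (Matrix m m ℂ)}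
    (h : HasLaurentExpansion Γ F (HahnSeries.ofPowerSeries ℤ _ a)) :
    HasAsymptoticExpansion Γ F fun l => PowerSeries.coeff l a := by
  obtain ⟨p, b, hf, hb⟩ := h
  have : b = PowerSeries.X ^ p * a := by
    refine HahnSeries.ofPowerSeries_injective (Γ := ℤ) ?_
    rw [map_mul, hf, HahnSeries.ofPowerSeries_X_pow, ← mul_assoc, HahnSeries.single_mul_single]
    simp
  rw [this] at hb
  exact (hasAsymptoticExpansion_inv_pow_smul_iff a p).1 hb

theorem hasLaurentExpansion_const (x : Matrix m m ℂ) :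
    HasLaurentExpansion Γ (fun _ => x) (HahnSeries.C x) := by
  rw [← HahnSeries.ofPowerSeries_C]
  refine HasAsymptoticExpansion.hasLaurentExpansion
    ((HasAsymptoticExpansion.const x).congr (fun _ _ _ => rfl) fun l => ?_)
  rw [PowerSeries.coeff_C]

theorem hasLaurentExpansion_pow_smul (p : ℕ) (x : Matrix m m ℂ) :
    HasLaurentExpansion Γ (fun z => z ^ p • x) (HahnSeries.single (-(p : ℤ)) x) := by
  refine ⟨p, PowerSeries.C x, ?_, (HasAsymptoticExpansion.const x).congr (fun z _ hz => ?_)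
    fun l => ?_⟩
  · rw [HahnSeries.ofPowerSeries_C, HahnSeries.C_apply, HahnSeries.single_mul_single]; simp
  · rw [smul_smul, inv_mul_cancel₀ (pow_ne_zero p hz), one_smul]
  · rw [PowerSeries.coeff_C]

theorem hasLaurentExpansion_inv_pow_smul (p : ℕ) (x : Matrix m m ℂ) :
    HasLaurentExpansion Γ (fun z => (z ^ p)⁻¹ • x) (HahnSeries.single (p : ℤ) x) := by
  have h : (HahnSeries.single (p : ℤ) x : LaurentSeries (Matrix m m ℂ)) =
      HahnSeries.ofPowerSeries ℤ _ (PowerSeries.X ^ p * PowerSeries.C x) := by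
    rw [map_mul, HahnSeries.ofPowerSeries_X_pow, HahnSeries.ofPowerSeries_C, HahnSeries.C_apply,
      HahnSeries.single_mul_single]
    simp
  rw [h]
  refine HasAsymptoticExpansion.hasLaurentExpansion
    ((hasAsymptoticExpansion_inv_pow_smul_iff _ p).2 ?_)
  exact (HasAsymptoticExpansion.const x).congr (fun _ _ _ => rfl) fun l => by
    rw [PowerSeries.coeff_C]

theorem hasLaurentExpansion_matEval (P : (Matrix m m ℂ)[X]) :
    HasLaurentExpansion Γ (matEval P) (polyToLaurent P) := by
  induction P using Polynomial.induction_on' with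
  | add p q hp hq =>
    rw [map_add]
    exact (hp.add hq).congr fun z _ _ => (matEval_add p q z).symm
  | monomial n a =>
    rw [polyToLaurent_monomial]
    exact (hasLaurentExpansion_pow_smul n a).congr fun z _ _ => (matEval_monomial n a z).symm

end Asymptotics

/-! ### Cauchy transforms -/

section Cauchy

open MeasureTheory

/-- The measure is arbitrary so that the result also applies to the part of the curve outside a
ball, where z₀ may lie on the curve itself. On the ball of radius ε/2 about z₀ the kernel stays
bounded, which gives the dominating function. -/
theorem hasDerivAt_cauchyTransform {ν : Measure ℝ} {γ : ℝ → ℂ} (hγ : Continuous γ) {φ : ℝ → ℂ}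
    (hφ : Integrable φ ν) {z₀ : ℂ} {ε : ℝ} (hε : 0 < ε) (h : ∀ᵐ t ∂ν, ε ≤ ‖γ t - z₀‖) :
    HasDerivAt (fun z => ∫ t, (γ t - z)⁻¹ * φ t ∂ν) (∫ t, ((γ t - z₀) ^ 2)⁻¹ * φ t ∂ν) z₀ := by
  have hball : ∀ t, ε ≤ ‖γ t - z₀‖ → ∀ z ∈ Metric.ball z₀ (ε / 2), ε / 2 ≤ ‖γ t - z‖ := by
    intro t ht z hz
    rw [mem_ball_iff_norm] at hz
    have := norm_sub_norm_le (γ t - z₀) (z - z₀)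
    rw [sub_sub_sub_cancel_right] at this
    linarith
  have hm : ∀ z, AEStronglyMeasurable (fun t => (γ t - z)⁻¹ * φ t) ν := fun z =>
    ((hγ.measurable.sub_const z).inv.aestronglyMeasurable).mul hφ.aestronglyMeasurable
  have hint : Integrable (fun t => (γ t - z₀)⁻¹ * φ t) ν := by
    refine hφ.bdd_mul (c := ε⁻¹) (hγ.measurable.sub_const z₀).inv.aestronglyMeasurable ?_
    filter_upwards [h] with t ht
    rw [norm_inv]
    exact inv_anti₀ hε ht
  refine (hasDerivAt_integral_of_dominated_loc_of_deriv_le (𝕜 := ℂ)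
    (F := fun z t => (γ t - z)⁻¹ * φ t) (F' := fun z t => ((γ t - z) ^ 2)⁻¹ * φ t)
    (bound := fun t => ((ε / 2) ^ 2)⁻¹ * ‖φ t‖)
    (Metric.ball_mem_nhds z₀ (half_pos hε)) (Eventually.of_forall hm) hint ?_ ?_ ?_ ?_).2
  · exact (((hγ.measurable.sub_const z₀).pow_const 2).inv.aestronglyMeasurable).mul
      hφ.aestronglyMeasurable
  · filter_upwards [h] with t ht z hz
    rw [norm_mul, norm_inv, norm_pow]
    have := hball t ht z hz
    gcongr
  · exact hφ.norm.const_mul _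
  · filter_upwards [h] with t ht z hz
    have h0 : γ t - z ≠ 0 := norm_pos_iff.1 ((half_pos hε).trans_le (hball t ht z hz))
    refine ((((hasDerivAt_id z).const_sub (γ t)).fun_inv h0).mul_const (φ t)).congr_deriv ?_
    simp

variable {γ : ℝ → ℂ}

theorem IsSmoothLine.hasDerivAt_cauchyTransform (hγ : IsSmoothLine γ) {φ : ℝ → ℂ}
    (hφ : Integrable φ) {z : ℂ} (hz : z ∉ Set.range γ) :
    HasDerivAt (fun z => ∫ t, (γ t - z)⁻¹ * φ t) (∫ t, ((γ t - z) ^ 2)⁻¹ * φ t) z :=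
  _root_.hasDerivAt_cauchyTransform hγ.continuous hφ (hγ.infDist_pos hz)
    (Eventually.of_forall fun t => infDist_le_norm_sub γ z t)

theorem IsSmoothLine.norm_cauchyTransform_le (hγ : IsSmoothLine γ) {φ : ℝ → ℂ} (hφ : Integrable φ)
    {z : ℂ} (hz : z ∉ Set.range γ) (j : ℕ) :
    ‖∫ t, ((γ t - z) ^ j)⁻¹ * φ t‖ ≤
      ((Metric.infDist z (Set.range γ)) ^ j)⁻¹ * ∫ t, ‖φ t‖ := by
  rw [← integral_const_mul]
  refine norm_integral_le_of_norm_le (hφ.norm.const_mul _) (Eventually.of_forall fun t => ?_)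
  rw [norm_mul, norm_inv, norm_pow]
  have h1 := hγ.infDist_pos hz
  have h2 := infDist_le_norm_sub γ z t
  gcongr

/-- In the region dist(z, γ) ≥ c|z|⁻ᵏ each factor (w - z)⁻¹ costs at most |z|ᵏ/c. -/
theorem IsSmoothLine.isBigO_cauchyTransform (hγ : IsSmoothLine γ) {φ : ℝ → ℂ} (hφ : Integrable φ)
    {c : ℝ} (hc : 0 < c) (k j : ℕ) :
    (fun z => ∫ t, ((γ t - z) ^ j)⁻¹ * φ t) =O[awayFilter (Set.range γ) c k]
      fun z => ‖z‖ ^ (k * j) := by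
  refine IsBigO.of_bound ((c ^ j)⁻¹ * ∫ t, ‖φ t‖) ?_
  filter_upwards [eventually_awayFilter hc k] with z hz
  refine (hγ.norm_cauchyTransform_le hφ hz.1 j).trans ?_
  have h1 := hγ.infDist_pos hz.1
  have h2 : ((Metric.infDist z (Set.range γ)) ^ j)⁻¹ ≤ (c ^ j)⁻¹ * ‖z‖ ^ (k * j) := by
    rw [inv_le_iff_one_le_mul₀ (by positivity), mul_assoc, pow_mul, ← mul_pow,
      ← inv_pow, ← mul_pow]
    refine one_le_pow₀ ?_
    rw [← div_eq_inv_mul, one_le_div hc]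
    exact hz.2.2
  rw [Real.norm_of_nonneg (by positivity)]
  calc _ ≤ ((c ^ j)⁻¹ * ‖z‖ ^ (k * j)) * ∫ t, ‖φ t‖ :=
        mul_le_mul_of_nonneg_right h2 (integral_nonneg fun t => norm_nonneg _)
    _ = _ := by ring

/-- The finite geometric expansion of 1/(w - z) in powers of w/z, with its exact remainder. -/
theorem IsSmoothLine.cauchyTransform_remainder (hγ : IsSmoothLine γ) {φ : ℝ → ℂ}
    (hφ : ∀ k : ℕ, Integrable fun t => γ t ^ k * φ t) {z : ℂ} (hz : z ∉ Set.range γ) (h0 : z ≠ 0)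
    (K : ℕ) : ∫ t, (γ t - z)⁻¹ * φ t = (z ^ K)⁻¹ * (∫ t, (γ t - z)⁻¹ * (γ t ^ K * φ t)) -
      ∑ i ∈ Finset.range K, (∫ t, γ t ^ i * φ t) * (z ^ (i + 1))⁻¹ := by
  induction K with
  | zero => simp
  | succ K ih =>
    have h1 : ∫ t, (γ t - z)⁻¹ * (γ t ^ (K + 1) * φ t) =
        z * (∫ t, (γ t - z)⁻¹ * (γ t ^ K * φ t)) + ∫ t, γ t ^ K * φ t := by
      rw [← integral_const_mul, ← integral_add ((hγ.integrable_inv_mul hz (hφ K)).const_mul z)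
        (hφ K)]
      congr 1
      ext t
      have := sub_ne_zero_of_notMem hz t
      field_simp
      ring
    rw [ih, Finset.sum_range_succ, h1, pow_succ]
    field_simp
    ring

theorem IsSmoothLine.expansionUpTo_cauchyTransform (hγ : IsSmoothLine γ) {φ : ℝ → ℂ}
    (hφ : ∀ k : ℕ, Integrable fun t => γ t ^ k * φ t) {a : ℕ → ℂ} (ha0 : a 0 = 0)
    (ha : ∀ l, a (l + 1) = -∫ t, γ t ^ l * φ t) {c : ℝ} (hc : 0 < c) (k K : ℕ) :
    ExpansionUpTo (awayFilter (Set.range γ) c k) K (fun z => ∫ t, (γ t - z)⁻¹ * φ t) a := by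
  have hl := awayFilter_le (Set.range γ) c k
  -- The distance to the curve costs k powers of z; the extra 1 counts the vanishing coefficient of
  -- z⁰.
  refine expansionUpTo_of_weak (m := k + 1) hl (fun K => ?_) K
  have h1 := hγ.isBigO_cauchyTransform (hφ (K + k)) hc k 1
  simp only [pow_one, mul_one] at h1
  have h2 : (fun z : ℂ => (z ^ (K + k))⁻¹) =O[awayFilter (Set.range γ) c k]
      fun z => (‖z‖ ^ (K + k))⁻¹ := by
    refine IsBigO.of_norm_left ?_
    simp only [norm_inv, norm_pow]
    exact isBigO_refl _ _
  refine (h2.mul h1).congr' ?_ ?_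
  · filter_upwards [eventually_awayFilter hc k] with z hz
    rw [hγ.cauchyTransform_remainder hφ hz.1 hz.2.1 (K + k), ← add_assoc, Finset.sum_range_succ',
      ha0]
    simp only [ha, neg_mul, Finset.sum_neg_distrib]
    ring
  · filter_upwards [eventually_awayFilter hc k] with z hz
    have : ‖z‖ ≠ 0 := norm_ne_zero_iff.2 hz.2.1
    rw [pow_add]
    field_simp

/-- Asymptotic expansions cannot be differentiated termwise in general. Here the remainder is
explicit and the identity holds on a neighbourhood of z, so both sides can be differentiated
exactly. -/
theorem IsSmoothLine.deriv_cauchyTransform_remainder (hγ : IsSmoothLine γ) {φ : ℝ → ℂ}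
    (hφ : ∀ k : ℕ, Integrable fun t => γ t ^ k * φ t) {z : ℂ} (hz : z ∉ Set.range γ) (h0 : z ≠ 0)
    (K : ℕ) : ∫ t, ((γ t - z) ^ 2)⁻¹ * φ t =
      (z ^ K)⁻¹ * (∫ t, ((γ t - z) ^ 2)⁻¹ * (γ t ^ K * φ t)) -
        K * (z ^ (K + 1))⁻¹ * (∫ t, (γ t - z)⁻¹ * (γ t ^ K * φ t)) +
      ∑ i ∈ Finset.range K, (i + 1) * (∫ t, γ t ^ i * φ t) * (z ^ (i + 2))⁻¹ := by
  have hφ0 : Integrable φ := by simpa using hφ 0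
  have hinv : ∀ n : ℕ, HasDerivAt (fun z : ℂ => (z ^ n)⁻¹) (-(n * (z ^ (n + 1))⁻¹)) z := by
    intro n
    refine ((hasDerivAt_pow n z).fun_inv (pow_ne_zero n h0)).congr_deriv ?_
    rcases n with _ | n
    · simp
    · rw [Nat.add_sub_cancel]
      field_simp
      ring
  have h1 := hγ.hasDerivAt_cauchyTransform hφ0 hz
  have h2 := ((hinv K).mul (hγ.hasDerivAt_cauchyTransform (hφ K) hz)).sub
    (HasDerivAt.fun_sum (u := Finset.range K) fun i _ =>
      (hinv (i + 1)).const_mul (∫ t, γ t ^ i * φ t))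
  have h3 : (fun z => ∫ t, (γ t - z)⁻¹ * φ t) =ᶠ[𝓝 z] fun z =>
      (z ^ K)⁻¹ * (∫ t, (γ t - z)⁻¹ * (γ t ^ K * φ t)) -
      ∑ i ∈ Finset.range K, (∫ t, γ t ^ i * φ t) * (z ^ (i + 1))⁻¹ := by
    filter_upwards [hγ.isClosed_range.isOpen_compl.mem_nhds hz, eventually_ne_nhds h0] with w hw hw0
    exact hγ.cauchyTransform_remainder hφ hw hw0 K
  rw [h1.unique (h2.congr_of_eventuallyEq h3), sub_eq_add_neg _ (∑ i ∈ Finset.range K, _),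
    ← Finset.sum_neg_distrib]
  congr 1
  · ring
  · refine Finset.sum_congr rfl fun i _ => ?_
    push_cast
    ring

theorem IsSmoothLine.expansionUpTo_deriv_cauchyTransform (hγ : IsSmoothLine γ) {φ : ℝ → ℂ}
    (hφ : ∀ k : ℕ, Integrable fun t => γ t ^ k * φ t) {a : ℕ → ℂ} (ha0 : a 0 = 0) (ha1 : a 1 = 0)
    (ha : ∀ l : ℕ, a (l + 2) = (l + 1) * ∫ t, γ t ^ l * φ t) {c : ℝ} (hc : 0 < c) (k K : ℕ) :
    ExpansionUpTo (awayFilter (Set.range γ) c k) K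
      (fun z => ∫ t, ((γ t - z) ^ 2)⁻¹ * φ t) a := by
  have hl := awayFilter_le (Set.range γ) c k
  -- The squared kernel costs 2k powers of z, and the first two coefficients vanish.
  refine expansionUpTo_of_weak (m := k * 2 + 2) hl (fun K => ?_) K
  set n := K + k * 2
  have h1 := hγ.isBigO_cauchyTransform (hφ n) hc k 2
  have h1' := hγ.isBigO_cauchyTransform (hφ n) hc k 1
  simp only [pow_one, mul_one] at h1'
  have h2 : ∀ n, (fun z : ℂ => (z ^ n)⁻¹) =O[awayFilter (Set.range γ) c k]
      fun z => (‖z‖ ^ n)⁻¹ := fun n => by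
    refine IsBigO.of_norm_left ?_
    simp only [norm_inv, norm_pow]
    exact isBigO_refl _ _
  have h3 : (fun z : ℂ => (z ^ n)⁻¹ * ∫ t, ((γ t - z) ^ 2)⁻¹ * (γ t ^ n * φ t))
      =O[awayFilter (Set.range γ) c k] fun z => (‖z‖ ^ K)⁻¹ := by
    refine ((h2 n).mul h1).congr' EventuallyEq.rfl ?_
    filter_upwards [eventually_awayFilter hc k] with z hz
    have : ‖z‖ ≠ 0 := norm_ne_zero_iff.2 hz.2.1
    simp only [n, pow_add]
    field_simp
  have h4 : (fun z : ℂ => (n : ℂ) * ((z ^ (n + 1))⁻¹ * ∫ t, (γ t - z)⁻¹ * (γ t ^ n * φ t)))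
      =O[awayFilter (Set.range γ) c k] fun z => (‖z‖ ^ K)⁻¹ := by
    refine IsBigO.const_mul_left ?_ _
    refine (((h2 (n + 1)).mul h1').congr' EventuallyEq.rfl ?_).trans
      (isBigO_inv_norm_pow hl (show K ≤ K + k + 1 by omega))
    filter_upwards [eventually_awayFilter hc k] with z hz
    have : ‖z‖ ≠ 0 := norm_ne_zero_iff.2 hz.2.1
    rw [show n + 1 = (K + k + 1) + k by omega, pow_add _ (K + k + 1) k]
    field_simp
  refine (h3.sub h4).congr' ?_ EventuallyEq.rfl
  filter_upwards [eventually_awayFilter hc k] with z hz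
  rw [hγ.deriv_cauchyTransform_remainder hφ hz.1 hz.2.1 n, ← add_assoc,
    Finset.sum_range_succ', Finset.sum_range_succ', ha0, ha1]
  simp only [ha]
  ring

end Cauchy

/-! ### Entire extension across the curve -/

section Extension

open MeasureTheory

/-- Cauchy's estimate turns the local bound on F into one on its z-derivative, so that
differentiation under the integral needs no hypothesis on derivatives. -/
theorem differentiable_integral_of_locally_bounded {α : Type*} [MeasurableSpace α] {ν : Measure α}
    [IsFiniteMeasure ν] {F : ℂ → α → ℂ} (hm : ∀ z, AEStronglyMeasurable (F z) ν)
    (hd : ∀ᵐ t ∂ν, Differentiable ℂ fun z => F z t)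
    (hb : ∀ R : ℝ, ∃ C : ℝ, ∀ᵐ t ∂ν, ∀ z ∈ Metric.ball (0 : ℂ) R, ‖F z t‖ ≤ C) :
    Differentiable ℂ fun z => ∫ t, F z t ∂ν := by
  intro z₀
  obtain ⟨C, hC⟩ := hb (‖z₀‖ + 3)
  have hsub : ∀ z ∈ Metric.ball z₀ 1, ∀ w ∈ Metric.closedBall z 1,
      w ∈ Metric.ball (0 : ℂ) (‖z₀‖ + 3) := by
    intro z hz w hw
    rw [mem_ball_iff_norm] at hz
    rw [mem_closedBall_iff_norm] at hw
    rw [mem_ball_zero_iff]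
    have h1 : w = (w - z) + (z - z₀) + z₀ := by ring
    have h2 := norm_add₃_le (a := w - z) (b := z - z₀) (c := z₀)
    rw [← h1] at h2
    linarith
  -- The derivative is measurable in t as a pointwise limit of difference quotients with increments
  -- 1/(n + 1).
  have hF' : AEStronglyMeasurable (fun t => deriv (fun z => F z t) z₀) ν := by
    refine aestronglyMeasurable_of_tendsto_ae (atTop : Filter ℕ)
      (f := fun n t => ((1 : ℂ) / (n + 1))⁻¹ • (F (z₀ + 1 / (n + 1)) t - F z₀ t))
      (fun n => ?_) ?_
    · have := ((hm (z₀ + 1 / (n + 1))).sub (hm z₀)).const_smul ((1 : ℂ) / (n + 1))⁻¹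
      exact this
    filter_upwards [hd] with t ht
    refine ((ht z₀).hasDerivAt.tendsto_slope_zero).comp (f := fun n : ℕ => (1 : ℂ) / (n + 1)) ?_
    refine tendsto_nhdsWithin_iff.2 ⟨tendsto_one_div_add_atTop_nhds_zero_nat, ?_⟩
    exact Eventually.of_forall fun n => one_div_ne_zero (Nat.cast_add_one_ne_zero n)
  refine (hasDerivAt_integral_of_dominated_loc_of_deriv_le (𝕜 := ℂ) (F := F)
    (F' := fun z t => deriv (fun z => F z t) z) (bound := fun _ => C)
    (Metric.ball_mem_nhds z₀ one_pos) (Eventually.of_forall hm) ?_ hF' ?_ (integrable_const C)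
    ?_).2.differentiableAt
  · refine Integrable.of_bound (hm z₀) C ?_
    filter_upwards [hC] with t ht
    exact ht z₀ (hsub z₀ (Metric.mem_ball_self one_pos) z₀ (Metric.mem_closedBall_self zero_le_one))
  · filter_upwards [hC, hd] with t ht htd z hz
    have := Complex.norm_deriv_le_of_forall_mem_sphere_norm_le (f := fun z => F z t) (c := z)
      one_pos htd.diffContOnCl fun w hw => ht w (hsub z hz w (Metric.sphere_subset_closedBall hw))
    rwa [div_one] at this
  · filter_upwards [hd] with t htd z _
    exact (htd z).hasDerivAt

/-- The quotient `f(z) / (z - w)²`, with the singularity removed. -/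
def doubleSlope (f : ℂ → ℂ) (w : ℂ) : ℂ → ℂ := dslope (dslope f w) w

theorem doubleSlope_of_ne {f : ℂ → ℂ} {w : ℂ} (h0 : f w = 0) (h1 : deriv f w = 0) {z : ℂ}
    (hz : z ≠ w) : doubleSlope f w z = ((w - z) ^ 2)⁻¹ * f z := by
  rw [doubleSlope, dslope_of_ne _ hz, slope_def_field, dslope_of_ne _ hz, dslope_same, h1,
    slope_def_field, h0]
  have h2 : z - w ≠ 0 := sub_ne_zero.2 hz
  have h3 : w - z ≠ 0 := sub_ne_zero.2 hz.symm
  rw [show (w - z) ^ 2 = (z - w) ^ 2 by ring]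
  field_simp
  ring

theorem differentiable_doubleSlope {f : ℂ → ℂ} (hf : Differentiable ℂ f) (w : ℂ) :
    Differentiable ℂ (doubleSlope f w) := by
  rw [← differentiableOn_univ] at *
  exact (Complex.differentiableOn_dslope univ_mem).2
    ((Complex.differentiableOn_dslope univ_mem).2 hf)

/-- At distance at least 1 from w the quotient is bounded by |f|; the unit disc about w is handled
by the maximum principle, its boundary circle lying in |z| ≤ R because |w| + 1 ≤ R. -/
theorem norm_doubleSlope_le {f : ℂ → ℂ} (hf : Differentiable ℂ f) {w : ℂ} (h0 : f w = 0)
    (h1 : deriv f w = 0) {R C : ℝ} (hR : ‖w‖ + 1 ≤ R) (hC : ∀ z, ‖z‖ ≤ R → ‖f z‖ ≤ C) {z : ℂ}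
    (hz : ‖z‖ ≤ R) : ‖doubleSlope f w z‖ ≤ C := by
  have key : ∀ z, ‖z‖ ≤ R → 1 ≤ ‖z - w‖ → ‖doubleSlope f w z‖ ≤ C := by
    intro z hz hzw
    have hne : z ≠ w := by
      rintro rfl
      rw [sub_self, norm_zero] at hzw
      exact absurd hzw (by norm_num)
    rw [doubleSlope_of_ne h0 h1 hne, norm_mul, norm_inv, norm_pow, norm_sub_rev]
    calc _ ≤ 1 * ‖f z‖ := by
          refine mul_le_mul_of_nonneg_right ?_ (norm_nonneg _)
          exact inv_le_one_of_one_le₀ (one_le_pow₀ hzw)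
      _ ≤ C := by rw [one_mul]; exact hC z hz
  rcases le_or_gt 1 ‖z - w‖ with h | h
  · exact key z hz h
  · refine Complex.norm_le_of_forall_mem_frontier_norm_le (U := Metric.ball w 1)
      Metric.isBounded_ball (differentiable_doubleSlope hf w).diffContOnCl (fun ζ hζ => ?_)
      (subset_closure (mem_ball_iff_norm.2 h))
    rw [frontier_ball w one_ne_zero, mem_sphere_iff_norm] at hζ
    refine key ζ ?_ hζ.ge
    have := norm_sub_norm_le ζ w
    linarith

variable {γ : ℝ → ℂ}

theorem differentiable_integral_doubleSlope (hγ : Continuous γ) (hinj : Function.Injective γ)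
    {H : ℂ → ℂ → ℂ} (hc : Continuous (Function.uncurry H)) (hd : ∀ w, Differentiable ℂ (H w))
    (h0 : ∀ w, H w w = 0) (h1 : ∀ w, deriv (H w) w = 0) {g : ℝ → ℂ} (hg : Continuous g) (T : ℝ) :
    Differentiable ℂ fun z => ∫ t in Set.Icc (-T) T, doubleSlope (H (γ t)) (γ t) z * g t := by
  have hK : IsCompact (γ '' Set.Icc (-T) T) := isCompact_Icc.image hγ
  obtain ⟨R₀, hR₀⟩ := hK.isBounded.exists_norm_le
  obtain ⟨G, hG⟩ := (isCompact_Icc.image hg : IsCompact (g '' Set.Icc (-T) T)).isBounded.exists_norm_le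
  refine differentiable_integral_of_locally_bounded (fun z => ?_) (Eventually.of_forall fun t => ?_)
    fun R => ?_
  · have hmeas : Measurable fun t => ((γ t - z) ^ 2)⁻¹ * H (γ t) z :=
      ((hγ.measurable.sub_const z).pow_const 2).inv.mul
        (hc.comp (hγ.prodMk continuous_const)).measurable
    -- The explicit quotient fails only where γ t = z, which by injectivity is at most one
    -- parameter.
    refine AEStronglyMeasurable.mul (hmeas.aestronglyMeasurable.congr ?_) hg.aestronglyMeasurable
    refine ae_restrict_of_ae ?_
    have : ∀ᵐ t : ℝ, t ∉ γ ⁻¹' {z} :=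
      measure_eq_zero_iff_ae_notMem.1 (((Set.subsingleton_singleton.preimage hinj)).measure_zero _)
    filter_upwards [this] with t ht
    exact (doubleSlope_of_ne (h0 _) (h1 _) fun h => ht h.symm).symm
  · exact (differentiable_doubleSlope (hd _) _).mul_const _
  · set R' := max R (R₀ + 1)
    obtain ⟨C, hC⟩ := (((isCompact_closedBall (0 : ℂ) R').prod
      (isCompact_closedBall (0 : ℂ) R')).image hc).isBounded.exists_norm_le
    refine ⟨C * G, ?_⟩
    filter_upwards [ae_restrict_mem measurableSet_Icc] with t ht z hz
    rw [norm_mul]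
    have hw : ‖γ t‖ ≤ R₀ := hR₀ _ ⟨t, ht, rfl⟩
    rw [mem_ball_zero_iff] at hz
    have hR' : R₀ + 1 ≤ R' := le_max_right _ _
    have hz' : ‖z‖ ≤ R' := hz.le.trans (le_max_left _ _)
    have hC' : ∀ z, ‖z‖ ≤ R' → ‖H (γ t) z‖ ≤ C := fun z hz =>
      hC _ ⟨(γ t, z), ⟨by rw [mem_closedBall_zero_iff]; linarith,
        by rwa [mem_closedBall_zero_iff]⟩, rfl⟩
    have h2 := norm_doubleSlope_le (hd (γ t)) (h0 _) (h1 _) (by linarith) hC' hz'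
    exact mul_le_mul h2 (hG _ ⟨t, ht, rfl⟩) (norm_nonneg _) ((norm_nonneg _).trans h2)

theorem IsSmoothLine.dense_compl_range (hγ : IsSmoothLine γ) : Dense (Set.range γ)ᶜ :=
  hγ.contDiff.dense_compl_range_of_finrank_lt_finrank (by simp [Complex.finrank_real_complex])

theorem IsSmoothLine.hasDerivAt (hγ : IsSmoothLine γ) (t : ℝ) : HasDerivAt γ (deriv γ t) t :=
  ((hγ.contDiff.differentiable one_ne_zero) t).hasDerivAt

theorem IsSmoothLine.continuous_deriv (hγ : IsSmoothLine γ) : Continuous (deriv γ) :=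
  hγ.contDiff.continuous_deriv le_rfl

/-- A function defined off the curve that has a holomorphic extension to every ball extends to an
entire function. -/
theorem exists_entire_of_locally {S : Set ℂ} (hS : Dense S) {D : ℂ → ℂ}
    (h : ∀ R : ℝ, ∃ E : ℂ → ℂ, DifferentiableOn ℂ E (Metric.ball 0 R) ∧
      ∀ z ∈ Metric.ball (0 : ℂ) R, z ∈ S → E z = D z) :
    ∃ E : ℂ → ℂ, Differentiable ℂ E ∧ ∀ z ∈ S, E z = D z := by
  have key : ∀ R : ℝ, ∀ E : ℂ → ℂ, DifferentiableOn ℂ E (Metric.ball 0 R) →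
      (∀ z ∈ Metric.ball (0 : ℂ) R, z ∈ S → E z = D z) →
      -- By density and continuity each local extension must be the limit of `D` along `S`; hence
      -- the local extensions agree and glue.
      ∀ z ∈ Metric.ball (0 : ℂ) R, extendFrom S D z = E z := by
    intro R E hE hED z hz
    refine extendFrom_eq (hS z) ?_
    have hmem := Metric.isOpen_ball.mem_nhds hz
    have h1 : Tendsto E (𝓝[S] z) (𝓝 (E z)) :=
      ((hE.differentiableAt hmem).continuousAt.tendsto).mono_left nhdsWithin_le_nhds
    refine h1.congr' ?_
    filter_upwards [self_mem_nhdsWithin, mem_nhdsWithin_of_mem_nhds hmem] with w hw hwb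
    exact hED w hwb hw
  refine ⟨extendFrom S D, fun z => ?_, fun z hz => ?_⟩
  · obtain ⟨E, hE, hED⟩ := h (‖z‖ + 1)
    have hmem : Metric.ball (0 : ℂ) (‖z‖ + 1) ∈ 𝓝 z :=
      Metric.isOpen_ball.mem_nhds (by rw [mem_ball_zero_iff]; linarith)
    refine (hE.differentiableAt hmem).congr_of_eventuallyEq ?_
    filter_upwards [hmem] with w hw
    exact key _ E hE hED w hw
  · obtain ⟨E, hE, hED⟩ := h (‖z‖ + 1)
    have hz' : z ∈ Metric.ball (0 : ℂ) (‖z‖ + 1) := by rw [mem_ball_zero_iff]; linarith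
    rw [key _ E hE hED z hz', hED z hz' hz]

theorem IsSmoothLine.exists_norm_ge (hγ : IsSmoothLine γ) (R : ℝ) :
    ∃ T : ℝ, 0 ≤ T ∧ ∀ t, T ≤ |t| → R ≤ ‖γ t‖ := by
  have h1 : ∀ᶠ t in cocompact ℝ, R ≤ ‖γ t‖ :=
    (tendsto_norm_cocompact_atTop.comp hγ.proper).eventually_ge_atTop R
  rw [← Metric.cobounded_eq_cocompact, (hasBasis_cobounded_norm (E := ℝ)).eventually_iff] at h1
  obtain ⟨T, -, hT⟩ := h1
  exact ⟨max T 0, le_max_right _ _, fun t ht => hT ((le_max_left _ _).trans ht)⟩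

theorem IsSmoothLine.integral_inv_sq (hγ : IsSmoothLine γ) {z : ℂ} (hz : z ∉ Set.range γ) {T : ℝ}
    (hT : 0 ≤ T) : ∫ t in Set.Icc (-T) T, ((γ t - z) ^ 2)⁻¹ * deriv γ t =
      (γ (-T) - z)⁻¹ - (γ T - z)⁻¹ := by
  rw [integral_Icc_eq_integral_Ioc, ← intervalIntegral.integral_of_le (by linarith)]
  have h : ∀ t, HasDerivAt (fun t => -(γ t - z)⁻¹) (((γ t - z) ^ 2)⁻¹ * deriv γ t) t := by
    intro t
    refine (((hγ.hasDerivAt t).sub_const z).fun_inv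
      (sub_ne_zero_of_notMem hz t)).fun_neg.congr_deriv ?_
    rw [neg_div, neg_neg, div_eq_inv_mul]
  rw [intervalIntegral.integral_eq_sub_of_hasDerivAt (fun t _ => h t)]
  · ring
  · refine Continuous.intervalIntegrable ?_ _ _
    exact (((hγ.continuous.sub continuous_const).pow 2).inv₀
      fun t => pow_ne_zero 2 (sub_ne_zero_of_notMem hz t)).mul hγ.continuous_deriv

theorem IsSmoothLine.integrable_inv_sq_mul (hγ : IsSmoothLine γ) {z : ℂ} (hz : z ∉ Set.range γ)
    {φ : ℝ → ℂ} (hφ : Integrable φ) : Integrable fun t => ((γ t - z) ^ 2)⁻¹ * φ t := by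
  refine (hγ.integrable_inv_mul hz (hγ.integrable_inv_mul hz hφ)).congr
    (Eventually.of_forall fun t => ?_)
  simp only
  rw [← mul_assoc, ← mul_inv, sq]

/-- If `V' = ∑ c_s v_s` with entire functions, then `F' - ∑ c_s F_s` extends to an entire
function, for the Cauchy transforms `F` of `V` and `F_s` of `v_s`. -/
theorem IsSmoothLine.exists_entire_extension (hγ : IsSmoothLine γ) {ι : Type*} [Fintype ι]
    {V : ℂ → ℂ} {c v : ι → ℂ → ℂ} (hV : Differentiable ℂ V) (hc : ∀ s, Differentiable ℂ (c s))
    (hv : ∀ s, Differentiable ℂ (v s)) (hVd : ∀ z, deriv V z = ∑ s, c s z * v s z)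
    (hVi : Integrable fun t => V (γ t) * deriv γ t)
    (hvi : ∀ s, Integrable fun t => v s (γ t) * deriv γ t) :
    ∃ E : ℂ → ℂ, Differentiable ℂ E ∧ ∀ z ∈ (Set.range γ)ᶜ,
      E z = (∫ t, ((γ t - z) ^ 2)⁻¹ * (V (γ t) * deriv γ t)) -
        ∑ s, c s z * ∫ t, (γ t - z)⁻¹ * (v s (γ t) * deriv γ t) := by
  refine exists_entire_of_locally hγ.dense_compl_range fun R => ?_
  -- Beyond parameter T the curve stays at distance at least 1 from the ball of radius R, so the
  -- tails give functions holomorphic in that ball.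
  obtain ⟨T, hT0, hT⟩ := hγ.exists_norm_ge (R + 1)
  set I := Set.Icc (-T) T
  have hI : ∀ t ∈ Iᶜ, R + 1 ≤ ‖γ t‖ := fun t ht => hT t (by
    by_contra h
    exact ht (abs_le.1 (not_le.1 h).le))
  have hfar : ∀ z ∈ Metric.ball (0 : ℂ) R, ∀ᵐ t ∂volume.restrict Iᶜ, 1 ≤ ‖γ t - z‖ := by
    intro z hz
    filter_upwards [ae_restrict_mem measurableSet_Icc.compl] with t ht
    have h1 := hI t ht
    have h2 := norm_sub_norm_le (γ t) z
    rw [mem_ball_zero_iff] at hz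
    linarith
  have houter : ∀ {φ : ℝ → ℂ}, Integrable φ →
      DifferentiableOn ℂ (fun z => ∫ t in Iᶜ, (γ t - z)⁻¹ * φ t) (Metric.ball 0 R) ∧
      DifferentiableOn ℂ (fun z => ∫ t in Iᶜ, ((γ t - z) ^ 2)⁻¹ * φ t) (Metric.ball 0 R) := by
    intro φ hφ
    have h1 := fun z hz => _root_.hasDerivAt_cauchyTransform hγ.continuous
      (hφ.restrict (s := Iᶜ)) one_pos (hfar z hz)
    have h2 : DifferentiableOn ℂ (fun z => ∫ t in Iᶜ, (γ t - z)⁻¹ * φ t) (Metric.ball 0 R) :=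
      fun z hz => (h1 z hz).differentiableAt.differentiableWithinAt
    exact ⟨h2, (h2.deriv Metric.isOpen_ball).congr fun z hz => (h1 z hz).deriv.symm⟩
  -- Numerator of the integrand over (w - z)², with V(z) subtracted. It vanishes at z = w, and so
  -- does its z-derivative, by the differential equation for V; the double pole is therefore
  -- removable.
  let H : ℂ → ℂ → ℂ := fun w z => V w - (w - z) * ∑ s, c s z * v s w - V z
  have hHc : Continuous (Function.uncurry H) := by
    have hcs : ∀ s, Continuous (c s) := fun s => (hc s).continuous
    have hvs : ∀ s, Continuous (v s) := fun s => (hv s).continuous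
    have hVc := hV.continuous
    simp only [H, Function.uncurry_def]
    fun_prop
  have hHd : ∀ w, Differentiable ℂ (H w) := fun w => by
    simp only [H]
    fun_prop
  have hH0 : ∀ w, H w w = 0 := fun w => by simp [H]
  have hH1 : ∀ w, deriv (H w) w = 0 := fun w => by
    have h1 : DifferentiableAt ℂ (fun z => ∑ s, c s z * v s w) w := by fun_prop
    have h2 := ((((hasDerivAt_id w).const_sub w).mul h1.hasDerivAt).const_sub (V w)).sub
      (hV w).hasDerivAt
    refine h2.deriv.trans ?_
    simp [hVd]
  -- The three parts: the regularized integral over the compact arc, the subtracted V(z)/(w - z)²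
  -- integrated through its primitive to endpoint terms, and the tails.
  refine ⟨fun z => (∫ t in I, doubleSlope (H (γ t)) (γ t) z * deriv γ t) +
      V z * ((γ (-T) - z)⁻¹ - (γ T - z)⁻¹) +
      ((∫ t in Iᶜ, ((γ t - z) ^ 2)⁻¹ * (V (γ t) * deriv γ t)) -
        ∑ s, c s z * ∫ t in Iᶜ, (γ t - z)⁻¹ * (v s (γ t) * deriv γ t)), ?_, ?_⟩
  · have hend : ∀ t, T ≤ |t| →
        DifferentiableOn ℂ (fun z => (γ t - z)⁻¹) (Metric.ball 0 R) := by
      intro t ht z hz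
      have h0 : γ t - z ≠ 0 := by
        intro h
        rw [mem_ball_zero_iff, ← sub_eq_zero.1 h] at hz
        linarith [hT t ht]
      exact (((differentiableAt_id).const_sub (γ t)).inv h0).differentiableWithinAt
    refine DifferentiableOn.add (DifferentiableOn.add ?_ ?_) (DifferentiableOn.sub ?_ ?_)
    · exact (differentiable_integral_doubleSlope hγ.continuous hγ.injective hHc hHd hH0 hH1
        hγ.continuous_deriv T).differentiableOn
    · exact hV.differentiableOn.mul ((hend (-T) (by rw [abs_neg]; exact le_abs_self T)).sub
        (hend T (le_abs_self T)))
    · exact (houter hVi).2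
    · exact DifferentiableOn.fun_sum fun s _ => (hc s).differentiableOn.mul (houter (hvi s)).1
  · intro z hz hzγ
    have hV2 := hγ.integrable_inv_sq_mul hzγ hVi
    have hv1 := fun s => hγ.integrable_inv_mul hzγ (hvi s)
    rw [← integral_add_compl (measurableSet_Icc (a := -T) (b := T)) hV2]
    have hsum : ∑ s, c s z * ∫ t, (γ t - z)⁻¹ * (v s (γ t) * deriv γ t) =
        (∑ s, c s z * ∫ t in I, (γ t - z)⁻¹ * (v s (γ t) * deriv γ t)) +
        ∑ s, c s z * ∫ t in Iᶜ, (γ t - z)⁻¹ * (v s (γ t) * deriv γ t) := by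
      rw [← Finset.sum_add_distrib]
      refine Finset.sum_congr rfl fun s _ => ?_
      rw [← mul_add, integral_add_compl measurableSet_Icc (hv1 s)]
    rw [hsum, add_sub_add_comm]
    beta_reduce
    congr 1
    rw [← hγ.integral_inv_sq hzγ hT0, ← integral_const_mul]
    simp only [← integral_const_mul]
    rw [← integral_finsetSum _ fun s _ => ((hv1 s).const_mul (c s z)).restrict,
      ← integral_sub hV2.restrict
        (integrable_finsetSum _ fun s _ => ((hv1 s).const_mul (c s z)).restrict)]
    have hcont : Integrable (fun t => V z * (((γ t - z) ^ 2)⁻¹ * deriv γ t))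
        (volume.restrict I) := by
      refine Integrable.const_mul ?_ _
      refine Continuous.integrableOn_Icc ?_
      exact (((hγ.continuous.sub continuous_const).pow 2).inv₀
        fun t => pow_ne_zero 2 (sub_ne_zero_of_notMem hzγ t)).mul hγ.continuous_deriv
    have hpt : ∀ t, doubleSlope (H (γ t)) (γ t) z * deriv γ t =
        (((γ t - z) ^ 2)⁻¹ * (V (γ t) * deriv γ t) -
          ∑ s, c s z * ((γ t - z)⁻¹ * (v s (γ t) * deriv γ t))) -
          V z * (((γ t - z) ^ 2)⁻¹ * deriv γ t) := by
      intro t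
      rw [doubleSlope_of_ne (hH0 _) (hH1 _) fun h => hzγ ⟨t, h.symm⟩]
      have h1 : ∑ s, c s z * ((γ t - z)⁻¹ * (v s (γ t) * deriv γ t)) =
          (γ t - z)⁻¹ * deriv γ t * ∑ s, c s z * v s (γ t) := by
        rw [Finset.mul_sum]
        exact Finset.sum_congr rfl fun s _ => by ring
      rw [h1]
      have h2 := sub_ne_zero_of_notMem hzγ t
      simp only [H]
      field_simp
    simp only [hpt]
    have hint : Integrable (fun t => ((γ t - z) ^ 2)⁻¹ * (V (γ t) * deriv γ t) -
        ∑ s, c s z * ((γ t - z)⁻¹ * (v s (γ t) * deriv γ t))) (volume.restrict I) :=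
      hV2.restrict.sub (integrable_finsetSum _ fun s _ => ((hv1 s).const_mul (c s z)).restrict)
    rw [integral_sub hint hcont]
    ring

end Extension

/-! ### Integration by parts along the curve -/

section Pearson

open MeasureTheory

variable {γ : ℝ → ℂ}

/-- γ y converges at both ends because its derivative is integrable; dividing by γ → ∞ gives the
limit 0. -/
theorem tendsto_zero_of_integrable_deriv (hp : Tendsto γ (cocompact ℝ) (cocompact ℂ))
    {y x' : ℝ → ℂ} (hx : ∀ t, HasDerivAt (fun t => γ t * y t) (x' t) t) (hxi : Integrable x') :
    Tendsto y atTop (𝓝 0) ∧ Tendsto y atBot (𝓝 0) := by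
  have key : ∀ l : Filter ℝ, l ≤ cocompact ℝ → (∃ b, Tendsto (fun t => γ t * y t) l (𝓝 b)) →
      Tendsto y l (𝓝 0) := by
    rintro l hl ⟨b, hb⟩
    have h1 : Tendsto γ l (cobounded ℂ) := by
      rw [Metric.cobounded_eq_cocompact]; exact hp.mono_left hl
    have h2 : Tendsto (fun t => (γ t)⁻¹) l (𝓝 0) := tendsto_inv₀_cobounded.comp h1
    have h3 := h2.mul hb
    rw [zero_mul] at h3
    refine h3.congr' ?_
    filter_upwards [h1 (eventually_ne_cobounded 0)] with t ht
    rw [inv_mul_cancel_left₀ ht]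
  refine ⟨key _ atTop_le_cocompact ⟨_, tendsto_limUnder_of_hasDerivAt_of_integrableOn_Ioi
    (a := 0) (fun t _ => hx t) hxi.integrableOn⟩, key _ atBot_le_cocompact
    ⟨_, tendsto_limUnder_of_hasDerivAt_of_integrableOn_Iic (a := 0) (fun t _ => hx t)
      hxi.integrableOn⟩⟩

/-- For k = 0 the truncated exponent k - 1 is harmless, as its term carries the factor k. -/
theorem IsSmoothLine.hasDerivAt_pow_mul (hγ : IsSmoothLine γ) {V : ℂ → ℂ} (hV : Differentiable ℂ V)
    (k : ℕ) (t : ℝ) : HasDerivAt (fun t => γ t ^ k * V (γ t))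
      (k * (γ t ^ (k - 1) * V (γ t) * deriv γ t) + γ t ^ k * deriv V (γ t) * deriv γ t) t := by
  have h1 := (hγ.hasDerivAt t).pow k
  have h2 : HasDerivAt (fun t => V (γ t)) (deriv V (γ t) * deriv γ t) t :=
    (hV (γ t)).hasDerivAt.comp t (hγ.hasDerivAt t)
  refine (h1.mul h2).congr_deriv ?_
  simp only [Pi.pow_apply]
  ring

variable {V : ℂ → ℂ}

theorem IsSmoothLine.tendsto_pow_mul (hγ : IsSmoothLine γ) (hV : Differentiable ℂ V)
    (hi : ∀ k : ℕ, Integrable fun t => γ t ^ k * V (γ t) * deriv γ t)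
    (hi' : ∀ k : ℕ, Integrable fun t => γ t ^ k * deriv V (γ t) * deriv γ t) (k : ℕ) :
    Tendsto (fun t => γ t ^ k * V (γ t)) atTop (𝓝 0) ∧
      Tendsto (fun t => γ t ^ k * V (γ t)) atBot (𝓝 0) := by
  refine tendsto_zero_of_integrable_deriv hγ.proper (fun t => ?_)
    -- One more power of γ is used than the statement contains; it is the one divided out to obtain
    -- the limit 0.
    (((hi (k + 1 - 1)).const_mul ((k + 1 : ℕ) : ℂ)).add (hi' (k + 1)))
  refine (hγ.hasDerivAt_pow_mul hV (k + 1) t).congr_of_eventuallyEq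
    (Eventually.of_forall fun s => ?_)
  simp only
  ring

theorem IsSmoothLine.integral_pow_mul_deriv (hγ : IsSmoothLine γ) (hV : Differentiable ℂ V)
    (hi : ∀ k : ℕ, Integrable fun t => γ t ^ k * V (γ t) * deriv γ t)
    (hi' : ∀ k : ℕ, Integrable fun t => γ t ^ k * deriv V (γ t) * deriv γ t) (k : ℕ) :
    ∫ t, γ t ^ k * deriv V (γ t) * deriv γ t =
      -(k * ∫ t, γ t ^ (k - 1) * V (γ t) * deriv γ t) := by
  have h := hγ.tendsto_pow_mul hV hi hi' k
  have h1 := integral_of_hasDerivAt_of_tendsto (hγ.hasDerivAt_pow_mul hV k)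
    (((hi (k - 1)).const_mul _).add (hi' k)) h.2 h.1
  rw [integral_add ((hi (k - 1)).const_mul _) (hi' k), integral_const_mul, sub_zero] at h1
  linear_combination h1

theorem IsSmoothLine.integral_inv_mul_deriv (hγ : IsSmoothLine γ) (hV : Differentiable ℂ V)
    (hi : ∀ k : ℕ, Integrable fun t => γ t ^ k * V (γ t) * deriv γ t)
    (hi' : ∀ k : ℕ, Integrable fun t => γ t ^ k * deriv V (γ t) * deriv γ t) {z : ℂ}
    (hz : z ∉ Set.range γ) :
    ∫ t, ((γ t - z) ^ 2)⁻¹ * (V (γ t) * deriv γ t) =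
      ∫ t, (γ t - z)⁻¹ * (deriv V (γ t) * deriv γ t) := by
  have h := hγ.tendsto_pow_mul hV hi hi' 0
  have hi0 : Integrable fun t => V (γ t) * deriv γ t := by simpa using hi 0
  have hi0' : Integrable fun t => deriv V (γ t) * deriv γ t := by simpa using hi' 0
  simp only [pow_zero, one_mul] at h
  have hd : ∀ t, HasDerivAt (fun t => (γ t - z)⁻¹ * V (γ t))
      ((γ t - z)⁻¹ * (deriv V (γ t) * deriv γ t) -
        ((γ t - z) ^ 2)⁻¹ * (V (γ t) * deriv γ t)) t := by
    intro t
    have h1 := ((hγ.hasDerivAt t).sub_const z).fun_inv (sub_ne_zero_of_notMem hz t)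
    have h2 : HasDerivAt (fun t => V (γ t)) (deriv V (γ t) * deriv γ t) t :=
      (hV (γ t)).hasDerivAt.comp t (hγ.hasDerivAt t)
    refine (h1.mul h2).congr_deriv ?_
    rw [neg_div, div_eq_mul_inv]
    ring
  have hlim : ∀ l : Filter ℝ, Tendsto (fun t => V (γ t)) l (𝓝 0) →
      Tendsto (fun t => (γ t - z)⁻¹ * V (γ t)) l (𝓝 0) := by
    intro l hl
    refine squeeze_zero_norm (a := fun t => (Metric.infDist z (Set.range γ))⁻¹ * ‖V (γ t)‖)
      (fun t => ?_) (by simpa using hl.norm.const_mul (Metric.infDist z (Set.range γ))⁻¹)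
    rw [norm_mul, norm_inv]
    have h1 := hγ.infDist_pos hz
    have h2 := infDist_le_norm_sub γ z t
    gcongr
  have h1 := integral_of_hasDerivAt_of_tendsto hd
    ((hγ.integrable_inv_mul hz hi0').sub (hγ.integrable_inv_sq_mul hz hi0))
    (hlim _ h.2) (hlim _ h.1)
  rw [integral_sub (hγ.integrable_inv_mul hz hi0') (hγ.integrable_inv_sq_mul hz hi0),
    sub_zero] at h1
  exact (sub_eq_zero.1 h1).symm

end Pearson

/-! ### Derivatives of matrix functions -/

section MatDeriv

variable {m : Type*}

/-- Entrywise derivative at a point. -/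
def HasMatDerivAt (F : ℂ → Matrix m m ℂ) (F' : Matrix m m ℂ) (z : ℂ) : Prop :=
  ∀ i j, HasDerivAt (fun w => F w i j) (F' i j) z

theorem HasMatDerivAt.matDeriv {F : ℂ → Matrix m m ℂ} {F' : Matrix m m ℂ} {z : ℂ}
    (h : HasMatDerivAt F F' z) : matDeriv F z = F' := by
  ext i j; exact (h i j).deriv

theorem IsEntireMat.hasMatDerivAt {F : ℂ → Matrix m m ℂ} (h : IsEntireMat F) (z : ℂ) :
    HasMatDerivAt F (matDeriv F z) z := fun i j => (h i j z).hasDerivAt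

theorem HasMatDerivAt.congr {F G : ℂ → Matrix m m ℂ} {F' : Matrix m m ℂ} {z : ℂ}
    (h : HasMatDerivAt F F' z) (hFG : ∀ᶠ w in 𝓝 z, G w = F w) : HasMatDerivAt G F' z :=
  fun i j => (h i j).congr_of_eventuallyEq (hFG.mono fun w hw => by simp only [hw])

theorem hasMatDerivAt_const (A : Matrix m m ℂ) (z : ℂ) : HasMatDerivAt (fun _ => A) 0 z :=
  fun i j => hasDerivAt_const z (A i j)

theorem HasMatDerivAt.add {F G : ℂ → Matrix m m ℂ} {F' G' : Matrix m m ℂ} {z : ℂ}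
    (hF : HasMatDerivAt F F' z) (hG : HasMatDerivAt G G' z) :
    HasMatDerivAt (fun w => F w + G w) (F' + G') z := fun i j => (hF i j).add (hG i j)

theorem HasMatDerivAt.mul [Fintype m] {F G : ℂ → Matrix m m ℂ} {F' G' : Matrix m m ℂ} {z : ℂ}
    (hF : HasMatDerivAt F F' z) (hG : HasMatDerivAt G G' z) :
    HasMatDerivAt (fun w => F w * G w) (F' * G z + F z * G') z := fun i j => by
  simp only [Matrix.mul_apply, Matrix.add_apply]
  rw [← Finset.sum_add_distrib]
  exact HasDerivAt.fun_sum fun s _ => (hF i s).mul (hG s j)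

theorem HasMatDerivAt.fromBlocks_diag {n : Type*} {F : ℂ → Matrix m m ℂ} {F' : Matrix m m ℂ}
    {G : ℂ → Matrix n n ℂ} {G' : Matrix n n ℂ} {z : ℂ}
    (hF : HasMatDerivAt F F' z) (hG : HasMatDerivAt G G' z) :
    HasMatDerivAt (fun w => Matrix.fromBlocks (F w) 0 0 (G w)) (Matrix.fromBlocks F' 0 0 G') z := by
  rintro (i | i) (j | j)
  · exact hF i j
  · exact hasDerivAt_const z 0
  · exact hasDerivAt_const z 0
  · exact hG i j

theorem HasMatDerivAt.e12 {N : ℕ} {F : ℂ → Mat N} {F' : Mat N} {z : ℂ}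
    (hF : HasMatDerivAt F F' z) : HasMatDerivAt (fun w => e12 (F w)) (_root_.e12 F') z := by
  rintro (i | i) (j | j)
  · exact hasDerivAt_const z 0
  · exact hF i j
  · exact hasDerivAt_const z 0
  · exact hasDerivAt_const z 0

theorem IsEntireMat.add {F G : ℂ → Matrix m m ℂ} (hF : IsEntireMat F) (hG : IsEntireMat G) :
    IsEntireMat fun z => F z + G z := fun i j => (hF i j).add (hG i j)

theorem IsEntireMat.mul [Fintype m] {F G : ℂ → Matrix m m ℂ} (hF : IsEntireMat F) (hG : IsEntireMat G) :
    IsEntireMat fun z => F z * G z :=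
  fun i j z => ((hF.hasMatDerivAt z).mul (hG.hasMatDerivAt z) i j).differentiableAt

theorem isEntireMat_const (A : Matrix m m ℂ) : IsEntireMat fun _ => A :=
  fun _ _ => differentiable_const _

/-- Solutions of a linear homogeneous differential equation that vanish at a point vanish
identically. -/
theorem eq_zero_of_linear_ode [Fintype m] {h : ℂ → Matrix m m ℂ} (hh : IsEntireMat h) {u : ℂ → m → ℂ}
    (hu : ∀ z i, HasDerivAt (fun w => u w i) ((h z *ᵥ u z) i) z) {z₀ : ℂ} (h0 : u z₀ = 0) (z : ℂ) :
    u z = 0 := by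
  -- The equation is restricted to the segment from z₀ to z, where it becomes a real-variable linear
  -- equation to which Grönwall's inequality applies.
  let y : ℝ → m → ℂ := fun t => u (z₀ + t * (z - z₀))
  have hline : ∀ t : ℝ, HasDerivAt (fun t : ℝ => z₀ + (t : ℂ) * (z - z₀)) (z - z₀) t := by
    intro t
    refine (((Complex.ofRealCLM.hasDerivAt (x := t)).mul_const (z - z₀)).const_add z₀).congr_deriv ?_
    simp
  have hy : ∀ t : ℝ, HasDerivAt y ((z - z₀) • (h (z₀ + t * (z - z₀)) *ᵥ y t)) t := by
    intro t
    rw [hasDerivAt_pi]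
    intro i
    refine ((hu (z₀ + t * (z - z₀)) i).comp t (hline t)).congr_deriv ?_
    rw [Pi.smul_apply, smul_eq_mul, mul_comm]
  let k : ℝ → ℝ := fun t => ‖z - z₀‖ * ∑ i, ∑ j, ‖h (z₀ + t * (z - z₀)) i j‖
  have hk : Continuous k := by
    have : ∀ i j, Continuous fun t : ℝ => h (z₀ + t * (z - z₀)) i j := fun i j =>
      (hh i j).continuous.comp (by fun_prop)
    exact continuous_const.mul (continuous_finsetSum _ fun i _ =>
      continuous_finsetSum _ fun j _ => (this i j).norm)
  obtain ⟨K, hK⟩ := (isCompact_Icc.image hk : IsCompact (k '' Set.Icc 0 1)).bddAbove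
  have hbound : ∀ t ∈ Set.Ico (0 : ℝ) 1,
      ‖(z - z₀) • (h (z₀ + t * (z - z₀)) *ᵥ y t)‖ ≤ K * ‖y t‖ + 0 := by
    intro t ht
    have h1 : k t ≤ K := hK ⟨t, ⟨ht.1, ht.2.le⟩, rfl⟩
    have h2 : ‖h (z₀ + t * (z - z₀)) *ᵥ y t‖ ≤
        (∑ i, ∑ j, ‖h (z₀ + t * (z - z₀)) i j‖) * ‖y t‖ := by
      refine (pi_norm_le_iff_of_nonneg (by positivity)).2 fun i => ?_
      rw [Matrix.mulVec, dotProduct]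
      refine (norm_sum_le _ _).trans ?_
      calc _ ≤ ∑ j, ‖h (z₀ + t * (z - z₀)) i j‖ * ‖y t‖ := by
            refine Finset.sum_le_sum fun j _ => ?_
            rw [norm_mul]
            exact mul_le_mul_of_nonneg_left (norm_le_pi_norm _ _) (norm_nonneg _)
        _ = (∑ j, ‖h (z₀ + t * (z - z₀)) i j‖) * ‖y t‖ := by rw [Finset.sum_mul]
        _ ≤ _ := mul_le_mul_of_nonneg_right (Finset.single_le_sum
            (f := fun i => ∑ j, ‖h (z₀ + t * (z - z₀)) i j‖)
            (fun i _ => Finset.sum_nonneg fun j _ => norm_nonneg _) (Finset.mem_univ i))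
            (norm_nonneg _)
    rw [norm_smul, add_zero]
    calc _ ≤ ‖z - z₀‖ * ((∑ i, ∑ j, ‖h (z₀ + t * (z - z₀)) i j‖) * ‖y t‖) := by gcongr
      _ = k t * ‖y t‖ := by simp only [k]; ring
      _ ≤ _ := by gcongr
  have hcont : Continuous y := continuous_iff_continuousAt.2 fun t => (hy t).continuousAt
  have := norm_le_gronwallBound_of_norm_deriv_right_le (f := y) (δ := 0) (K := K) (ε := 0)
    (a := 0) (b := 1) hcont.continuousOn (fun t _ => (hy t).hasDerivWithinAt)
    (by simp [y, h0]) hbound 1 (by simp)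
  rw [gronwallBound_ε0_δ0] at this
  simpa [y] using norm_le_zero_iff.1 this

variable [Fintype m] [DecidableEq m]

theorem differentiableAt_det {n : Type*} [Fintype n] [DecidableEq n] {F : ℂ → Matrix n n ℂ} {z : ℂ}
    (h : ∀ i j, DifferentiableAt ℂ (fun w => F w i j) z) :
    DifferentiableAt ℂ (fun w => (F w).det) z := by
  simp only [Matrix.det_apply]
  refine DifferentiableAt.fun_sum fun σ _ => DifferentiableAt.const_smul ?_ _
  exact DifferentiableAt.fun_finsetProd fun i _ => h (σ i) i

/-- Differentiability comes from the adjugate formula; the value of the derivative is then forced by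
differentiating F F⁻¹ = 1. -/
theorem HasMatDerivAt.inv {F : ℂ → Matrix m m ℂ} {F' : Matrix m m ℂ} {z : ℂ}
    (h : HasMatDerivAt F F' z) (hz : (F z).det ≠ 0) :
    HasMatDerivAt (fun w => (F w)⁻¹) (-((F z)⁻¹ * F' * (F z)⁻¹)) z := by
  have hd : ∀ i j, DifferentiableAt ℂ (fun w => F w i j) z := fun i j => (h i j).differentiableAt
  have hdet := differentiableAt_det hd
  have hinv : ∀ i j, DifferentiableAt ℂ (fun w => (F w)⁻¹ i j) z := by
    intro i j
    simp only [Matrix.inv_def, Matrix.smul_apply, Ring.inverse_eq_inv, smul_eq_mul,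
      Matrix.adjugate_apply]
    refine (hdet.inv hz).mul (differentiableAt_det fun a b => ?_)
    simp only [Matrix.updateRow_apply]
    split_ifs
    · exact differentiableAt_const _
    · exact hd a b
  have hG : HasMatDerivAt (fun w => (F w)⁻¹) (_root_.matDeriv (fun w => (F w)⁻¹) z) z :=
    fun i j => (hinv i j).hasDerivAt
  have h1 : _root_.matDeriv (fun w => F w * (F w)⁻¹) z = 0 := by
    refine ((hasMatDerivAt_const 1 z).congr ?_).matDeriv
    filter_upwards [hdet.continuousAt.eventually_ne hz] with w hw
    exact Matrix.mul_nonsing_inv _ (isUnit_iff_ne_zero.2 hw)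
  rw [(h.mul hG).matDeriv] at h1
  have h2 : _root_.matDeriv (fun w => (F w)⁻¹) z = -((F z)⁻¹ * F' * (F z)⁻¹) := by
    have h3 : F z * _root_.matDeriv (fun w => (F w)⁻¹) z = -(F' * (F z)⁻¹) :=
      eq_neg_of_add_eq_zero_right h1
    rw [← one_mul (_root_.matDeriv _ z), ← Matrix.nonsing_inv_mul _ (isUnit_iff_ne_zero.2 hz), mul_assoc,
      h3, mul_neg, mul_assoc]
  rwa [h2] at hG

theorem hasMatDerivAt_matEval (P : (Matrix m m ℂ)[X]) (z : ℂ) :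
    HasMatDerivAt (matEval P) (matEval (Polynomial.derivative P) z) z := by
  induction P using Polynomial.induction_on' with
  | add p q hp hq =>
    rw [Polynomial.derivative_add, matEval_add]
    exact (hp.add hq).congr (Eventually.of_forall fun w => matEval_add p q w)
  | monomial n a =>
    rw [Polynomial.derivative_monomial, matEval_monomial]
    intro i j
    simp only [matEval_monomial, Matrix.smul_apply, smul_eq_mul]
    refine ((hasDerivAt_pow n z).mul_const (a i j)).congr_deriv ?_
    have : a * (n : Matrix m m ℂ) = (n : ℂ) • a := by
      rw [← Nat.cast_comm, ← nsmul_eq_mul, Nat.cast_smul_eq_nsmul]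
    rw [this, Matrix.smul_apply, smul_eq_mul]
    ring

theorem isEntireMat_matEval (P : (Matrix m m ℂ)[X]) : IsEntireMat (matEval P) :=
  fun i j z => (hasMatDerivAt_matEval P z i j).differentiableAt

/-! ### Invertibility of the factors of the weight -/

/-- Where det F = 0 the matrix inverse has the default value 0 and the definition gives nothing. But
det F · (F' - h F) vanishes identically, and entire functions have no zero divisors. -/
theorem matDeriv_eq_rightLogDeriv_mul {F : ℂ → Matrix m m ℂ} (hF : IsEntireMat F)
    (hdet : ∃ z, (F z).det ≠ 0) (hh : IsEntireMat (rightLogDeriv F)) (z : ℂ) :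
    matDeriv F z = rightLogDeriv F z * F z := by
  have hdetd : Differentiable ℂ fun z => (F z).det := fun z =>
    differentiableAt_det fun i j => hF i j z
  have hprod := hh.mul hF
  ext i j
  have hd : Differentiable ℂ fun z => matDeriv F z i j - (rightLogDeriv F z * F z) i j :=
    (show Differentiable ℂ fun z => deriv (fun w => F w i j) z from (hF i j).deriv).sub (hprod i j)
  have hana : ∀ f : ℂ → ℂ, Differentiable ℂ f → AnalyticOnNhd ℂ f Set.univ := fun f hf z _ =>
    hf.analyticAt z
  have hzero : ∀ z ∈ Set.univ, (F z).det *
      (matDeriv F z i j - (rightLogDeriv F z * F z) i j) = 0 := by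
    intro z _
    by_cases h : (F z).det = 0
    · rw [h, zero_mul]
    · rw [rightLogDeriv, mul_assoc, Matrix.nonsing_inv_mul _ (isUnit_iff_ne_zero.2 h), mul_one,
        sub_self, mul_zero]
  rcases AnalyticOnNhd.eq_zero_or_eq_zero_of_mul_eq_zero (hana _ hdetd) (hana _ hd) hzero
    isPreconnected_univ with h | h
  · obtain ⟨w, hw⟩ := hdet
    exact absurd (h w trivial) hw
  · exact sub_eq_zero.1 (h z trivial)

/-- If F(z) v = 0, then u = F v solves u' = h u with a zero at z. It vanishes identically, so det F
≡ 0. -/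
theorem det_ne_zero_of_rightLogDeriv {F : ℂ → Matrix m m ℂ} (hF : IsEntireMat F)
    (hdet : ∃ z, (F z).det ≠ 0) (hh : IsEntireMat (rightLogDeriv F)) (z : ℂ) : (F z).det ≠ 0 := by
  intro h
  obtain ⟨v, hv, hv0⟩ := Matrix.exists_mulVec_eq_zero_iff.2 h
  obtain ⟨w, hw⟩ := hdet
  refine hw (Matrix.exists_mulVec_eq_zero_iff.1 ⟨v, hv, ?_⟩)
  refine eq_zero_of_linear_ode hh (u := fun z => F z *ᵥ v) (fun z i => ?_) hv0 w
  rw [Matrix.mulVec_mulVec, ← matDeriv_eq_rightLogDeriv_mul hF ⟨w, hw⟩ hh]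
  simp only [Matrix.mulVec, dotProduct]
  exact HasDerivAt.fun_sum fun j _ => (hF.hasMatDerivAt z i j).mul_const (v j)

theorem leftLogDeriv_eq_transpose (F : ℂ → Matrix m m ℂ) (z : ℂ) :
    leftLogDeriv F z = (rightLogDeriv (fun w => (F w)ᵀ) z)ᵀ := by
  rw [leftLogDeriv, rightLogDeriv, Matrix.transpose_mul, ← Matrix.transpose_nonsing_inv,
    Matrix.transpose_transpose]
  rfl

theorem isEntireMat_rightLogDeriv_transpose {F : ℂ → Matrix m m ℂ}
    (hh : IsEntireMat (leftLogDeriv F)) : IsEntireMat (rightLogDeriv fun w => (F w)ᵀ) := by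
  intro i j
  have := hh j i
  simp only [leftLogDeriv_eq_transpose, Matrix.transpose_apply] at this
  exact this

theorem det_ne_zero_of_leftLogDeriv {F : ℂ → Matrix m m ℂ} (hF : IsEntireMat F)
    (hdet : ∃ z, (F z).det ≠ 0) (hh : IsEntireMat (leftLogDeriv F)) (z : ℂ) : (F z).det ≠ 0 := by
  have := det_ne_zero_of_rightLogDeriv (F := fun w => (F w)ᵀ) (fun i j => hF j i)
    (hdet.imp fun z hz => by rwa [Matrix.det_transpose])
    (isEntireMat_rightLogDeriv_transpose hh) z
  rwa [Matrix.det_transpose] at this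

theorem matDeriv_eq_mul_leftLogDeriv {F : ℂ → Matrix m m ℂ} {z : ℂ} (hz : (F z).det ≠ 0) :
    matDeriv F z = F z * leftLogDeriv F z := by
  rw [leftLogDeriv, ← mul_assoc, Matrix.mul_nonsing_inv _ (isUnit_iff_ne_zero.2 hz), one_mul]

end MatDeriv

section Structure

open MeasureTheory

variable {N : ℕ} {γ : ℝ → ℂ} {W WL WR : ℂ → Mat N}

/-! ### The Cauchy transform of the weight -/

theorem IsWeight.integrable_pow_mul (hW : IsWeight γ W) (i j : Fin N) (k : ℕ) :
    Integrable fun t => γ t ^ k * (W (γ t) i j * deriv γ t) := by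
  simpa only [mul_assoc] using hW k i j

/-- The derivative of the Cauchy transform of the weight. -/
def cauchyDeriv (γ : ℝ → ℂ) (W : ℂ → Mat N) (z : ℂ) : Mat N :=
  curveInt γ fun w => ((w - z) ^ 2)⁻¹ • W w

theorem cauchyMoment_zero_apply (z : ℂ) (i j : Fin N) :
    cauchyMoment γ W 0 z i j = (2 * (Real.pi : ℂ) * Complex.I)⁻¹ *
      ∫ t, (γ t - z)⁻¹ * (W (γ t) i j * deriv γ t) := by
  simp only [cauchyMoment, curveInt, Matrix.of_apply, Matrix.smul_apply, smul_eq_mul, pow_zero,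
    mul_one, mul_assoc]

theorem cauchyDeriv_apply (z : ℂ) (i j : Fin N) :
    cauchyDeriv γ W z i j = (2 * (Real.pi : ℂ) * Complex.I)⁻¹ *
      ∫ t, ((γ t - z) ^ 2)⁻¹ * (W (γ t) i j * deriv γ t) := by
  simp only [cauchyDeriv, curveInt, Matrix.of_apply, Matrix.smul_apply, smul_eq_mul, mul_assoc]

theorem moment_apply (k : ℕ) (i j : Fin N) :
    moment γ W k i j = (2 * (Real.pi : ℂ) * Complex.I)⁻¹ *
      ∫ t, γ t ^ k * (W (γ t) i j * deriv γ t) := by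
  simp only [moment, curveInt, Matrix.of_apply, Matrix.smul_apply, smul_eq_mul, mul_assoc]

theorem hasMatDerivAt_cauchyMoment (hγ : IsSmoothLine γ) (hW : IsWeight γ W) {z : ℂ}
    (hz : z ∉ Set.range γ) : HasMatDerivAt (cauchyMoment γ W 0) (cauchyDeriv γ W z) z := by
  intro i j
  simp only [cauchyMoment_zero_apply, cauchyDeriv_apply]
  exact (hγ.hasDerivAt_cauchyTransform (by simpa using hW.integrable_pow_mul i j 0) hz).const_mul _

theorem hasLaurentExpansion_of_coeff {m : Type*} [Fintype m] [DecidableEq m] {Γ : Set ℂ}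
    {F : ℂ → Matrix m m ℂ} {f : LaurentSeries (Matrix m m ℂ)} (h0 : ∀ l < 0, f.coeff l = 0)
    (h : HasAsymptoticExpansion Γ F fun l => f.coeff l) : HasLaurentExpansion Γ F f := by
  rw [eq_ofPowerSeries h0]
  exact HasAsymptoticExpansion.hasLaurentExpansion (by simpa only [PowerSeries.coeff_mk] using h)

theorem HasLaurentExpansion.coeff {m : Type*} [Fintype m] [DecidableEq m] {Γ : Set ℂ}
    {F : ℂ → Matrix m m ℂ} {f : LaurentSeries (Matrix m m ℂ)} (h0 : ∀ l < 0, f.coeff l = 0)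
    (h : HasLaurentExpansion Γ F f) : HasAsymptoticExpansion Γ F fun l => f.coeff l := by
  rw [eq_ofPowerSeries h0] at h
  simpa only [PowerSeries.coeff_mk] using h.hasAsymptoticExpansion

theorem HasAsymptoticExpansion.e12 {Γ : Set ℂ} {F : ℂ → Mat N} {a : ℕ → BMat N} {b : ℕ → Mat N}
    (h : HasAsymptoticExpansion Γ F b) (hab : ∀ l, a l = e12 (b l)) :
    HasAsymptoticExpansion Γ (fun z => _root_.e12 (F z)) a := by
  rw [funext hab]
  rw [hasAsymptoticExpansion_iff] at h ⊢
  rintro c hc k K (i | i) (j | j)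
  · exact ExpansionUpTo.zero K
  · exact h c hc k K i j
  · exact ExpansionUpTo.zero K
  · exact ExpansionUpTo.zero K

theorem hasLaurentExpansion_cauchyMoment (hγ : IsSmoothLine γ) (hW : IsWeight γ W) :
    HasLaurentExpansion (Set.range γ) (fun z => e12 (cauchyMoment γ W 0 z)) (formalF γ W) := by
  refine hasLaurentExpansion_of_coeff (fun l hl => coeff_stieltjes_of_nonpos _ _ hl.le) ?_
  let b : ℕ → Mat N := fun l => Nat.casesOn l 0 fun l => -moment γ W l
  refine HasAsymptoticExpansion.e12 (b := b) ?_ ?_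
  · rw [hasAsymptoticExpansion_iff]
    intro c hc k K i j
    simp only [cauchyMoment_zero_apply]
    let a : ℕ → ℂ := fun l => Nat.casesOn l 0 fun l => -∫ t, γ t ^ l * (W (γ t) i j * deriv γ t)
    refine ((hγ.expansionUpTo_cauchyTransform (a := a) (hW.integrable_pow_mul i j) rfl
      (fun l => rfl) hc k K).const_mul (2 * (Real.pi : ℂ) * Complex.I)⁻¹).congr
      (Eventually.of_forall fun z => rfl) fun l => ?_
    rcases l with _ | l
    · exact mul_zero _
    · simp only [a, b, Matrix.neg_apply, moment_apply, mul_neg]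
  · rintro (_ | l)
    · rw [Nat.cast_zero, formalF, coeff_stieltjes_of_nonpos _ _ le_rfl]
      exact (map_zero e12).symm
    · rw [Nat.cast_succ, formalF, coeff_stieltjes_succ, zero_add, blockMoment]
      exact (map_neg e12 _).symm

theorem hasLaurentExpansion_cauchyDeriv (hγ : IsSmoothLine γ) (hW : IsWeight γ W) :
    HasLaurentExpansion (Set.range γ) (fun z => e12 (cauchyDeriv γ W z))
      (laurentDeriv (formalF γ W)) := by
  refine hasLaurentExpansion_of_coeff (fun l hl => ?_) ?_
  · rw [coeff_laurentDeriv, formalF, coeff_stieltjes_of_nonpos _ _ (by omega), smul_zero]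
  let b : ℕ → Mat N := fun l =>
    Nat.casesOn l 0 fun l => Nat.casesOn l 0 fun l => ((l : ℂ) + 1) • moment γ W l
  refine HasAsymptoticExpansion.e12 (b := b) ?_ ?_
  · rw [hasAsymptoticExpansion_iff]
    intro c hc k K i j
    simp only [cauchyDeriv_apply]
    let a : ℕ → ℂ := fun l => Nat.casesOn l 0 fun l => Nat.casesOn l 0 fun l =>
      (l + 1) * ∫ t, γ t ^ l * (W (γ t) i j * deriv γ t)
    refine ((hγ.expansionUpTo_deriv_cauchyTransform (a := a) (hW.integrable_pow_mul i j) rfl rfl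
      (fun l => rfl) hc k K).const_mul (2 * (Real.pi : ℂ) * Complex.I)⁻¹).congr
      (Eventually.of_forall fun z => rfl) fun l => ?_
    rcases l with _ | _ | l
    · exact mul_zero _
    · exact mul_zero _
    · simp only [a, b, Matrix.smul_apply, moment_apply, smul_eq_mul]
      ring
  · rintro (_ | _ | l)
    · rw [coeff_laurentDeriv, formalF, coeff_stieltjes_of_nonpos _ _ (by simp), smul_zero]
      exact (map_zero e12).symm
    · rw [coeff_laurentDeriv, formalF, coeff_stieltjes_of_nonpos _ _ (by simp), smul_zero]
      exact (map_zero e12).symm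
    · rw [coeff_laurentDeriv, formalF, show ((l + 1 + 1 : ℕ) : ℤ) - 1 = (l : ℤ) + 1 by
        push_cast; ring, coeff_stieltjes_succ, zero_add, blockMoment, smul_neg, ← neg_smul,
        show -(1 - ((l + 1 + 1 : ℕ) : ℤ)) = ((l + 1 : ℕ) : ℤ) by push_cast; ring, natCast_zsmul,
        ← map_nsmul]
      simp only [b]
      rw [← Nat.cast_smul_eq_nsmul ℂ]
      push_cast
      rfl

/-! ### Fundamental matrices off the curve -/

/-- `diag(z^{-n}, z^n)`. -/
def normalizer (N : ℕ) (n : ℕ) (z : ℂ) : BMat N :=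
  Matrix.fromBlocks ((z ^ n)⁻¹ • (1 : Mat N)) 0 0 (z ^ n • (1 : Mat N))

/-- `diag(z^n, z^{-n})`. -/
def normalizerInv (N : ℕ) (n : ℕ) (z : ℂ) : BMat N :=
  Matrix.fromBlocks (z ^ n • (1 : Mat N)) 0 0 ((z ^ n)⁻¹ • (1 : Mat N))

theorem normalizer_mul_inv (n : ℕ) {z : ℂ} (hz : z ≠ 0) :
    normalizer N n z * normalizerInv N n z = 1 := by
  have := pow_ne_zero n hz
  simp [normalizer, normalizerInv, Matrix.fromBlocks_multiply, smul_smul, this,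
    Matrix.fromBlocks_one]

theorem normalizer_conj (n : ℕ) {z : ℂ} (hz : z ≠ 0) (a d : Mat N) :
    normalizer N n z * Matrix.fromBlocks a 0 0 d * normalizerInv N n z =
      Matrix.fromBlocks a 0 0 d := by
  have := pow_ne_zero n hz
  simp [normalizer, normalizerInv, Matrix.fromBlocks_multiply, smul_smul, this]

theorem hasLaurentExpansion_normalizer (n : ℕ) (Γ : Set ℂ) :
    HasLaurentExpansion Γ (normalizer N n) (formalD N n) := by
  refine ((hasLaurentExpansion_inv_pow_smul n (proj1 N)).add
    (hasLaurentExpansion_pow_smul n (proj2 N))).congr fun z _ _ => ?_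
  simp [normalizer, proj1, proj2, Matrix.fromBlocks_smul, Matrix.fromBlocks_add]

theorem hasLaurentExpansion_normalizerInv (n : ℕ) (Γ : Set ℂ) :
    HasLaurentExpansion Γ (normalizerInv N n) (formalD N (-n)) := by
  rw [formalD, neg_neg]
  refine ((hasLaurentExpansion_pow_smul n (proj1 N)).add
    (hasLaurentExpansion_inv_pow_smul n (proj2 N))).congr fun z _ _ => ?_
  simp [normalizerInv, proj1, proj2, Matrix.fromBlocks_smul, Matrix.fromBlocks_add]

theorem one_add_e12_mul (x : Mat N) : (1 + e12 x) * (1 - e12 x) = 1 := by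
  rw [add_mul, mul_sub, mul_sub, e12_mul_e12]; simp

theorem one_add_e12_conj (x a d : Mat N) :
    (1 + e12 x) * Matrix.fromBlocks a 0 0 d * (1 - e12 x) =
      Matrix.fromBlocks a 0 0 d + e12 (x * d - a * x) := by
  have h1 : (1 : BMat N) + e12 x = Matrix.fromBlocks 1 x 0 1 := by
    rw [← Matrix.fromBlocks_one, e12_apply, Matrix.fromBlocks_add]; simp
  have h2 : (1 : BMat N) - e12 x = Matrix.fromBlocks 1 (-x) 0 1 := by
    rw [sub_eq_add_neg, ← Matrix.fromBlocks_one, e12_apply, Matrix.fromBlocks_neg,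
      Matrix.fromBlocks_add]
    simp
  rw [h1, h2, e12_apply]
  simp only [Matrix.fromBlocks_multiply, Matrix.fromBlocks_add]
  simp [sub_eq_add_neg, add_comm]

theorem matEval_fundPoly_mul_inv (hW : IsWeight γ W) (hreg : IsRegularWeight γ W) (n : ℕ) (z : ℂ) :
    matEval (fundPoly γ W n) z * matEval (fundPolyInv γ W n) z = 1 := by
  rw [← matEval_mul, fundPoly_mul_inv hW hreg, matEval_one]

/-- The inverse of the left fundamental matrix. -/
def leftYInv (γ : ℝ → ℂ) (W : ℂ → Mat N) (n : ℕ) (z : ℂ) : BMat N :=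
  (1 - e12 (cauchyMoment γ W 0 z)) * matEval (fundPolyInv γ W n) z

theorem leftY_mul_leftYInv (hγ : IsSmoothLine γ) (hW : IsWeight γ W) (hreg : IsRegularWeight γ W)
    (n : ℕ) {z : ℂ} (hz : z ∉ Set.range γ) : leftY γ W n z * leftYInv γ W n z = 1 := by
  rw [leftY_eq hγ hW hz, leftYInv, ← mul_assoc, mul_assoc _ (1 + _), one_add_e12_mul, mul_one,
    matEval_fundPoly_mul_inv hW hreg]

theorem cauchyMoment_transpose (i : ℕ) (z : ℂ) :
    cauchyMoment γ (transposeWeight W) i z = (cauchyMoment γ W i z)ᵀ := rfl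

/-- Y_n^R is the transpose of Y_n^L for Wᵀ; the anti-automorphism turns its factorization into (1 -
[[0, F], [0, 0]]) V_n⁻¹, that is, (Y_n^L)⁻¹. All right-hand results rest on this. -/
theorem blockJ_mul_rightY (hγ : IsSmoothLine γ) (hW : IsWeight γ W) (hreg : IsRegularWeight γ W)
    (n : ℕ) {z : ℂ} (hz : z ∉ Set.range γ) :
    blockJ N * rightY γ W n z * blockJInv N = leftYInv γ W n z := by
  rw [rightY_eq_transpose hW hreg, ← blockAnti_apply, leftY_eq hγ hW.transpose hz, blockAnti_mul,
    map_add, blockAnti_one, blockAnti_e12, cauchyMoment_transpose, Matrix.transpose_transpose,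
    ← sub_eq_add_neg, ← matEval_polyMap _ blockAnti_smul]
  rfl

theorem eq_blockJInv_mul {A B : BMat N} (h : blockJ N * A * blockJInv N = B) :
    A = blockJInv N * B * blockJ N := by
  rw [← h]
  calc A = 1 * A * 1 := by rw [one_mul, mul_one]
    _ = _ := by rw [← blockJInv_mul]; simp only [mul_assoc]

theorem leftS_inv (hγ : IsSmoothLine γ) (hW : IsWeight γ W) (hreg : IsRegularWeight γ W)
    (n : ℕ) {z : ℂ} (hz : z ∉ Set.range γ) (h0 : z ≠ 0) :
    (leftS γ W n z)⁻¹ = normalizerInv N n z * leftYInv γ W n z := by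
  refine Matrix.inv_eq_right_inv ?_
  change leftY γ W n z * normalizer N n z * (normalizerInv N n z * leftYInv γ W n z) = 1
  rw [← mul_assoc, mul_assoc (leftY γ W n z), normalizer_mul_inv n h0, mul_one,
    leftY_mul_leftYInv hγ hW hreg n hz]

theorem rightS_eq (hγ : IsSmoothLine γ) (hW : IsWeight γ W) (hreg : IsRegularWeight γ W)
    (n : ℕ) {z : ℂ} (hz : z ∉ Set.range γ) (h0 : z ≠ 0) :
    rightS γ W n z = blockJInv N * (leftS γ W n z)⁻¹ * blockJ N := by
  have h1 : blockJ N * normalizer N n z * blockJInv N = normalizerInv N n z := by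
    rw [normalizer, blockJ_conj, normalizerInv]; simp
  rw [leftS_inv hγ hW hreg n hz h0, ← h1, ← blockJ_mul_rightY hγ hW hreg n hz]
  change normalizer N n z * rightY γ W n z = _
  calc _ = 1 * normalizer N n z * 1 * rightY γ W n z * 1 := by simp only [one_mul, mul_one]
    _ = _ := by rw [← blockJInv_mul]; simp only [mul_assoc]

theorem leftS_isUnit (hγ : IsSmoothLine γ) (hW : IsWeight γ W) (hreg : IsRegularWeight γ W)
    (n : ℕ) {z : ℂ} (hz : z ∉ Set.range γ) (h0 : z ≠ 0) : IsUnit (leftS γ W n z).det := by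
  refine Matrix.isUnit_det_of_right_inverse
    (B := normalizerInv N n z * leftYInv γ W n z) ?_
  change leftY γ W n z * normalizer N n z * (normalizerInv N n z * leftYInv γ W n z) = 1
  rw [← mul_assoc, mul_assoc (leftY γ W n z), normalizer_mul_inv n h0, mul_one,
    leftY_mul_leftYInv hγ hW hreg n hz]

theorem rightS_inv (hγ : IsSmoothLine γ) (hW : IsWeight γ W) (hreg : IsRegularWeight γ W)
    (n : ℕ) {z : ℂ} (hz : z ∉ Set.range γ) (h0 : z ≠ 0) :
    (rightS γ W n z)⁻¹ = blockJInv N * leftS γ W n z * blockJ N := by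
  refine Matrix.inv_eq_right_inv ?_
  rw [rightS_eq hγ hW hreg n hz h0]
  calc _ = blockJInv N * ((leftS γ W n z)⁻¹ * (blockJ N * blockJInv N) * leftS γ W n z) *
        blockJ N := by simp only [mul_assoc]
    _ = _ := by rw [blockJ_mul_inv, mul_one,
      Matrix.nonsing_inv_mul _ (leftS_isUnit hγ hW hreg n hz h0), mul_one, blockJInv_mul]

/-! ### Expansions of the normalized fundamental matrices -/

theorem hasLaurentExpansion_one (Γ : Set ℂ) :
    HasLaurentExpansion Γ (fun _ => (1 : BMat N)) 1 := by
  have := hasLaurentExpansion_const (Γ := Γ) (1 : BMat N)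
  rwa [map_one] at this

theorem HasLaurentExpansion.neg {m : Type*} [Fintype m] [DecidableEq m] {Γ : Set ℂ}
    {F : ℂ → Matrix m m ℂ} {f : LaurentSeries (Matrix m m ℂ)}
    (h : HasLaurentExpansion Γ F f) : HasLaurentExpansion Γ (fun z => -F z) (-f) := by
  have := (hasLaurentExpansion_const (Γ := Γ) (-1 : Matrix m m ℂ)).mul h
  rw [map_neg, map_one, show (-1 : LaurentSeries (Matrix m m ℂ)) * f = -f from neg_one_mul f]
    at this
  exact this.congr fun z _ _ => neg_one_mul _

theorem hasAsymptoticExpansion_leftS (hγ : IsSmoothLine γ) (hW : IsWeight γ W)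
    (hreg : IsRegularWeight γ W) (n : ℕ) :
    HasAsymptoticExpansion (Set.range γ) (leftS γ W n) (leftSCoeff γ W n) := by
  have h := (((hasLaurentExpansion_matEval (Γ := Set.range γ) (fundPoly γ W n)).mul
    ((hasLaurentExpansion_one _).add (hasLaurentExpansion_cauchyMoment hγ hW))).mul
    (hasLaurentExpansion_normalizer n _))
  rw [formalS_eq hW hreg, formalS] at h
  refine (h.hasAsymptoticExpansion).congr (fun z hz _ => ?_) fun l => PowerSeries.coeff_mk _ _
  rw [← leftY_eq hγ hW hz]
  rfl

theorem hasAsymptoticExpansion_leftS_inv (hγ : IsSmoothLine γ) (hW : IsWeight γ W)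
    (hreg : IsRegularWeight γ W) (n : ℕ) :
    HasAsymptoticExpansion (Set.range γ) (fun z => (leftS γ W n z)⁻¹)
      (invCoeff (leftSCoeff γ W n)) := by
  have h := (((hasLaurentExpansion_normalizerInv n _).mul
    ((hasLaurentExpansion_one _).add (hasLaurentExpansion_cauchyMoment hγ hW).neg)).mul
    (hasLaurentExpansion_matEval (Γ := Set.range γ) (fundPolyInv γ W n)))
  rw [← sub_eq_add_neg, formalSInv_eq hW hreg, formalSInv_eq_ofPowerSeries] at h
  refine (h.hasAsymptoticExpansion).congr (fun z hz h0 => ?_) fun l => ?_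
  · rw [leftS_inv hγ hW hreg n hz h0, leftYInv, ← mul_assoc, sub_eq_add_neg]
  · rw [PowerSeries.coeff_mk, invCoeff_leftSCoeff hW hreg, rightSCoeff_eq_transpose hW hreg,
      blockAnti_apply]

theorem HasAsymptoticExpansion.conj {m : Type*} [Fintype m] {Γ : Set ℂ} {F : ℂ → Matrix m m ℂ}
    {a : ℕ → Matrix m m ℂ} (h : HasAsymptoticExpansion Γ F a) (A B : Matrix m m ℂ) :
    HasAsymptoticExpansion Γ (fun z => A * F z * B) (fun l => A * a l * B) := by
  rw [hasAsymptoticExpansion_iff] at h ⊢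
  intro c hc k K i j
  refine (ExpansionUpTo.sum Finset.univ fun t _ => (ExpansionUpTo.sum Finset.univ fun s _ =>
    (h c hc k K s t).const_mul (A i s)).const_mul (B t j)).congr
    (Eventually.of_forall fun z => ?_) fun l => ?_
  · simp only [Matrix.mul_apply, mul_comm]
  · simp only [Matrix.mul_apply, mul_comm]

theorem hasAsymptoticExpansion_rightS (hγ : IsSmoothLine γ) (hW : IsWeight γ W)
    (hreg : IsRegularWeight γ W) (n : ℕ) :
    HasAsymptoticExpansion (Set.range γ) (rightS γ W n) (rightSCoeff γ W n) := by
  refine ((hasAsymptoticExpansion_leftS_inv hγ hW hreg n).conj (blockJInv N) (blockJ N)).congr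
    (fun z hz h0 => (rightS_eq hγ hW hreg n hz h0).symm) fun l => ?_
  exact (eq_blockJInv_mul (invCoeff_leftSCoeff hW hreg n l).symm).symm

theorem hasAsymptoticExpansion_rightS_inv (hγ : IsSmoothLine γ) (hW : IsWeight γ W)
    (hreg : IsRegularWeight γ W) (n : ℕ) :
    HasAsymptoticExpansion (Set.range γ) (fun z => (rightS γ W n z)⁻¹)
      (invCoeff (rightSCoeff γ W n)) :=
  ((hasAsymptoticExpansion_leftS hγ hW hreg n).conj (blockJInv N) (blockJ N)).congr
    (fun _ hz h0 => (rightS_inv hγ hW hreg n hz h0).symm)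
    fun l => (invCoeff_rightSCoeff hW hreg n l).symm

/-! ### The structure matrices -/

/-- `F' - h^L F - F h^R`, for the Cauchy transform `F` of the weight. -/
def pearsonDefect (γ : ℝ → ℂ) (W WL WR : ℂ → Mat N) (z : ℂ) : Mat N :=
  cauchyDeriv γ W z - rightLogDeriv WL z * cauchyMoment γ W 0 z -
    cauchyMoment γ W 0 z * leftLogDeriv WR z

/-- `diag(h^L, -h^R)`. -/
def blockH (WL WR : ℂ → Mat N) (z : ℂ) : BMat N :=
  Matrix.fromBlocks (rightLogDeriv WL z) 0 0 (-leftLogDeriv WR z)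

theorem blockH_add_e12_pearsonDefect (z : ℂ) :
    blockH WL WR z + e12 (pearsonDefect γ W WL WR z) = e12 (cauchyDeriv γ W z) +
      (1 + e12 (cauchyMoment γ W 0 z)) * blockH WL WR z * (1 - e12 (cauchyMoment γ W 0 z)) := by
  rw [blockH, one_add_e12_conj, add_left_comm, ← map_add, pearsonDefect]
  congr 2
  rw [mul_neg]
  abel

/-- The product rule for Z = V (1 + [[0, F], [0, 0]]) D with D = diag(W^L, (W^R)⁻¹), for which D'
D⁻¹ = diag(h^L, -h^R). After conjugation by the unipotent factor the only part not yet known to be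
entire is the combination F' - h^L F - F h^R. -/
theorem leftM_eq (hγ : IsSmoothLine γ) (hW : IsWeight γ W) (hreg : IsRegularWeight γ W)
    (hWL : IsEntireMat WL) (hWR : IsEntireMat WR) (hL : ∀ z, (WL z).det ≠ 0)
    (hR : ∀ z, (WR z).det ≠ 0) (n : ℕ) {z : ℂ} (hz : z ∉ Set.range γ) :
    leftM γ W WL WR n z =
      matEval (Polynomial.derivative (fundPoly γ W n)) z * matEval (fundPolyInv γ W n) z +
      matEval (fundPoly γ W n) z * (blockH WL WR z + e12 (pearsonDefect γ W WL WR z)) *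
        matEval (fundPolyInv γ W n) z ∧
    rightM γ W WL WR n z = -(blockJInv N * leftM γ W WL WR n z * blockJ N) := by
  set F := cauchyMoment γ W 0 z
  set D : BMat N := Matrix.fromBlocks (WL z) 0 0 (WR z)⁻¹ with hD
  set D' : BMat N := Matrix.fromBlocks (matDeriv WL z) 0 0 (-((WR z)⁻¹ * matDeriv WR z * (WR z)⁻¹))
    with hD'
  set Di : BMat N := Matrix.fromBlocks (WL z)⁻¹ 0 0 (WR z) with hDi
  have hLu := isUnit_iff_ne_zero.2 (hL z)
  have hRu := isUnit_iff_ne_zero.2 (hR z)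
  have hDDi : D * Di = 1 := by
    rw [hD, hDi, Matrix.fromBlocks_multiply]
    simp [Matrix.mul_nonsing_inv _ hLu, Matrix.nonsing_inv_mul _ hRu, Matrix.fromBlocks_one]
  have hH : D' * Di = blockH WL WR z := by
    rw [hD', hDi, Matrix.fromBlocks_multiply]
    simp [blockH, rightLogDeriv, leftLogDeriv, mul_assoc, Matrix.nonsing_inv_mul _ hRu]
  have hopen : ∀ᶠ w in 𝓝 z, w ∉ Set.range γ := hγ.isClosed_range.isOpen_compl.mem_nhds hz
  have hZ : HasMatDerivAt (leftZ γ W WL WR n)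
      ((matEval (Polynomial.derivative (fundPoly γ W n)) z * (1 + e12 F) +
        matEval (fundPoly γ W n) z * (0 + e12 (cauchyDeriv γ W z))) * D +
        matEval (fundPoly γ W n) z * (1 + e12 F) * D') z := by
    refine (((hasMatDerivAt_matEval (fundPoly γ W n) z).mul ((hasMatDerivAt_const 1 z).add
      (hasMatDerivAt_cauchyMoment hγ hW hz).e12)).mul ((hWL.hasMatDerivAt z).fromBlocks_diag
      ((hWR.hasMatDerivAt z).inv (hR z)))).congr ?_
    filter_upwards [hopen] with w hw
    rw [leftZ, leftY_eq hγ hW hw]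
  have hZinv : leftZ γ W WL WR n z * (Di * leftYInv γ W n z) = 1 := by
    change leftY γ W n z * D * (Di * leftYInv γ W n z) = 1
    rw [← mul_assoc, mul_assoc _ D, hDDi, mul_one, leftY_mul_leftYInv hγ hW hreg n hz]
  have hZu : IsUnit (leftZ γ W WL WR n z).det := Matrix.isUnit_det_of_right_inverse hZinv
  constructor
  · rw [leftM, rightLogDeriv, hZ.matDeriv, Matrix.inv_eq_right_inv hZinv, leftYInv,
      show cauchyMoment γ W 0 z = F from rfl]
    have h2 : e12 (cauchyDeriv γ W z) * (1 - e12 F) = e12 (cauchyDeriv γ W z) := by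
      rw [mul_sub, e12_mul_e12, mul_one, sub_zero]
    rw [blockH_add_e12_pearsonDefect, zero_add, show cauchyMoment γ W 0 z = F from rfl]
    set P := matEval (fundPoly γ W n) z
    set P' := matEval (Polynomial.derivative (fundPoly γ W n)) z
    set Q := matEval (fundPolyInv γ W n) z
    calc _ = P' * ((1 + e12 F) * (D * Di) * (1 - e12 F)) * Q +
          P * (e12 (cauchyDeriv γ W z) * (D * Di) * (1 - e12 F)) * Q +
          P * ((1 + e12 F) * (D' * Di) * (1 - e12 F)) * Q := by
          simp only [add_mul, mul_assoc]
      _ = _ := by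
        rw [hDDi, hH, mul_one, mul_one, one_add_e12_mul, mul_one, h2]
        simp only [mul_add, add_mul, add_assoc]
  · have hG : HasMatDerivAt (fun w => (leftZ γ W WL WR n w)⁻¹) _ z :=
      hZ.inv (isUnit_iff_ne_zero.1 hZu)
    -- Z_n^R = J⁻¹ (Z_n^L)⁻¹ J near z, so differentiating an inverse yields M_n^R = -J⁻¹ M_n^L J.
    have hrel : ∀ w ∉ Set.range γ, rightZ γ W WL WR n w =
        blockJInv N * (leftZ γ W WL WR n w)⁻¹ * blockJ N := by
      intro w hw
      have hLu := isUnit_iff_ne_zero.2 (hL w)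
      have hRu := isUnit_iff_ne_zero.2 (hR w)
      refine eq_blockJInv_mul (Eq.symm (Matrix.inv_eq_right_inv ?_))
      have h1 : blockJ N * rightZ γ W WL WR n w * blockJInv N =
          Matrix.fromBlocks (WL w)⁻¹ 0 0 (WR w) * leftYInv γ W n w := by
        rw [← blockJ_mul_rightY hγ hW hreg n hw, rightZ]
        have h2 : Matrix.fromBlocks (WL w)⁻¹ 0 0 (WR w) =
            blockJ N * Matrix.fromBlocks (WR w) 0 0 (WL w)⁻¹ * blockJInv N := by
          rw [blockJ_conj]; simp
        rw [h2]
        calc _ = blockJ N * Matrix.fromBlocks (WR w) 0 0 (WL w)⁻¹ * 1 * rightY γ W n w *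
              blockJInv N := by simp only [mul_one, mul_assoc]
          _ = _ := by rw [← blockJInv_mul]; simp only [mul_assoc]
      rw [h1, leftZ, ← mul_assoc, mul_assoc (leftY γ W n w), Matrix.fromBlocks_multiply]
      simp only [Matrix.mul_zero, Matrix.zero_mul, add_zero, zero_add,
        Matrix.mul_nonsing_inv _ hLu, Matrix.nonsing_inv_mul _ hRu, Matrix.fromBlocks_one]
      rw [mul_one, leftY_mul_leftYInv hγ hW hreg n hw]
    have hr := (((hasMatDerivAt_const (blockJInv N) z).mul hG).mul
      (hasMatDerivAt_const (blockJ N) z)).congr (G := rightZ γ W WL WR n) (by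
        filter_upwards [hopen] with w hw
        exact hrel w hw)
    have hri : (rightZ γ W WL WR n z)⁻¹ = blockJInv N * leftZ γ W WL WR n z * blockJ N := by
      refine Matrix.inv_eq_right_inv ?_
      rw [hrel z hz]
      calc _ = blockJInv N * ((leftZ γ W WL WR n z)⁻¹ * (blockJ N * blockJInv N) *
            leftZ γ W WL WR n z) * blockJ N := by simp only [mul_assoc]
        _ = _ := by rw [blockJ_mul_inv, mul_one, Matrix.nonsing_inv_mul _ hZu, mul_one,
          blockJInv_mul]
    rw [rightM, leftLogDeriv, hr.matDeriv, hri, leftM, rightLogDeriv, hZ.matDeriv]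
    set Z := leftZ γ W WL WR n z
    simp only [zero_mul, zero_add, mul_zero, add_zero]
    generalize (matEval (Polynomial.derivative (fundPoly γ W n)) z * (1 + e12 F) +
        matEval (fundPoly γ W n) z * (e12 (cauchyDeriv γ W z))) * D +
        matEval (fundPoly γ W n) z * (1 + e12 F) * D' = Z'
    calc _ = -(blockJInv N * (Z * (blockJ N * blockJInv N) * Z⁻¹) * Z' * Z⁻¹ * blockJ N) := by
          simp only [mul_assoc, mul_neg, neg_mul]
      _ = _ := by
        rw [blockJ_mul_inv, mul_one, Matrix.mul_nonsing_inv _ hZu, mul_one]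
        simp only [mul_assoc]

end Structure

section StructureExtension

open MeasureTheory

variable {N : ℕ} {γ : ℝ → ℂ} {W WL WR : ℂ → Mat N}

/-! ### Entire extension of the structure matrices -/

theorem hasMatDerivAt_mul_of_logDeriv (hWL : IsEntireMat WL) (hWR : IsEntireMat WR)
    (hdetL : ∃ z, (WL z).det ≠ 0) (hhL : IsEntireMat (rightLogDeriv WL))
    (hR : ∀ z, (WR z).det ≠ 0) (z : ℂ) :
    HasMatDerivAt (fun w => WL w * WR w)
      (rightLogDeriv WL z * (WL z * WR z) + WL z * WR z * leftLogDeriv WR z) z := by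
  have h := (hWL.hasMatDerivAt z).mul (hWR.hasMatDerivAt z)
  rwa [matDeriv_eq_rightLogDeriv_mul hWL hdetL hhL, matDeriv_eq_mul_leftLogDeriv (hR z),
    mul_assoc, ← mul_assoc (WL z)] at h

theorem exists_entire_pearsonDefect (hγ : IsSmoothLine γ) (hW : IsWeight γ W)
    (hfac : ∀ z ∈ Set.range γ, W z = WL z * WR z) (hWL : IsEntireMat WL) (hWR : IsEntireMat WR)
    (hdetL : ∃ z, (WL z).det ≠ 0) (hhL : IsEntireMat (rightLogDeriv WL))
    (hhR : IsEntireMat (leftLogDeriv WR)) (hR : ∀ z, (WR z).det ≠ 0) :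
    ∃ E : ℂ → Mat N, IsEntireMat E ∧ ∀ z ∉ Set.range γ, E z = pearsonDefect γ W WL WR z := by
  have hγW : ∀ t i j, (WL (γ t) * WR (γ t)) i j = W (γ t) i j := fun t i j => by
    rw [hfac _ (Set.mem_range_self t)]
  have hi : ∀ i j, Integrable fun t => (WL (γ t) * WR (γ t)) i j * deriv γ t := fun i j => by
    simpa only [hγW, pow_zero, one_mul] using hW.integrable_pow_mul i j 0
  have key : ∀ i j, ∃ E : ℂ → ℂ, Differentiable ℂ E ∧ ∀ z ∈ (Set.range γ)ᶜ, E z = _ := fun i j =>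
    -- Entry (i, j) of V' = h^L V + V h^R: the left summands of the index run over the product h^L
    -- V, the right ones over V h^R.
    hγ.exists_entire_extension (ι := Fin N ⊕ Fin N) (V := fun z => (WL z * WR z) i j)
      (c := Sum.elim (fun a z => rightLogDeriv WL z i a) (fun b z => leftLogDeriv WR z b j))
      (v := Sum.elim (fun a z => (WL z * WR z) a j) (fun b z => (WL z * WR z) i b))
      (hWL.mul hWR i j) (by rintro (a | b); exacts [hhL i a, hhR b j])
      (by rintro (a | b); exacts [hWL.mul hWR a j, hWL.mul hWR i b])
      (fun z => by
        rw [(hasMatDerivAt_mul_of_logDeriv hWL hWR hdetL hhL hR z i j).deriv]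
        simp only [Fintype.sum_sum_type, Sum.elim_inl, Sum.elim_inr, Matrix.add_apply]
        rw [Matrix.mul_apply, Matrix.mul_apply]
        simp only [mul_comm]) (hi i j) (by rintro (a | b); exacts [hi a j, hi i b])
  choose E hE hEz using key
  refine ⟨fun z => Matrix.of fun i j => (2 * (Real.pi : ℂ) * Complex.I)⁻¹ * E i j z,
    fun i j => (hE i j).const_mul _, fun z hz => ?_⟩
  ext i j
  change (2 * (Real.pi : ℂ) * Complex.I)⁻¹ * E i j z = _
  rw [hEz i j z hz]
  simp only [Fintype.sum_sum_type, Sum.elim_inl, Sum.elim_inr, hγW, pearsonDefect,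
    Matrix.sub_apply, cauchyDeriv_apply]
  rw [Matrix.mul_apply, Matrix.mul_apply]
  simp only [cauchyMoment_zero_apply]
  simp only [mul_sub, mul_add, Finset.mul_sum, sub_sub]
  simp only [mul_comm, mul_left_comm]

theorem IsEntireMat.e12 {F : ℂ → Mat N} (hF : IsEntireMat F) :
    IsEntireMat fun z => _root_.e12 (F z) := by
  rintro (i | i) (j | j)
  exacts [differentiable_const 0, hF i j, differentiable_const 0, differentiable_const 0]

theorem isEntireMat_blockH (hhL : IsEntireMat (rightLogDeriv WL))
    (hhR : IsEntireMat (leftLogDeriv WR)) : IsEntireMat (blockH WL WR) := by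
  rintro (i | i) (j | j)
  exacts [hhL i j, differentiable_const 0, differentiable_const 0, (hhR i j).neg]

/-- `Y' Y⁻¹ + Y H Y⁻¹` for the polynomial factor `Y` of the fundamental matrix. -/
def structureMat (γ : ℝ → ℂ) (W : ℂ → Mat N) (n : ℕ) (H : ℂ → BMat N) (z : ℂ) : BMat N :=
  matEval (Polynomial.derivative (fundPoly γ W n)) z * matEval (fundPolyInv γ W n) z +
    matEval (fundPoly γ W n) z * H z * matEval (fundPolyInv γ W n) z

theorem leftS_conj (hγ : IsSmoothLine γ) (hW : IsWeight γ W) (hreg : IsRegularWeight γ W)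
    (n : ℕ) {z : ℂ} (hz : z ∉ Set.range γ) (h0 : z ≠ 0) :
    leftS γ W n z * blockH WL WR z * (leftS γ W n z)⁻¹ =
      matEval (fundPoly γ W n) z * ((1 + e12 (cauchyMoment γ W 0 z)) * blockH WL WR z *
        (1 - e12 (cauchyMoment γ W 0 z))) * matEval (fundPolyInv γ W n) z := by
  rw [leftS_inv hγ hW hreg n hz h0, leftYInv]
  change leftY γ W n z * normalizer N n z * _ * _ = _
  rw [leftY_eq hγ hW hz]
  have := normalizer_conj n h0 (rightLogDeriv WL z) (-leftLogDeriv WR z)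
  rw [← blockH] at this
  calc _ = matEval (fundPoly γ W n) z * ((1 + e12 (cauchyMoment γ W 0 z)) *
        (normalizer N n z * blockH WL WR z * normalizerInv N n z) *
        (1 - e12 (cauchyMoment γ W 0 z))) * matEval (fundPolyInv γ W n) z := by
        simp only [mul_assoc]
    _ = _ := by rw [this]

/-- In S_n H S_n⁻¹ - M_n the terms with H cancel and -Y_n' Y_n⁻¹ remains, whose expansion starts at
z⁻¹ or later. No growth condition on h^L or h^R is involved. -/
theorem isPlusPart_structureMat (hγ : IsSmoothLine γ) (hW : IsWeight γ W)
    (hreg : IsRegularWeight γ W) (hhL : IsEntireMat (rightLogDeriv WL))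
    (hhR : IsEntireMat (leftLogDeriv WR)) (n : ℕ) {E : ℂ → Mat N} (hE : IsEntireMat E)
    (hEz : ∀ z ∉ Set.range γ, E z = pearsonDefect γ W WL WR z) :
    IsPlusPart (Set.range γ) (fun z => leftS γ W n z * blockH WL WR z * (leftS γ W n z)⁻¹)
      (structureMat γ W n fun z => blockH WL WR z + e12 (E z)) := by
  constructor
  · exact ((isEntireMat_matEval _).mul (isEntireMat_matEval _)).add
      (((isEntireMat_matEval _).mul ((isEntireMat_blockH hhL hhR).add hE.e12)).mul
        (isEntireMat_matEval _))
  · have h := (((hasLaurentExpansion_matEval (Γ := Set.range γ)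
      (Polynomial.derivative (fundPoly γ W n))).mul (hasLaurentExpansion_matEval
      (fundPolyInv γ W n))).add (((hasLaurentExpansion_matEval (fundPoly γ W n)).mul
      (hasLaurentExpansion_cauchyDeriv hγ hW)).mul
      (hasLaurentExpansion_matEval (fundPolyInv γ W n)))).neg
    rw [← formalLogDeriv] at h
    have h0 : ∀ l ≤ 0, (-formalLogDeriv γ W n).coeff l = 0 := fun l hl => by
      rw [HahnSeries.coeff_neg, coeff_formalLogDeriv hW hreg n hl, neg_zero]
    refine ⟨fun l => (-formalLogDeriv γ W n).coeff l, h0 0 le_rfl, ?_⟩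
    refine (h.coeff fun l hl => h0 l hl.le).congr (fun z hz hz0 => ?_) fun _ => rfl
    beta_reduce
    rw [leftS_conj hγ hW hreg n hz hz0, structureMat, hEz z hz, blockH_add_e12_pearsonDefect]
    simp only [mul_add, add_mul]
    abel

theorem blockJInv_blockH_blockJ (z : ℂ) :
    blockJInv N * blockH WL WR z * blockJ N =
      -Matrix.fromBlocks (leftLogDeriv WR z) 0 0 (-rightLogDeriv WL z) := by
  refine (eq_blockJInv_mul ?_).symm
  rw [Matrix.fromBlocks_neg, blockJ_conj, blockH]
  simp

theorem rightS_conj (hγ : IsSmoothLine γ) (hW : IsWeight γ W) (hreg : IsRegularWeight γ W)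
    (n : ℕ) {z : ℂ} (hz : z ∉ Set.range γ) (h0 : z ≠ 0) :
    (rightS γ W n z)⁻¹ * Matrix.fromBlocks (leftLogDeriv WR z) 0 0 (-rightLogDeriv WL z) *
      rightS γ W n z =
      -(blockJInv N * (leftS γ W n z * blockH WL WR z * (leftS γ W n z)⁻¹) * blockJ N) := by
  rw [rightS_inv hγ hW hreg n hz h0, rightS_eq hγ hW hreg n hz h0,
    ← neg_eq_iff_eq_neg.2 (blockJInv_blockH_blockJ z)]
  simp only [mul_neg, neg_mul]
  calc _ = -(blockJInv N * leftS γ W n z * (blockJ N * blockJInv N) * blockH WL WR z *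
        (blockJ N * blockJInv N) * (leftS γ W n z)⁻¹ * blockJ N) := by simp only [mul_assoc]
    _ = _ := by rw [blockJ_mul_inv]; simp only [mul_one, mul_assoc]

theorem IsPlusPart.conj {m : Type*} [Fintype m] {Γ : Set ℂ} {F E : ℂ → Matrix m m ℂ}
    (h : IsPlusPart Γ F E) (A B : Matrix m m ℂ) :
    IsPlusPart Γ (fun z => A * F z * B) (fun z => A * E z * B) := by
  obtain ⟨hE, a, ha, hFE⟩ := h
  refine ⟨((isEntireMat_const A).mul hE).mul (isEntireMat_const B), _, ?_,
    (hFE.conj A B).congr (fun z _ _ => ?_) fun _ => rfl⟩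
  · rw [ha, mul_zero, zero_mul]
  · rw [mul_sub, sub_mul]

theorem IsPlusPart.congr {m : Type*} {Γ : Set ℂ} {F G E : ℂ → Matrix m m ℂ}
    (h : IsPlusPart Γ F E) (hFG : ∀ z ∉ Γ, z ≠ 0 → F z = G z) : IsPlusPart Γ G E := by
  obtain ⟨hE, a, ha, hFE⟩ := h
  exact ⟨hE, a, ha, hFE.congr (fun z hz h0 => by rw [hFG z hz h0]) fun _ => rfl⟩

end StructureExtension

/-- Three different maps are allowed because block embeddings multiply as matrix units, such as
`e11` times `e12` into `e12`; the zero map expresses vanishing block products. -/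
theorem laurentMap_mul_of {R S : Type*} [Ring R] [Ring S] (τ σ ρ : R →+ S)
    (h : ∀ a b, τ (a * b) = σ a * ρ b) (f g : LaurentSeries R) :
    laurentMap τ (f * g) = laurentMap σ f * laurentMap ρ g := by
  have hs : ∀ (κ : R →+ S) (h : LaurentSeries R), (laurentMap κ h).support ⊆ h.support :=
    fun κ h l hl h0 => hl (by change κ (h.coeff l) = 0; rw [h0, map_zero])
  ext l
  rw [coeff_laurentMap, HahnSeries.coeff_mul, map_sum,
    HahnSeries.coeff_mul_left' f.isPWO_support (hs σ f)]
  have : ∀ ij ∈ Finset.antidiagonal f.isPWO_support (laurentMap ρ g).isPWO_support l,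
      ij ∈ Finset.antidiagonal f.isPWO_support g.isPWO_support l := fun ij h => by
    rw [Finset.mem_antidiagonal] at h ⊢
    exact ⟨h.1, hs ρ g h.2.1, h.2.2⟩
  rw [Finset.sum_subset this]
  · exact Finset.sum_congr rfl fun ij _ => h _ _
  · intro ij h h'
    rw [Finset.mem_antidiagonal] at h h'
    have : (laurentMap ρ g).coeff ij.2 = 0 := by
      by_contra h0
      exact h' ⟨h.1, h0, h.2.2⟩
    rw [this, mul_zero]

section PolynomialCase

open MeasureTheory

variable {N : ℕ} {γ : ℝ → ℂ} {W WL WR : ℂ → Mat N} {hL hR : (Mat N)[X]}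

/-! ### Polynomial logarithmic derivatives -/

/-- `h^L W + W h^R`. -/
def weightDeriv (W : ℂ → Mat N) (hL hR : (Mat N)[X]) (z : ℂ) : Mat N :=
  matEval hL z * W z + W z * matEval hR z

theorem integrable_mul_matEval_mul {g : ℂ → ℂ}
    (hg : ∀ (i : ℕ) (a b : Fin N), Integrable
      fun t : ℝ => g (γ t) * γ t ^ i * W (γ t) a b * deriv γ t) (P : (Mat N)[X]) (a b : Fin N) :
    Integrable fun t => g (γ t) * (matEval P (γ t) * W (γ t)) a b * deriv γ t := by
  have h : (fun t => g (γ t) * (matEval P (γ t) * W (γ t)) a b * deriv γ t) = fun t =>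
      ∑ c, ∑ i ∈ Finset.range (P.natDegree + 1),
        P.coeff i a c * (g (γ t) * γ t ^ i * W (γ t) c b * deriv γ t) := by
    funext t
    simp only [Matrix.mul_apply, matEval_apply, Finset.mul_sum, Finset.sum_mul]
    refine Finset.sum_congr rfl fun c _ => Finset.sum_congr rfl fun i _ => by ring
  rw [h]
  exact integrable_finsetSum _ fun c _ => integrable_finsetSum _ fun i _ => (hg i c b).const_mul _

theorem mul_matEval_eq_transpose (P : (Mat N)[X]) (z : ℂ) :
    W z * matEval P z = (matEval (transposePoly P) z * transposeWeight W z)ᵀ := by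
  rw [Matrix.transpose_mul, matEval_transposePoly, Matrix.transpose_transpose, transposeWeight,
    Matrix.transpose_transpose]

theorem integrable_mul_weightDeriv {g : ℂ → ℂ}
    (hg : ∀ (i : ℕ) (a b : Fin N), Integrable
      fun t : ℝ => g (γ t) * γ t ^ i * W (γ t) a b * deriv γ t) (hL hR : (Mat N)[X])
    (a b : Fin N) :
    Integrable fun t => g (γ t) * (weightDeriv W hL hR (γ t)) a b * deriv γ t := by
  have h1 := integrable_mul_matEval_mul hg hL a b
  have h2 := integrable_mul_matEval_mul (W := transposeWeight W) (fun i a b => hg i b a)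
    (transposePoly hR) b a
  refine (h1.add h2).congr (Eventually.of_forall fun t => ?_)
  simp only [weightDeriv, Pi.add_apply, Matrix.add_apply, mul_matEval_eq_transpose hR,
    Matrix.transpose_apply]
  ring

/-- `lfun` only accepts polynomial coefficients on the left of the moments, so the term W h^R is
treated through its transpose. -/
theorem curveInt_smul_weightDeriv {g : ℂ → ℂ}
    (hg : ∀ (i : ℕ) (a b : Fin N), Integrable
      fun t : ℝ => g (γ t) * γ t ^ i * W (γ t) a b * deriv γ t) (hL hR : (Mat N)[X]) :
    curveInt γ (fun w => g w • weightDeriv W hL hR w) =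
      lfun (fun i => curveInt γ fun w => (g w * w ^ i) • W w) hL +
      (lfun (fun i => curveInt γ fun w => (g w * w ^ i) • transposeWeight W w)
        (transposePoly hR))ᵀ := by
  rw [← curveInt_polynomial_mul hg, ← curveInt_polynomial_mul (W := transposeWeight W)
    (fun i a b => hg i b a), ← curveInt_transpose]
  ext a b
  simp only [curveInt, Matrix.add_apply, Matrix.of_apply, ← mul_add]
  have h1 := integrable_mul_matEval_mul hg hL a b
  have h2 := integrable_mul_matEval_mul (W := transposeWeight W) (fun i a b => hg i b a)
    (transposePoly hR) b a
  congr 1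
  refine Eq.trans ?_ (integral_add h1 h2)
  refine integral_congr_ae (Eventually.of_forall fun t => ?_)
  simp only [weightDeriv, Matrix.add_apply, mul_matEval_eq_transpose hR, Matrix.smul_apply,
    Matrix.transpose_apply, smul_eq_mul]
  ring

/-- The polynomial `F' - h^L F - F h^R`, for the Cauchy transform `F` of the weight. -/
def defectPoly (γ : ℝ → ℂ) (W : ℂ → Mat N) (hL hR : (Mat N)[X]) : (Mat N)[X] :=
  assocPoly (moment γ W) hL +
    transposePoly (assocPoly (moment γ (transposeWeight W)) (transposePoly hR))

/-- The Pearson equation, together with the factorization of the weight. -/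
structure PearsonData (γ : ℝ → ℂ) (W WL WR : ℂ → Mat N) (hL hR : (Mat N)[X]) : Prop where
  factor : ∀ z ∈ Set.range γ, W z = WL z * WR z
  hasMatDerivAt : ∀ z, HasMatDerivAt (fun w => WL w * WR w)
    (matEval hL z * (WL z * WR z) + WL z * WR z * matEval hR z) z
  rightLogDeriv_eq : ∀ z, rightLogDeriv WL z = matEval hL z
  leftLogDeriv_eq : ∀ z, leftLogDeriv WR z = matEval hR z

namespace PearsonData

theorem apply_eq (h : PearsonData γ W WL WR hL hR) (t : ℝ) (i j : Fin N) :
    (WL (γ t) * WR (γ t)) i j = W (γ t) i j := by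
  rw [h.factor _ (Set.mem_range_self t)]

theorem deriv_eq (h : PearsonData γ W WL WR hL hR) (t : ℝ) (i j : Fin N) :
    deriv (fun w => (WL w * WR w) i j) (γ t) = weightDeriv W hL hR (γ t) i j := by
  rw [(h.hasMatDerivAt (γ t) i j).deriv, ← h.factor _ (Set.mem_range_self t), weightDeriv]

theorem differentiable (h : PearsonData γ W WL WR hL hR) (i j : Fin N) :
    Differentiable ℂ fun w => (WL w * WR w) i j :=
  fun z => (h.hasMatDerivAt z i j).differentiableAt

theorem integrable (h : PearsonData γ W WL WR hL hR) (hW : IsWeight γ W) (i j : Fin N) (k : ℕ) :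
    Integrable fun t => γ t ^ k * (WL (γ t) * WR (γ t)) i j * deriv γ t := by
  simpa only [h.apply_eq] using hW k i j

/-- For polynomial h^L and h^R the derivative h^L W + W h^R is a finite combination of the zⁱ W,
hence has all moments. This is what makes integration by parts possible. -/
theorem integrable_deriv (h : PearsonData γ W WL WR hL hR) (hW : IsWeight γ W) (i j : Fin N)
    (k : ℕ) : Integrable fun t =>
      γ t ^ k * deriv (fun w => (WL w * WR w) i j) (γ t) * deriv γ t := by
  simp only [h.deriv_eq]
  exact integrable_mul_weightDeriv (g := fun w => w ^ k)
    (fun i a b => by simpa only [pow_add] using hW (k + i) a b) hL hR i j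

/-- The moments of a weight that satisfies a Pearson equation. -/
theorem moment_recurrence (h : PearsonData γ W WL WR hL hR) (hγ : IsSmoothLine γ)
    (hW : IsWeight γ W) (k : ℕ) :
    lfun (fun i => moment γ W (i + k)) hL +
      (lfun (fun i => moment γ (transposeWeight W) (i + k)) (transposePoly hR))ᵀ =
      -(k • moment γ W (k - 1)) := by
  have h1 := curveInt_smul_weightDeriv (g := fun w => w ^ k) (W := W)
    (fun i a b => by simpa only [pow_add] using hW (k + i) a b) hL hR
  simp only [← pow_add, add_comm k] at h1
  change _ = lfun (fun i => moment γ W (i + k)) hL +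
    (lfun (fun i => moment γ (transposeWeight W) (i + k)) (transposePoly hR))ᵀ at h1
  rw [← h1]
  ext i j
  have h2 := hγ.integral_pow_mul_deriv (h.differentiable i j) (h.integrable hW i j)
    (h.integrable_deriv hW i j) k
  simp only [h.deriv_eq, h.apply_eq] at h2
  rw [Matrix.neg_apply, Matrix.smul_apply, nsmul_eq_mul]
  simp only [curveInt, Matrix.of_apply, Matrix.smul_apply, smul_eq_mul, h2, moment]
  ring

/-- By parts, F' is the Cauchy transform of h^L W + W h^R. Replacing h^L(w) and h^R(w) by their
values at z produces h^L F + F h^R, at the cost of the associated polynomials. -/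
theorem pearsonDefect_eq (h : PearsonData γ W WL WR hL hR) (hγ : IsSmoothLine γ)
    (hW : IsWeight γ W) {z : ℂ} (hz : z ∉ Set.range γ) :
    pearsonDefect γ W WL WR z = matEval (defectPoly γ W hL hR) z := by
  have h1 := curveInt_smul_weightDeriv (g := fun w => (w - z)⁻¹)
    (integrable_cauchyMoment hγ hW hz) hL hR
  have h2 : curveInt γ (fun w => (w - z)⁻¹ • weightDeriv W hL hR w) = cauchyDeriv γ W z := by
    ext i j
    have h3 := hγ.integral_inv_mul_deriv (h.differentiable i j) (h.integrable hW i j)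
      (h.integrable_deriv hW i j) hz
    simp only [h.deriv_eq, h.apply_eq] at h3
    rw [cauchyDeriv_apply, h3]
    simp only [curveInt, Matrix.of_apply, Matrix.smul_apply, smul_eq_mul, mul_assoc]
  have h3 := lfun_eq_matEval (q := fun i => cauchyMoment γ W i z) (cauchyMoment_succ hγ hW hz) hL
  have h4 := lfun_eq_matEval (q := fun i => cauchyMoment γ (transposeWeight W) i z)
    (cauchyMoment_succ hγ hW.transpose hz) (transposePoly hR)
  rw [h2] at h1
  change _ = lfun (fun i => cauchyMoment γ W i z) hL +
    (lfun (fun i => cauchyMoment γ (transposeWeight W) i z) (transposePoly hR))ᵀ at h1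
  rw [h3, h4, Matrix.transpose_add, Matrix.transpose_mul, matEval_transposePoly,
    Matrix.transpose_transpose, cauchyMoment_transpose, Matrix.transpose_transpose] at h1
  rw [pearsonDefect, h1, h.rightLogDeriv_eq, h.leftLogDeriv_eq, defectPoly, matEval_add,
    matEval_transposePoly]
  abel

/-- The Pearson equation for the formal Stieltjes transform of the weight. -/
theorem polyToLaurent_defectPoly (h : PearsonData γ W WL WR hL hR) (hγ : IsSmoothLine γ)
    (hW : IsWeight γ W) :
    polyToLaurent (defectPoly γ W hL hR) = laurentDeriv (stieltjes (moment γ W) 0) -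
      polyToLaurent hL * stieltjes (moment γ W) 0 -
      stieltjes (moment γ W) 0 * polyToLaurent hR := by
  set T : Mat N →+ Mat N := (Matrix.transposeAddEquiv (Fin N) (Fin N) ℂ).toAddMonoidHom with hT
  have hTa : ∀ a, T a = aᵀ := fun _ => rfl
  have hTm : ∀ a b, T (a * b) = T b * T a := fun a b => Matrix.transpose_mul a b
  have h1 : laurentDeriv (stieltjes (moment γ W) 0) = secondKind (moment γ W) hL +
      laurentMap T (secondKind (moment γ (transposeWeight W)) (transposePoly hR)) := by
    ext1
    funext l
    rw [HahnSeries.coeff_add, coeff_laurentDeriv, coeff_laurentMap]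
    rcases int_cases_pos l with ⟨k, rfl⟩ | hl
    · rw [coeff_secondKind_succ, coeff_secondKind_succ, map_neg, ← neg_add, hTa,
        h.moment_recurrence hγ hW k, neg_neg]
      rcases k with _ | k
      · simp [coeff_stieltjes_of_nonpos]
      · rw [show ((k + 1 : ℕ) : ℤ) + 1 - 1 = (k : ℤ) + 1 by push_cast; ring,
          coeff_stieltjes_succ, smul_neg, ← neg_smul, zero_add,
          show -(1 - (((k + 1 : ℕ) : ℤ) + 1)) = ((k + 1 : ℕ) : ℤ) by ring, natCast_zsmul]
        rfl
    · rw [coeff_stieltjes_of_nonpos _ _ (by omega), secondKind, secondKind,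
        coeff_stieltjes_of_nonpos _ _ hl, coeff_stieltjes_of_nonpos _ _ hl]
      simp
  have h2 : laurentMap T (stieltjes (moment γ (transposeWeight W)) 0) =
      stieltjes (moment γ W) 0 := laurentMap_stieltjes _ _ _
  have h3 : polyMap T (transposePoly hR) = hR := transposePoly_transposePoly hR
  rw [h1, secondKind_eq, secondKind_eq, laurentMap_add, laurentMap_mul_anti T hTm, h2,
    laurentMap_polyToLaurent, laurentMap_polyToLaurent, h3, defectPoly, map_add]
  change _ + polyToLaurent (polyMap T _) = _
  abel

end PearsonData

/-! ### The structure matrices as polynomials -/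

/-- The lower right block. -/
def e22 : Mat N →+ BMat N where
  toFun x := Matrix.fromBlocks 0 0 0 x
  map_zero' := by simp
  map_add' x y := by simp [Matrix.fromBlocks_add]

theorem e22_apply (x : Mat N) : e22 x = Matrix.fromBlocks 0 0 0 x := rfl

/-- `diag(h^L, -h^R)`. -/
def diagPoly (hL hR : (Mat N)[X]) : (BMat N)[X] := polyMap e11 hL + polyMap e22 (-hR)

theorem coeff_diagPoly (hL hR : (Mat N)[X]) (k : ℕ) :
    (diagPoly hL hR).coeff k = Matrix.fromBlocks (hL.coeff k) 0 0 (-hR.coeff k) := by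
  rw [diagPoly, Polynomial.coeff_add, coeff_polyMap, coeff_polyMap, Polynomial.coeff_neg,
    e11_apply, e22_apply, Matrix.fromBlocks_add]
  simp

theorem matEval_neg {m : Type*} [Fintype m] [DecidableEq m] (P : (Matrix m m ℂ)[X]) (z : ℂ) :
    matEval (-P) z = -matEval P z := by simp only [matEval_eq_hom, map_neg]

theorem matEval_diagPoly (hL hR : (Mat N)[X]) (z : ℂ) :
    matEval (diagPoly hL hR) z = Matrix.fromBlocks (matEval hL z) 0 0 (-matEval hR z) := by
  rw [diagPoly, matEval_add, matEval_polyMap e11 (fun c x => by simp [e11_apply,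
    Matrix.fromBlocks_smul]), matEval_polyMap e22 (fun c x => by simp [e22_apply,
    Matrix.fromBlocks_smul]), e11_apply, e22_apply, Matrix.fromBlocks_add, matEval_neg]
  simp

theorem natDegree_diagPoly_le (hL hR : (Mat N)[X]) :
    (diagPoly hL hR).natDegree ≤ max hL.natDegree hR.natDegree := by
  refine Polynomial.natDegree_le_iff_coeff_eq_zero.2 fun k hk => ?_
  rw [coeff_diagPoly, Polynomial.coeff_eq_zero_of_natDegree_lt ((le_max_left _ _).trans_lt hk),
    Polynomial.coeff_eq_zero_of_natDegree_lt ((le_max_right _ _).trans_lt hk)]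
  simp

theorem formalF_eq_laurentMap : formalF γ W = laurentMap e12 (stieltjes (moment γ W) 0) :=
  (laurentMap_stieltjes _ _ _).symm

theorem laurentMap_zero {R S : Type*} [Ring R] [Ring S] (f : LaurentSeries R) :
    laurentMap (0 : R →+ S) f = 0 := by
  ext l; simp [coeff_laurentMap]

theorem laurentMap_laurentDeriv {R S : Type*} [Ring R] [Ring S] (τ : R →+ S)
    (f : LaurentSeries R) : laurentMap τ (laurentDeriv f) = laurentDeriv (laurentMap τ f) := by
  ext l; simp only [coeff_laurentMap, coeff_laurentDeriv, map_zsmul]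

theorem laurentMap_sub {R S : Type*} [Ring R] [Ring S] (τ : R →+ S) (f g : LaurentSeries R) :
    laurentMap τ (f - g) = laurentMap τ f - laurentMap τ g := by
  ext l; simp [coeff_laurentMap]

theorem diagPoly_mul_formalF (hL hR : (Mat N)[X]) :
    polyToLaurent (diagPoly hL hR) * formalF γ W =
      laurentMap e12 (polyToLaurent hL * stieltjes (moment γ W) 0) := by
  rw [diagPoly, map_add, add_mul, formalF_eq_laurentMap, ← laurentMap_polyToLaurent,
    ← laurentMap_polyToLaurent, laurentMap_mul_of e12 e11 e12,
    ← laurentMap_mul_of 0 e22 e12, laurentMap_zero, add_zero]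
  · intro a b
    simp [e22_apply, e12_apply, Matrix.fromBlocks_multiply]
  · intro a b
    simp [e11_apply, e12_apply, Matrix.fromBlocks_multiply]

theorem formalF_mul_diagPoly (hL hR : (Mat N)[X]) :
    formalF γ W * polyToLaurent (diagPoly hL hR) =
      laurentMap e12 (stieltjes (moment γ W) 0 * polyToLaurent (-hR)) := by
  rw [diagPoly, map_add, mul_add, formalF_eq_laurentMap, ← laurentMap_polyToLaurent,
    ← laurentMap_polyToLaurent, laurentMap_mul_of e12 e12 e22,
    ← laurentMap_mul_of 0 e12 e11, laurentMap_zero, zero_add]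
  · intro a b
    simp [e11_apply, e12_apply, Matrix.fromBlocks_multiply]
  · intro a b
    simp [e22_apply, e12_apply, Matrix.fromBlocks_multiply]

/-- Formal counterpart of `blockH_add_e12_pearsonDefect`; the term quadratic in F vanishes since F
diag(h^L, -h^R) stays in the upper right block. -/
theorem PearsonData.polyToLaurent_diagPoly_add (h : PearsonData γ W WL WR hL hR)
    (hγ : IsSmoothLine γ) (hW : IsWeight γ W) :
    polyToLaurent (diagPoly hL hR + polyMap e12 (defectPoly γ W hL hR)) =
      laurentDeriv (formalF γ W) +
        (1 + formalF γ W) * polyToLaurent (diagPoly hL hR) * (1 - formalF γ W) := by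
  have h0 : formalF γ W * polyToLaurent (diagPoly hL hR) * formalF γ W = 0 := by
    rw [formalF_mul_diagPoly, formalF_eq_laurentMap, ← laurentMap_mul_of 0 e12 e12,
      laurentMap_zero]
    intro a b
    rw [e12_mul_e12]; rfl
  have h1 : (1 + formalF γ W) * polyToLaurent (diagPoly hL hR) * (1 - formalF γ W) =
      polyToLaurent (diagPoly hL hR) + formalF γ W * polyToLaurent (diagPoly hL hR) -
      polyToLaurent (diagPoly hL hR) * formalF γ W -
      formalF γ W * polyToLaurent (diagPoly hL hR) * formalF γ W := by
    simp only [add_mul, mul_sub, one_mul, mul_one]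
    abel
  rw [h1, h0, formalF_mul_diagPoly, diagPoly_mul_formalF, map_add, ← laurentMap_polyToLaurent e12,
    h.polyToLaurent_defectPoly hγ hW, laurentMap_sub, laurentMap_sub, laurentMap_laurentDeriv,
    ← formalF_eq_laurentMap, map_neg, mul_neg]
  have h2 : laurentMap e12 (-(stieltjes (moment γ W) 0 * polyToLaurent hR)) =
      -laurentMap e12 (stieltjes (moment γ W) 0 * polyToLaurent hR) := by
    ext l; simp [coeff_laurentMap]
  rw [h2]
  abel

/-- The left structure matrix, as a polynomial. -/
def structurePoly (γ : ℝ → ℂ) (W : ℂ → Mat N) (hL hR : (Mat N)[X]) (n : ℕ) : (BMat N)[X] :=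
  Polynomial.derivative (fundPoly γ W n) * fundPolyInv γ W n +
    fundPoly γ W n * (diagPoly hL hR + polyMap e12 (defectPoly γ W hL hR)) * fundPolyInv γ W n

/-- As a Laurent series the structure polynomial is Y_n' Y_n⁻¹ + S_n H S_n⁻¹. The first summand has
only negative powers of z, so the second determines all the coefficients. -/
theorem PearsonData.coeff_structurePoly (h : PearsonData γ W WL WR hL hR)
    (hγ : IsSmoothLine γ) (hW : IsWeight γ W) (hreg : IsRegularWeight γ W) (n k : ℕ) :
    (structurePoly γ W hL hR n).coeff k = prodCoeff (leftSCoeff γ W n)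
      (fun l => Matrix.fromBlocks (hL.coeff l) 0 0 (-hR.coeff l))
      (max hL.natDegree hR.natDegree) (invCoeff (leftSCoeff γ W n)) k := by
  have h1 : polyToLaurent (structurePoly γ W hL hR n) = formalLogDeriv γ W n +
      formalS γ W n * polyToLaurent (diagPoly hL hR) * formalSInv γ W n := by
    rw [← formal_conj hW hreg n, structurePoly, map_add, map_mul, map_mul, map_mul,
      h.polyToLaurent_diagPoly_add hγ hW, formalLogDeriv]
    · simp only [mul_add, add_mul, add_assoc]
    · intro k
      rw [coeff_diagPoly, proj1, Matrix.fromBlocks_multiply, Matrix.fromBlocks_multiply]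
      simp
    · intro k
      rw [coeff_diagPoly, proj2, Matrix.fromBlocks_multiply, Matrix.fromBlocks_multiply]
      simp
  rw [← coeff_polyToLaurent_neg, h1, HahnSeries.coeff_add,
    coeff_formalLogDeriv hW hreg n (by omega), zero_add, formalS, formalSInv_eq_ofPowerSeries,
    coeff_ofPowerSeries_mul_polyToLaurent_mul _ _ _ (natDegree_diagPoly_le hL hR)]
  congr 1
  · funext l; exact coeff_diagPoly hL hR l
  · funext l
    rw [invCoeff_leftSCoeff hW hreg, rightSCoeff_eq_transpose hW hreg, blockAnti_apply]

theorem matEval_structurePoly (n : ℕ) (z : ℂ) :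
    matEval (structurePoly γ W hL hR n) z = structureMat γ W n (fun z =>
      Matrix.fromBlocks (matEval hL z) 0 0 (-matEval hR z) +
        e12 (matEval (defectPoly γ W hL hR) z)) z := by
  rw [structurePoly, structureMat, matEval_add, matEval_mul, matEval_mul, matEval_mul, matEval_add,
    matEval_diagPoly, matEval_polyMap e12 e12_smul]

end PolynomialCase

/-! ### Degrees of the structure matrices, passage from left to right, and the main theorem -/

section DegreeAndMain

variable {N : ℕ} {γ : ℝ → ℂ} {W WL WR : ℂ → Mat N} {hL hR : (Mat N)[X]}

theorem prodCoeff_of_lt {R : Type*} [Ring R] (a H b : ℕ → R) {d k : ℕ} (h : d < k) :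
    prodCoeff a H d b k = 0 := by
  rw [prodCoeff, Finset.Icc_eq_empty (not_le.2 h), Finset.sum_empty]

theorem prodCoeff_self {R : Type*} [Ring R] {a b : ℕ → R} (H : ℕ → R) (ha : a 0 = 1)
    (hb : b 0 = 1) (d : ℕ) : prodCoeff a H d b d = H d := by
  simp [prodCoeff, ha, hb]

/-- Used with x = J⁻¹ and y = J to carry the coefficient formula from M_n^L to M_n^R; the sign comes
from J⁻¹ diag(h^L, -h^R) J = -diag(h^R, -h^L). -/
theorem prodCoeff_conj {R : Type*} [Ring R] {a b a' b' H H' : ℕ → R} {x y : R} (hxy : y * x = 1)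
    (ha : ∀ l, a' l = x * a l * y) (hb : ∀ l, b' l = x * b l * y)
    (hH : ∀ l, H' l = -(x * H l * y)) (d k : ℕ) :
    prodCoeff a' H' d b' k = -(x * prodCoeff a H d b k * y) := by
  simp only [prodCoeff, Finset.mul_sum, Finset.sum_mul, ← Finset.sum_neg_distrib]
  refine Finset.sum_congr rfl fun l _ => Finset.sum_congr rfl fun i _ => ?_
  rw [ha, hb, hH]
  calc _ = -(x * a i * (y * x) * H l * (y * x) * b (l - k - i) * y) := by
        simp only [mul_assoc, mul_neg, neg_mul]
    _ = _ := by rw [hxy]; simp only [mul_one, mul_assoc]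

/-- A polynomial whose coefficients of degree greater than `d = max (deg P) (deg Q)` vanish, and
whose coefficient of degree `d` vanishes only if those of `P` and `Q` do, has degree `d`. -/
theorem degree_eq_max_of_coeff {R S : Type*} [Ring R] [Ring S] {P Q : R[X]} {M : S[X]}
    (h : ∀ k, max P.natDegree Q.natDegree < k → M.coeff k = 0)
    (h' : M.coeff (max P.natDegree Q.natDegree) = 0 ↔
      P.coeff (max P.natDegree Q.natDegree) = 0 ∧ Q.coeff (max P.natDegree Q.natDegree) = 0) :
    M.degree = max P.degree Q.degree := by
  have hle : M.natDegree ≤ max P.natDegree Q.natDegree :=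
    Polynomial.natDegree_le_iff_coeff_eq_zero.2 h
  by_cases h0 : M.coeff (max P.natDegree Q.natDegree) = 0
  · obtain ⟨hP, hQ⟩ := h'.1 h0
    -- The polynomial of larger `natDegree` has its leading coefficient at the index d, so it is 0.
    -- Then d = 0, and the other polynomial is a constant equal to 0.
    have key : P = 0 ∧ Q = 0 := by
      rcases le_total P.natDegree Q.natDegree with hPQ | hPQ
      · rw [max_eq_right hPQ] at hP hQ
        have hQ0 : Q = 0 := Polynomial.leadingCoeff_eq_zero.1 hQ
        rw [hQ0, Polynomial.natDegree_zero, Nat.le_zero] at hPQ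
        rw [hQ0, Polynomial.natDegree_zero, ← hPQ] at hP
        exact ⟨Polynomial.leadingCoeff_eq_zero.1 hP, hQ0⟩
      · rw [max_eq_left hPQ] at hP hQ
        have hP0 : P = 0 := Polynomial.leadingCoeff_eq_zero.1 hP
        rw [hP0, Polynomial.natDegree_zero, Nat.le_zero] at hPQ
        rw [hP0, Polynomial.natDegree_zero, ← hPQ] at hQ
        exact ⟨hP0, Polynomial.leadingCoeff_eq_zero.1 hQ⟩
    obtain ⟨rfl, rfl⟩ := key
    simp only [Polynomial.natDegree_zero, max_self] at hle h0
    rw [Polynomial.eq_C_of_natDegree_le_zero hle, h0]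
    simp
  · have hM : M.degree = ((max P.natDegree Q.natDegree : ℕ) : WithBot ℕ) :=
      le_antisymm (Polynomial.natDegree_le_iff_degree_le.1 hle) (Polynomial.le_degree_of_ne_zero h0)
    refine le_antisymm ?_ (hM ▸ max_le ?_ ?_)
    · rw [hM]
      have h1 : P.coeff (max P.natDegree Q.natDegree) ≠ 0 ∨
          Q.coeff (max P.natDegree Q.natDegree) ≠ 0 := by
        by_contra! hcon
        exact h0 (h'.2 hcon)
      rcases h1 with h1 | h1
      · exact (Polynomial.le_degree_of_ne_zero h1).trans (le_max_left _ _)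
      · exact (Polynomial.le_degree_of_ne_zero h1).trans (le_max_right _ _)
    · exact Polynomial.degree_le_natDegree.trans (by exact_mod_cast le_max_left _ _)
    · exact Polynomial.degree_le_natDegree.trans (by exact_mod_cast le_max_right _ _)

theorem fromBlocks_diag_eq_zero_iff (a d : Mat N) :
    Matrix.fromBlocks a 0 0 d = 0 ↔ a = 0 ∧ d = 0 := by
  rw [← Matrix.fromBlocks_zero, Matrix.fromBlocks_inj]
  tauto

theorem invCoeff_zero {R : Type*} [Ring R] (s : ℕ → R) : invCoeff s 0 = 1 := by
  rw [invCoeff]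

theorem rightSCoeff_zero (n : ℕ) : rightSCoeff γ W n 0 = 1 := by cases n <;> rfl

theorem isUnit_det_leftY (hγ : IsSmoothLine γ) (hW : IsWeight γ W) (hreg : IsRegularWeight γ W)
    (n : ℕ) {z : ℂ} (hz : z ∉ Set.range γ) : IsUnit (leftY γ W n z).det :=
  Matrix.isUnit_det_of_right_inverse (leftY_mul_leftYInv hγ hW hreg n hz)

theorem isUnit_det_rightY (hγ : IsSmoothLine γ) (hW : IsWeight γ W) (hreg : IsRegularWeight γ W)
    (n : ℕ) {z : ℂ} (hz : z ∉ Set.range γ) : IsUnit (rightY γ W n z).det := by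
  rw [rightY_eq_transpose hW hreg, Matrix.det_transpose]
  exact isUnit_det_leftY hγ hW.transpose hreg.transpose n hz

/-- The left and right structure matrices, when the logarithmic derivatives are polynomials. -/
theorem exists_structure_polynomials (hγ : IsSmoothLine γ) (hW : IsWeight γ W)
    (hreg : IsRegularWeight γ W) (h : PearsonData γ W WL WR hL hR) (n : ℕ)
    (hM : ∀ z ∉ Set.range γ, leftM γ W WL WR n z =
      structureMat γ W n (fun z => blockH WL WR z + e12 (pearsonDefect γ W WL WR z)) z ∧
      rightM γ W WL WR n z = -(blockJInv N * leftM γ W WL WR n z * blockJ N)) :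
    ∃ ML MR : (BMat N)[X],
      (∀ z ∉ Set.range γ, leftM γ W WL WR n z = matEval ML z) ∧
      (∀ z ∉ Set.range γ, rightM γ W WL WR n z = matEval MR z) ∧
      ML.degree = max hL.degree hR.degree ∧
      MR.degree = max hL.degree hR.degree ∧
      (∀ k, ML.coeff k =
        prodCoeff (leftSCoeff γ W n)
          (fun l => Matrix.fromBlocks (hL.coeff l) 0 0 (-hR.coeff l))
          (max hL.natDegree hR.natDegree) (invCoeff (leftSCoeff γ W n)) k) ∧
      (∀ k, MR.coeff k =
        prodCoeff (invCoeff (rightSCoeff γ W n))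
          (fun l => Matrix.fromBlocks (hR.coeff l) 0 0 (-hL.coeff l))
          (max hL.natDegree hR.natDegree) (rightSCoeff γ W n) k) := by
  set ML := structurePoly γ W hL hR n
  set MR : (BMat N)[X] := -(Polynomial.C (blockJInv N) * ML * Polynomial.C (blockJ N))
  have hML := h.coeff_structurePoly hγ hW hreg n
  have hMR : ∀ k, MR.coeff k =
      prodCoeff (invCoeff (rightSCoeff γ W n))
        (fun l => Matrix.fromBlocks (hR.coeff l) 0 0 (-hL.coeff l))
        (max hL.natDegree hR.natDegree) (rightSCoeff γ W n) k := fun k => by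
    rw [Polynomial.coeff_neg, Polynomial.coeff_mul_C, Polynomial.coeff_C_mul, hML]
    refine (prodCoeff_conj blockJ_mul_inv (invCoeff_rightSCoeff hW hreg n) (fun l => ?_)
      (fun l => ?_) _ _).symm
    · exact eq_blockJInv_mul (invCoeff_leftSCoeff hW hreg n l).symm
    · rw [← neg_eq_iff_eq_neg]
      refine eq_blockJInv_mul ?_
      rw [Matrix.fromBlocks_neg, blockJ_conj]
      simp
  have hMLz : ∀ z ∉ Set.range γ, leftM γ W WL WR n z = matEval ML z := fun z hz => by
    rw [(hM z hz).1, matEval_structurePoly, structureMat, structureMat,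
      h.pearsonDefect_eq hγ hW hz, blockH, h.rightLogDeriv_eq, h.leftLogDeriv_eq]
  refine ⟨ML, MR, hMLz, fun z hz => ?_, degree_eq_max_of_coeff (fun k hk => ?_) ?_,
    degree_eq_max_of_coeff (fun k hk => ?_) ?_, hML, hMR⟩
  · rw [(hM z hz).2, hMLz z hz, matEval_neg, matEval_mul, matEval_mul, matEval_C, matEval_C]
  · rw [hML, prodCoeff_of_lt _ _ _ hk]
  · rw [hML, prodCoeff_self _ (leftSCoeff_zero n) (invCoeff_zero _), fromBlocks_diag_eq_zero_iff,
      neg_eq_zero]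
  · rw [hMR, prodCoeff_of_lt _ _ _ hk]
  · rw [hMR, prodCoeff_self _ (invCoeff_zero _) (rightSCoeff_zero n), fromBlocks_diag_eq_zero_iff,
      neg_eq_zero, and_comm]

end DegreeAndMain

end

theorem mainTheorem4 {N : ℕ} (γ : ℝ → ℂ) (hγ : IsSmoothLine γ)
    (W WL WR : ℂ → Mat N)
    (hW : IsWeight γ W) (hreg : IsRegularWeight γ W)
    (hfac : ∀ z ∈ Set.range γ, W z = WL z * WR z)
    (hWL : IsEntireMat WL) (hWR : IsEntireMat WR)
    (hdetL : ∃ z, (WL z).det ≠ 0) (hdetR : ∃ z, (WR z).det ≠ 0)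
    (hhL : IsEntireMat (rightLogDeriv WL)) (hhR : IsEntireMat (leftLogDeriv WR))
    (n : ℕ) :
    -- the objects are well defined
    (IsLeftOP γ W n (leftOP γ W n) ∧ IsRightOP γ W n (rightOP γ W n) ∧
      IsUnit (normMat γ W n).det ∧
      leftMoment γ W n n = (normMat γ W n)⁻¹ ∧ rightMoment γ W n n = (normMat γ W n)⁻¹ ∧
      (∀ z, IsUnit (WL z).det ∧ IsUnit (WR z).det) ∧
      (∀ z ∉ Set.range γ, IsUnit (leftY γ W n z).det ∧ IsUnit (rightY γ W n z).det)) ∧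
    -- the left structure matrix
    (∃ M : ℂ → BMat N,
      (∀ z ∉ Set.range γ, leftM γ W WL WR n z = M z) ∧
      IsPlusPart (Set.range γ)
        (fun z => leftS γ W n z *
          Matrix.fromBlocks (rightLogDeriv WL z) 0 0 (-leftLogDeriv WR z) *
          (leftS γ W n z)⁻¹) M) ∧
    -- the right structure matrix
    (∃ M : ℂ → BMat N,
      (∀ z ∉ Set.range γ, rightM γ W WL WR n z = M z) ∧
      IsPlusPart (Set.range γ)
        (fun z => (rightS γ W n z)⁻¹ *
          Matrix.fromBlocks (leftLogDeriv WR z) 0 0 (-rightLogDeriv WL z) *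
          rightS γ W n z) M) ∧
    -- the asymptotic expansions of the normalized fundamental matrices and their inverses
    (HasAsymptoticExpansion (Set.range γ) (leftS γ W n) (leftSCoeff γ W n) ∧
      HasAsymptoticExpansion (Set.range γ) (fun z => (leftS γ W n z)⁻¹)
        (invCoeff (leftSCoeff γ W n)) ∧
      HasAsymptoticExpansion (Set.range γ) (rightS γ W n) (rightSCoeff γ W n) ∧
      HasAsymptoticExpansion (Set.range γ) (fun z => (rightS γ W n z)⁻¹)
        (invCoeff (rightSCoeff γ W n))) ∧
    -- the case of polynomial logarithmic derivatives
    (∀ hL hR : (Mat N)[X],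
      (∀ z, rightLogDeriv WL z = matEval hL z) → (∀ z, leftLogDeriv WR z = matEval hR z) →
      ∃ ML MR : (BMat N)[X],
        (∀ z ∉ Set.range γ, leftM γ W WL WR n z = matEval ML z) ∧
        (∀ z ∉ Set.range γ, rightM γ W WL WR n z = matEval MR z) ∧
        ML.degree = max hL.degree hR.degree ∧
        MR.degree = max hL.degree hR.degree ∧
        (∀ k, ML.coeff k =
          prodCoeff (leftSCoeff γ W n)
            (fun l => Matrix.fromBlocks (hL.coeff l) 0 0 (-hR.coeff l))
            (max hL.natDegree hR.natDegree) (invCoeff (leftSCoeff γ W n)) k) ∧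
        (∀ k, MR.coeff k =
          prodCoeff (invCoeff (rightSCoeff γ W n))
            (fun l => Matrix.fromBlocks (hR.coeff l) 0 0 (-hL.coeff l))
            (max hL.natDegree hR.natDegree) (rightSCoeff γ W n) k)) := by
  have hL := det_ne_zero_of_rightLogDeriv hWL hdetL hhL
  have hR := det_ne_zero_of_leftLogDeriv hWR hdetR hhR
  have hM := fun z (hz : z ∉ Set.range γ) => leftM_eq hγ hW hreg hWL hWR hL hR n hz
  have hC := isUnit_leftMoment hW hreg n
  have hCinv : leftMoment γ W n n = (normMat γ W n)⁻¹ :=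
    (Matrix.nonsing_inv_nonsing_inv _ hC).symm
  obtain ⟨E, hE, hEz⟩ := exists_entire_pearsonDefect hγ hW hfac hWL hWR hdetL hhL hhR hR
  have hplus := isPlusPart_structureMat hγ hW hreg hhL hhR n hE hEz
  have hMz : ∀ z ∉ Set.range γ, leftM γ W WL WR n z =
      structureMat γ W n (fun z => blockH WL WR z + e12 (E z)) z := fun z hz => by
    rw [(hM z hz).1, structureMat, hEz z hz]
  refine ⟨⟨leftOP_spec hW hreg n, (rightOP_eq hW hreg n).1,
    Matrix.isUnit_nonsing_inv_det _ hC, hCinv, (rightMoment_self hW hreg n).trans hCinv,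
    fun z => ⟨isUnit_iff_ne_zero.2 (hL z), isUnit_iff_ne_zero.2 (hR z)⟩,
    fun z hz => ⟨isUnit_det_leftY hγ hW hreg n hz, isUnit_det_rightY hγ hW hreg n hz⟩⟩,
    -- M_n^R = -J⁻¹ M_n^L J, and S_n^R obeys the same conjugation rule; the sign is carried by the
    -- left factor.
    ⟨_, hMz, hplus⟩, ⟨_, fun z hz => ?_, (hplus.conj (-blockJInv N) (blockJ N)).congr
      fun z hz h0 => ?_⟩,
    ⟨hasAsymptoticExpansion_leftS hγ hW hreg n, hasAsymptoticExpansion_leftS_inv hγ hW hreg n,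
      hasAsymptoticExpansion_rightS hγ hW hreg n, hasAsymptoticExpansion_rightS_inv hγ hW hreg n⟩,
    fun pL pR hpL hpR => exists_structure_polynomials hγ hW hreg ⟨hfac, fun z => ?_, hpL, hpR⟩ n hM⟩
  · rw [(hM z hz).2, hMz z hz, neg_mul, neg_mul]
  · rw [rightS_conj hγ hW hreg n hz h0, neg_mul, neg_mul]
  · have := hasMatDerivAt_mul_of_logDeriv hWL hWR hdetL hhL hR z
    rwa [hpL, hpR] at this
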